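/- Let $q\in(-1,1)$ and let $\nu$ be a compactly supported probability measure on $\mathbb{R}$. Put $\mathcal{H}=L^2(\mathbb{R}_+,dt)\otimes L^2(\mathbb{R},\nu)$ and let $\mathcal{F}_q(\mathcal{H})$ be the $q$-Fock space: the completion of $\mathbb{C}\Omega\oplus\bigoplus_{n\ge1}\mathcal{H}^{\otimes n}$ for the inner product $$\langle \xi_1\otimes\cdots\otimes\xi_n,\ \eta_1\otimes\cdots\otimes\eta_k\rangle_q=\delta_{nk}\sum_{\sigma\in \mathrm{Sym}(n)}q^{i(\sigma)}\prod_{j=1}^n\langle\xi_j,\eta_{\sigma(j)}\rangle ,$$ where $i(\sigma)$ is the number of inversions of $\sigma$ and $\Omega$ is the vacuum vector. For $\zeta\in\mathcal{H}$ and a bounded operator $T$ on $\mathcal{H}$ let $a^*(\zeta)$, $a(\zeta)$, $p(T)$ be the bounded operators on $\mathcal{F}_q(\mathcal{H})$ with $$a^*(\zeta)\,\eta_1\otimes\cdots\otimes\eta_n=\zeta\otimes\eta_1\otimes\cdots\otimes\eta_n,\qquad a(\zeta)\,\eta_1\otimes\cdots\otimes\eta_n=\sum_{k=1}^n q^{k-1}\langle\zeta,\eta_k\rangle\,\eta_1\otimes\cdots\otimes\check\eta_k\otimes\cdots\otimes\eta_n,$$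 $$p(T)\,\eta_1\otimes\cdots\otimes\eta_n=\sum_{k=1}^n q^{k-1}(T\eta_k)\otimes\eta_1\otimes\cdots\otimes\check\eta_k\otimes\cdots\otimes\eta_n ,$$ where $\check\eta_k$ means that $\eta_k$ is omitted, and $a^*(\zeta)\Omega=\zeta$, $a(\zeta)\Omega=0$, $p(T)\Omega=0$. Let $\mathcal{D}\subset\mathcal{H}$ be the complex span of the functions $\chi_{[a,b)}(t)\,x^{k-1}$, where $0\le a\le b$, $k\ge1$. For $g\in\mathcal{D}$ let $T_g$ be the multiplication by $x\,g(t,x)$ and let $X(g)=a(\bar g)+a^*(g)+p(T_g)$. Put $Y_k(s)=X(\chi_{[0,s)}\otimes x^{k-1})$ for $k\ge1$, $s\ge0$ (so that $Y_1$ is the $q$-Lévy process $X$), and let $\mathcal{A}_{X,\Delta}$ be the von Neumann algebra generated by all the operators $Y_k(s)$. Define the Wick products recursively by $W(\Omega)=\mathrm{Id}$ and, for $\eta_0,\dots,\eta_n\in\mathcal{D}$, $$W(\eta_0\otimes\cdots\otimes\eta_n)=X(\eta_0)W(\eta_1\otimes\cdots\otimes\eta_n)-\sum_{i=1}^nq^{i-1}\langle\bar\eta_0,\eta_i\rangle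 W(\eta_1\otimes\cdots\otimes\check\eta_i\otimes\cdots\otimes\eta_n)-\sum_{i=1}^nq^{i-1}W((T_{\eta_0}\eta_i)\otimes\eta_1\otimes\cdots\otimes\check\eta_i\otimes\cdots\otimes\eta_n).$$ **Proposition.** The algebra $\mathcal{A}_{X,\Delta}$ has no normal tracial states except, possibly, the vacuum state. That is: let $\tau$ be a normal (i.e. ultraweakly continuous) tracial state on $\mathcal{A}_{X,\Delta}$. Then for all $k>0$ and $\eta_1,\dots,\eta_k\in\mathcal{D}$, the Wick product $W(\eta_1\otimes\cdots\otimes\eta_k)$ lies in $\mathcal{A}_{X,\Delta}$ and $\tau[W(\eta_1\otimes\cdots\otimes\eta_k)]=0$; and $\tau(A)=\langle\Omega,A\Omega\rangle_q$ for every $A\in\mathcal{A}_{X,\Delta}$. -/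

import Mathlib

open MeasureTheory
open scoped ENNReal InnerProductSpace

noncomputable section

namespace QLevy

/-! ## Positivity of the `q`-deformed inner product -/

/-- The number of inversions of a permutation of `{0, …, n - 1}`. -/
def inversions {n : ℕ} (σ : Equiv.Perm (Fin n)) : ℕ :=
  (Finset.univ.filter fun p : Fin n × Fin n => p.1 < p.2 ∧ σ p.2 < σ p.1).card

section Kernel

open scoped ComplexOrder

variable {H : Type*} [NormedAddCommGroup H] [InnerProductSpace ℂ H]

/-- The `q`-inner product `⟨ξ₁ ⊗ ⋯ ⊗ ξₙ, η₁ ⊗ ⋯ ⊗ ηₖ⟩_q` of two simple tensors (given as the lists of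
their factors; the empty list is the vacuum):
`δ_{nk} ∑_{σ ∈ Sym(n)} q ^ i(σ) ∏ⱼ ⟨ξⱼ, η_{σ(j)}⟩`. -/
def qKernel (q : ℝ) (l l' : List H) : ℂ :=
  if l.length = l'.length then
    ∑ σ : Equiv.Perm (Fin l.length),
      (q : ℂ) ^ inversions σ * ∏ i : Fin l.length, ⟪l.getD i 0, l'.getD (σ i) 0⟫_ℂ
  else 0

open Matrix in
lemma posSemidef_prod {α ι : Type*} (s : Finset ι) (A : ι → Matrix α α ℂ)
    (hA : ∀ i, (A i).PosSemidef) : (Matrix.of fun a b => ∏ i ∈ s, A i a b).PosSemidef := by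
  classical
  induction s using Finset.induction_on with
  | empty =>
    have h := (Matrix.PosSemidef.one (n := Unit) (R := ℂ)).submatrix (fun _ : α => ())
    convert h using 1
    ext a b
    simp
  | insert i s hi ih =>
    have h := (hA i).hadamard ih
    have e : (Matrix.of fun a b => ∏ j ∈ insert i s, A j a b) =
        A i ⊙ Matrix.of fun a b => ∏ j ∈ s, A j a b := by
      ext a b
      simp [Finset.prod_insert hi]
    rw [e]
    exact h

lemma posSemidef_gram {E : Type*} [NormedAddCommGroup E] [InnerProductSpace ℂ E] {α : Type*}
    (v : α → E) : (Matrix.of fun a b => ⟪v a, v b⟫_ℂ).PosSemidef := by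
  refine ⟨by ext a b; simp, fun x => ?_⟩
  have h : (x.sum fun i xi => x.sum fun j xj => star xi * ⟪v i, v j⟫_ℂ * xj) =
      ⟪x.sum fun i xi => xi • v i, x.sum fun i xi => xi • v i⟫_ℂ := by
    simp only [Finsupp.sum]
    rw [sum_inner]
    refine Finset.sum_congr rfl fun i _ => ?_
    rw [inner_smul_left, inner_sum, Finset.mul_sum]
    refine Finset.sum_congr rfl fun j _ => ?_
    rw [inner_smul_right, starRingEnd_apply]
    ring
  simp only [Matrix.of_apply]
  rw [h, inner_self_eq_norm_sq_to_K]
  simp only [Complex.coe_algebraMap]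
  rw [← Complex.ofReal_pow, Complex.zero_le_real]
  exact sq_nonneg _

lemma posSemidef_rankOne {α : Type*} (s : α → ℂ) :
    (Matrix.of fun a b => star (s a) * s b).PosSemidef := by
  have h := posSemidef_gram s
  convert h using 1
  ext a b
  simp [mul_comm]

open Matrix in
lemma posSemidef_sumOut {α P : Type*} [Fintype P] (M : Matrix (α × P) (α × P) ℂ)
    (hM : M.PosSemidef) :
    (Matrix.of fun a b => ∑ τ, ∑ σ, M (a, τ) (b, σ)).PosSemidef := by
  classical
  refine ⟨?_, fun x => ?_⟩
  · ext a b
    simp only [Matrix.conjTranspose_apply, Matrix.of_apply, star_sum]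
    rw [Finset.sum_comm]
    refine Finset.sum_congr rfl fun τ _ => Finset.sum_congr rfl fun σ _ => ?_
    exact hM.1.apply _ _
  · have h := hM.2 (Finsupp.onFinset (x.support ×ˢ Finset.univ) (fun p => x p.1)
      (fun p hp => by simpa using hp))
    rw [Finsupp.sum_of_support_subset _ Finsupp.support_onFinset_subset _ (by simp)] at h
    simp only [Finsupp.onFinset_apply] at h
    convert h using 1
    rw [Finset.sum_product, Finsupp.sum]
    refine Finset.sum_congr rfl fun a _ => ?_
    have : ∀ τ, (Finsupp.onFinset (x.support ×ˢ (Finset.univ : Finset P)) (fun p => x p.1)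
        (fun p hp => by simpa using hp)).sum (fun j xj => star (x a) * M (a, τ) j * xj)
        = ∑ b ∈ x.support, ∑ σ, star (x a) * M (a, τ) (b, σ) * x b := by
      intro τ
      rw [Finsupp.sum_of_support_subset _ Finsupp.support_onFinset_subset _ (by simp),
        Finset.sum_product]
      simp
    simp only [this]
    rw [Finset.sum_comm, Finsupp.sum]
    refine Finset.sum_congr rfl fun b _ => ?_
    simp [Finset.mul_sum, Finset.sum_mul]

lemma pow_inversions {n : ℕ} (q : ℝ) (τ σ : Equiv.Perm (Fin n)) :
    (q : ℂ) ^ inversions (σ * τ⁻¹) =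
      ∏ e ∈ Finset.univ.filter (fun e : Fin n × Fin n => e.1 < e.2),
        (if (τ e.1 < τ e.2 ↔ σ e.1 < σ e.2) then (1 : ℂ) else q) := by
  rw [Finset.prod_ite, Finset.prod_const_one, one_mul, Finset.prod_const, inversions]
  congr 1
  refine Finset.card_bij'
    (fun p _ => (min (τ⁻¹ p.1) (τ⁻¹ p.2), max (τ⁻¹ p.1) (τ⁻¹ p.2)))
    (fun p _ => (min (τ p.1) (τ p.2), max (τ p.1) (τ p.2))) ?_ ?_ ?_ ?_
  · rintro ⟨a, b⟩ h
    obtain ⟨a, rfl⟩ := τ.surjective a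
    obtain ⟨b, rfl⟩ := τ.surjective b
    simp at h ⊢
    grind
  · rintro ⟨a, b⟩ h
    rw [Finset.mem_filter, Finset.mem_filter] at h
    have hab : a < b := h.1.2
    have h0 : ¬(τ a < τ b ↔ σ a < σ b) := h.2
    have h1 : τ a ≠ τ b := by simpa using hab.ne
    have h2 : σ a ≠ σ b := by simpa using hab.ne
    rw [Finset.mem_filter]
    refine ⟨Finset.mem_univ _, ?_⟩
    rcases lt_or_gt_of_ne h1 with h3 | h3
    · have h4 : σ b < σ a := by
        rcases lt_or_gt_of_ne h2 with h4 | h4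
        · exact absurd ⟨fun _ => h4, fun _ => h3⟩ h0
        · exact h4
      simp [min_eq_left h3.le, max_eq_right h3.le, h3, h4]
    · have h4 : σ a < σ b := by
        by_contra h4
        exact h0 ⟨fun h => absurd h h3.not_gt, fun h => absurd h h4⟩
      simp [min_eq_right h3.le, max_eq_left h3.le, h3, h4]
  · rintro ⟨a, b⟩ h
    obtain ⟨a, rfl⟩ := τ.surjective a
    obtain ⟨b, rfl⟩ := τ.surjective b
    rw [Finset.mem_filter] at h
    have hab : τ a < τ b := h.2.1
    rcases le_total a b with h3 | h3 <;> simp [h3, hab.le]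
  · rintro ⟨a, b⟩ h
    rw [Finset.mem_filter, Finset.mem_filter] at h
    have hab : a < b := h.1.2
    rcases le_total (τ a) (τ b) with h3 | h3 <;> simp [h3, hab.le]

lemma posSemidef_level {q : ℝ} (hq : q ∈ Set.Ioo (-1 : ℝ) 1) (n : ℕ) :
    (Matrix.of fun ξ η : Fin n → H => ∑ σ : Equiv.Perm (Fin n),
      (q : ℂ) ^ inversions σ * ∏ i, ⟪ξ i, η (σ i)⟫_ℂ).PosSemidef := by
  classical
  have hq1 : (0 : ℝ) ≤ (1 + q) / 2 := by linarith [hq.1]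
  have hq2 : (0 : ℝ) ≤ (1 - q) / 2 := by linarith [hq.2]
  -- the sign of a pair under a permutation
  let s (e : Fin n × Fin n) (p : (Fin n → H) × Equiv.Perm (Fin n)) : ℂ :=
    if p.2 e.1 < p.2 e.2 then 1 else -1
  have hS := posSemidef_prod (Finset.univ.filter (fun e : Fin n × Fin n => e.1 < e.2))
    (fun e => (((1 + q) / 2 : ℝ) : ℂ) • (Matrix.of fun a b : (Fin n → H) × Equiv.Perm (Fin n) =>
        star (1 : ℂ) * 1) + (((1 - q) / 2 : ℝ) : ℂ) • (Matrix.of fun a b => star (s e a) * s e b))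
    (fun e => ((posSemidef_rankOne fun _ => 1).smul (by exact_mod_cast hq1)).add
      ((posSemidef_rankOne (s e)).smul (by exact_mod_cast hq2)))
  have hG := posSemidef_prod Finset.univ
    (fun i => Matrix.of fun a b : (Fin n → H) × Equiv.Perm (Fin n) => ⟪a.1 (a.2 i), b.1 (b.2 i)⟫_ℂ)
    (fun i => posSemidef_gram fun p : (Fin n → H) × Equiv.Perm (Fin n) => p.1 (p.2 i))
  have hT := (posSemidef_sumOut _ (hS.hadamard hG)).smul
    (a := ((n.factorial : ℝ)⁻¹ : ℂ)) (by positivity)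
  convert hT using 1
  ext ξ η
  simp only [Matrix.smul_apply, Matrix.of_apply, Matrix.hadamard_apply, Matrix.add_apply,
    smul_eq_mul]
  have key : ∀ τ : Equiv.Perm (Fin n), (∑ σ : Equiv.Perm (Fin n),
      (∏ e ∈ Finset.univ.filter (fun e : Fin n × Fin n => e.1 < e.2),
        ((((1 + q) / 2 : ℝ) : ℂ) * (star (1 : ℂ) * 1) +
          (((1 - q) / 2 : ℝ) : ℂ) * (star (s e (ξ, τ)) * s e (η, σ)))) *
        ∏ i, ⟪ξ (τ i), η (σ i)⟫_ℂ) =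
      ∑ σ : Equiv.Perm (Fin n), (q : ℂ) ^ inversions σ * ∏ i, ⟪ξ i, η (σ i)⟫_ℂ := by
    intro τ
    rw [← Equiv.sum_comp (Equiv.mulRight τ⁻¹) (fun σ : Equiv.Perm (Fin n) =>
      (q : ℂ) ^ inversions σ * ∏ i, ⟪ξ i, η (σ i)⟫_ℂ)]
    refine Finset.sum_congr rfl fun σ _ => ?_
    congr 1
    · rw [Equiv.coe_mulRight, pow_inversions]
      refine Finset.prod_congr rfl fun e _ => ?_
      simp only [s]
      by_cases h1 : τ e.1 < τ e.2 <;> by_cases h2 : σ e.1 < σ e.2 <;> simp [h1, h2] <;> ring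
    · rw [← Equiv.prod_comp τ (fun i => ⟪ξ i, η (Equiv.mulRight τ⁻¹ σ i)⟫_ℂ)]
      simp
  simp only [key]
  have hn : ((n.factorial : ℝ) : ℂ) ≠ 0 := by exact_mod_cast n.factorial_ne_zero
  simp [Fintype.card_perm, Finset.sum_const]
  field_simp

lemma qKernel_eq {q : ℝ} (n : ℕ) (l l' : List H) (hl : l.length = n) (hl' : l'.length = n) :
    qKernel q l l' = ∑ σ : Equiv.Perm (Fin n),
      (q : ℂ) ^ inversions σ * ∏ i : Fin n, ⟪l.getD i 0, l'.getD (σ i) 0⟫_ℂ := by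
  subst hl
  simp [qKernel, hl']

/-- The `q`-inner product is positive semi-definite for `-1 < q < 1`. -/
lemma posSemidef_qKernel {q : ℝ} (hq : q ∈ Set.Ioo (-1 : ℝ) 1) :
    (Matrix.of (qKernel q) : Matrix (List H) (List H) ℂ).PosSemidef := by
  classical
  let d (n : ℕ) (l : List H) : ℂ := if l.length = n then 1 else 0
  let A (n : ℕ) : Matrix (List H) (List H) ℂ :=
    Matrix.of fun l l' => star (d n l) * d n l' * ∑ σ : Equiv.Perm (Fin n),
      (q : ℂ) ^ inversions σ * ∏ i : Fin n, ⟪l.getD i 0, l'.getD (σ i) 0⟫_ℂ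
  have hA : ∀ n, (A n).PosSemidef := fun n =>
    (posSemidef_rankOne (d n)).hadamard
      ((posSemidef_level (H := H) hq n).submatrix fun (l : List H) (i : Fin n) => l.getD i 0)
  have hsum : ∀ (N : ℕ) (l l' : List H), l.length < N →
      qKernel q l l' = ∑ n ∈ Finset.range N, A n l l' := by
    intro N l l' hl
    rw [Finset.sum_eq_single l.length]
    · by_cases h : l.length = l'.length
      · rw [qKernel_eq l.length l l' rfl h.symm]
        simp only [A, d, Matrix.of_apply, if_pos h.symm, if_true, star_one, one_mul]
      · simp [qKernel, A, d, h, Ne.symm h]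
    · intro n _ hn
      simp [A, d, hn.symm]
    · intro h
      simp [hl] at h
  refine ⟨?_, fun x => ?_⟩
  · ext l l'
    simp only [Matrix.conjTranspose_apply, Matrix.of_apply]
    rw [hsum (l.length + l'.length + 1) l l' (by omega),
      hsum (l.length + l'.length + 1) l' l (by omega), star_sum]
    exact Finset.sum_congr rfl fun n _ => (hA n).1.apply _ _
  · have h := (Matrix.posSemidef_sum (Finset.range (x.support.sup List.length + 1))
      (fun n _ => hA n)).2 x
    convert h using 1
    refine Finset.sum_congr rfl fun l hl => Finset.sum_congr rfl fun l' _ => ?_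
    dsimp only
    rw [Matrix.of_apply, Matrix.sum_apply,
      hsum _ l l' (Nat.lt_succ_of_le (Finset.le_sup (f := List.length) hl))]

end Kernel

/-! ## The `q`-Fock space -/

section Fock

variable (q : Set.Ioo (-1 : ℝ) 1) (H : Type*) [NormedAddCommGroup H] [InnerProductSpace ℂ H]

/-- Formal linear combinations of simple tensors `η₁ ⊗ ⋯ ⊗ ηₙ` (lists `[η₁, …, ηₙ]`) of all orders
`n ≥ 0`. With the `q`-inner product below this presents the algebraic Fock space
`⨁ₙ H^{⊗ n}`: the relations expressing multilinearity of `⊗` are null vectors of the `q`-inner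
product, and they are divided out in the completion. -/
def PreFock (_q : Set.Ioo (-1 : ℝ) 1) (H : Type*) : Type _ := List H →₀ ℂ

instance : AddCommGroup (PreFock q H) := inferInstanceAs (AddCommGroup (List H →₀ ℂ))

instance : Module ℂ (PreFock q H) := inferInstanceAs (Module ℂ (List H →₀ ℂ))

/-- The `q`-inner product, extended sesquilinearly (conjugate-linear in the first variable). -/
@[reducible] def formCore : PreInnerProductSpace.Core ℂ (List H →₀ ℂ) where
  inner x y := x.sum fun l c => y.sum fun l' c' => star c * qKernel q l l' * c'
  conj_inner_symm x y := by
    rw [Finsupp.sum_comm]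
    simp only [map_finsuppSum]
    refine Finset.sum_congr rfl fun l _ => Finset.sum_congr rfl fun l' _ => ?_
    have h := (posSemidef_qKernel (H := H) q.2).1.apply l l'
    simp only [Matrix.of_apply] at h
    dsimp only
    rw [← h]
    simp
    ring
  re_inner_nonneg x := by
    have h := (posSemidef_qKernel (H := H) q.2).2 x
    exact (RCLike.le_iff_re_im.1 h).1
  add_left x y z := by
    rw [Finsupp.sum_add_index'] <;> simp [← Finsupp.sum_add, add_mul]
  smul_left x y c := by
    rw [Finsupp.sum_smul_index] <;> simp [Finsupp.mul_sum, ← mul_assoc]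

instance : PreInnerProductSpace.Core ℂ (PreFock q H) := formCore q H

instance : SeminormedAddCommGroup (PreFock q H) :=
  InnerProductSpace.Core.toSeminormedAddCommGroup (𝕜 := ℂ)

instance : InnerProductSpace ℂ (PreFock q H) := .ofCore _

/-- The `q`-Fock space `F_q(H)`, a complex Hilbert space. -/
abbrev Fock : Type _ := UniformSpace.Completion (PreFock q H)

variable {H}

/-- The simple tensor `η₁ ⊗ ⋯ ⊗ ηₙ` as a formal combination. -/
def preTensor (l : List H) : PreFock q H := Finsupp.single l 1

/-- The simple tensor `η₁ ⊗ ⋯ ⊗ ηₙ` in the `q`-Fock space. -/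
def tensor (l : List H) : Fock q H := (preTensor q l : PreFock q H)

variable (H) in
/-- The vacuum vector `Ω`. -/
def vacuum : Fock q H := tensor q []

lemma inner_tensor (l l' : List H) : ⟪tensor q l, tensor q l'⟫_ℂ = qKernel q l l' := by
  rw [tensor, tensor, UniformSpace.Completion.inner_coe]
  change ((Finsupp.single l (1 : ℂ)).sum fun l c => (Finsupp.single l' (1 : ℂ)).sum fun l' c' =>
    star c * qKernel q l l' * c') = _
  simp

/-- The linear extension of a map given on simple tensors. -/
def preLift (f : List H → PreFock q H) : PreFock q H →ₗ[ℂ] PreFock q H :=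
  Finsupp.linearCombination ℂ f

lemma preLift_preTensor (f : List H → PreFock q H) (l : List H) :
    preLift q f (preTensor q l) = f l :=
  (Finsupp.linearCombination_single ℂ (1 : ℂ) l).trans (one_smul ℂ (f l))

/-- The extension to the `q`-Fock space, by continuity, of a bounded operator given on simple
tensors. -/
def extend (f : List H → PreFock q H) : Fock q H →L[ℂ] Fock q H :=
  (((UniformSpace.Completion.toComplL (𝕜 := ℂ) (E := PreFock q H)).toLinearMap).comp
    (preLift q f)).extendOfNorm
      ((UniformSpace.Completion.toComplL (𝕜 := ℂ) (E := PreFock q H)).toLinearMap)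

/-- The creation operator
`a*(ζ) (η₁ ⊗ ⋯ ⊗ ηₙ) = ζ ⊗ η₁ ⊗ ⋯ ⊗ ηₙ`, `a*(ζ) Ω = ζ`. -/
def creation (ζ : H) : Fock q H →L[ℂ] Fock q H :=
  extend q fun l => preTensor q (ζ :: l)

/-- The annihilation operator
`a(ζ) (η₁ ⊗ ⋯ ⊗ ηₙ) = ∑ₖ q^{k-1} ⟨ζ, ηₖ⟩ η₁ ⊗ ⋯ ⊗ η̌ₖ ⊗ ⋯ ⊗ ηₙ`, `a(ζ) Ω = 0`
(the index `k` starts at `0` here). -/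
def annihilation (ζ : H) : Fock q H →L[ℂ] Fock q H :=
  extend q fun l => ∑ k : Fin l.length,
    (((q : ℝ) : ℂ) ^ (k : ℕ) * ⟪ζ, l.get k⟫_ℂ) • preTensor q (l.eraseIdx k)

/-- The gauge (preservation) operator
`p(T) (η₁ ⊗ ⋯ ⊗ ηₙ) = ∑ₖ q^{k-1} (T ηₖ) ⊗ η₁ ⊗ ⋯ ⊗ η̌ₖ ⊗ ⋯ ⊗ ηₙ`, `p(T) Ω = 0`
(the index `k` starts at `0` here). -/
def gauge (T : H →L[ℂ] H) : Fock q H →L[ℂ] Fock q H :=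
  extend q fun l => ∑ k : Fin l.length,
    (((q : ℝ) : ℂ) ^ (k : ℕ)) • preTensor q (T (l.get k) :: l.eraseIdx k)

end Fock

/-! ## The `q`-Lévy process with Kolmogorov measure `ν` -/

section Levy

variable (q : Set.Ioo (-1 : ℝ) 1) (ν : Measure ℝ)

/-- The measure `dt ⊗ ν` on `ℝ₊ × ℝ`. -/
abbrev baseMeasure : Measure (ℝ × ℝ) := (volume.restrict (Set.Ici (0 : ℝ))).prod ν

/-- The one-particle space `L²(ℝ₊, dt) ⊗ L²(ℝ, ν) = L²(ℝ₊ × ℝ, dt ⊗ ν)`. -/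
abbrev OneParticle : Type := Lp ℂ 2 (baseMeasure ν)

open Classical in
/-- The vector of the one-particle space given by a square integrable function. -/
def vec (g : ℝ × ℝ → ℂ) : OneParticle ν :=
  if h : MemLp g 2 (baseMeasure ν) then h.toLp g else 0

open Classical in
/-- The operator of multiplication by an essentially bounded function. -/
def mulOp (m : ℝ × ℝ → ℂ) : OneParticle ν →L[ℂ] OneParticle ν :=
  if h : MemLp m ∞ (baseMeasure ν) then
    (ContinuousLinearMap.mul ℂ ℂ).holderL (baseMeasure ν) ∞ 2 2 (h.toLp m)
  else 0

/-- The operator `X(g) = a(ξ) + a*(ξ) + p(T)`, where `ξ = g` and `T` is the multiplication by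
`x g(t, x)`, for real `g`; and its `ℂ`-linear extension to complex `g`. -/
def X (g : ℝ × ℝ → ℂ) : Fock q (OneParticle ν) →L[ℂ] Fock q (OneParticle ν) :=
  annihilation q (vec ν fun z => star (g z)) + creation q (vec ν g) +
    gauge q (mulOp ν fun z => (z.2 : ℂ) * g z)

/-- The function `χ_{[a, b)}(t) x^{k-1}`. -/
def mono (a b : ℝ) (k : ℕ) (z : ℝ × ℝ) : ℂ :=
  (Set.Ico a b).indicator (fun _ => (1 : ℂ)) z.1 * (z.2 : ℂ) ^ (k - 1)

/-- The processes `Y_k(s) = Y_k([0, s))`, `k ≥ 1`, `s ≥ 0`; `Y_1(s) = X(s)` is the `q`-Lévy process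
itself. -/
def Y (k : ℕ) (s : ℝ) : Fock q (OneParticle ν) →L[ℂ] Fock q (OneParticle ν) :=
  X q ν (mono 0 s k)

/-- The space `𝒟`: the complex span of the functions `χ_{[a, b)}(t) x^{k-1}` with `0 ≤ a ≤ b`
and `k ≥ 1`. -/
def testSpace : Submodule ℂ (ℝ × ℝ → ℂ) :=
  Submodule.span ℂ {g | ∃ (a b : ℝ) (k : ℕ), 0 ≤ a ∧ a ≤ b ∧ 1 ≤ k ∧ g = mono a b k}

/-- The Wick products `W(η₁ ⊗ ⋯ ⊗ ηₙ)`, given by `W(Ω) = Id` and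
`W(η₀ ⊗ ⋯ ⊗ ηₙ) = X(η₀) W(η₁ ⊗ ⋯ ⊗ ηₙ) - ∑ᵢ q^{i-1} ⟨η̄₀, ηᵢ⟩ W(η₁ ⊗ ⋯ ⊗ η̌ᵢ ⊗ ⋯ ⊗ ηₙ)
- ∑ᵢ q^{i-1} W((T_{η₀} ηᵢ) ⊗ η₁ ⊗ ⋯ ⊗ η̌ᵢ ⊗ ⋯ ⊗ ηₙ)`, where `T_g` is the multiplication by
`x g(t, x)`. -/
def wick : List (ℝ × ℝ → ℂ) → (Fock q (OneParticle ν) →L[ℂ] Fock q (OneParticle ν))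
  | [] => 1
  | g :: l =>
    X q ν g * wick l
      - ∑ i : Fin l.length, (((q : ℝ) : ℂ) ^ (i : ℕ) *
          ⟪vec ν fun z => star (g z), vec ν (l.get i)⟫_ℂ) • wick (l.eraseIdx i)
      - ∑ i : Fin l.length, (((q : ℝ) : ℂ) ^ (i : ℕ)) •
          wick ((fun z => (z.2 : ℂ) * g z * l.get i z) :: l.eraseIdx i)
termination_by l => l.length
decreasing_by
  all_goals
    first
    | (simp only [List.length_cons]; omega)
    | (have := (‹Fin _› : Fin _).2
       simp only [List.length_cons, List.length_eraseIdx]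
       split <;> omega)

end Levy

/-! ## Von Neumann algebras and normal tracial states -/

section VonNeumann

variable {F : Type*} [NormedAddCommGroup F] [InnerProductSpace ℂ F] [CompleteSpace F]

/-- The von Neumann algebra generated by a set `S` of bounded operators: the double commutant of
`S ∪ S*`. -/
def generated (S : Set (F →L[ℂ] F)) : VonNeumannAlgebra F where
  toStarSubalgebra :=
    StarSubalgebra.centralizer ℂ (StarSubalgebra.centralizer ℂ S : Set (F →L[ℂ] F))
  centralizer_centralizer' := by
    change Set.centralizer (Set.centralizer
      ((StarSubalgebra.centralizer ℂ (StarSubalgebra.centralizer ℂ S : Set (F →L[ℂ] F)) :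
        StarSubalgebra ℂ (F →L[ℂ] F)) : Set (F →L[ℂ] F))) =
      ((StarSubalgebra.centralizer ℂ (StarSubalgebra.centralizer ℂ S : Set (F →L[ℂ] F)) :
        StarSubalgebra ℂ (F →L[ℂ] F)) : Set (F →L[ℂ] F))
    simp [StarSubalgebra.coe_centralizer]

/-- The ultraweak (`σ`-weak) topology on a von Neumann algebra `M`: the coarsest topology for which
all functionals `A ↦ ∑ₙ ⟨xₙ, A yₙ⟩` with `∑ₙ ‖xₙ‖² < ∞` and `∑ₙ ‖yₙ‖² < ∞` are continuous. -/
@[reducible] def ultraweakTopology (M : VonNeumannAlgebra F) : TopologicalSpace M.toStarSubalgebra :=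
  ⨅ (x : ℕ → F) (y : ℕ → F) (_ : Summable fun n => ‖x n‖ ^ 2) (_ : Summable fun n => ‖y n‖ ^ 2),
    TopologicalSpace.induced
      (fun A : M.toStarSubalgebra => ∑' n, ⟪x n, (A : F →L[ℂ] F) (y n)⟫_ℂ) inferInstance

open scoped ComplexOrder in
/-- `τ` is a normal (that is, ultraweakly continuous) tracial state on the von Neumann
algebra `M`. -/
structure IsNormalTracialState (M : VonNeumannAlgebra F) (τ : M.toStarSubalgebra →ₗ[ℂ] ℂ) :
    Prop where
  map_one : τ 1 = 1
  nonneg : ∀ A, 0 ≤ τ (star A * A)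
  tracial : ∀ A B, τ (A * B) = τ (B * A)
  normal : @Continuous _ _ (ultraweakTopology M) _ τ

end VonNeumann

/-- The von Neumann algebra of the `q`-Lévy process: it is generated by all the operators `Y_k(s)`,
`k ≥ 1`, `s ≥ 0`. -/
def levyAlgebra (q : Set.Ioo (-1 : ℝ) 1) (ν : Measure ℝ) :
    VonNeumannAlgebra (Fock q (OneParticle ν)) :=
  generated {A | ∃ (k : ℕ) (s : ℝ), 1 ≤ k ∧ 0 ≤ s ∧ A = Y q ν k s}

end QLevy

end

/-! Let `fₖ` be the unit vector `χ_[k,k+1) ⊗ 1` and let `V = X(fₙ) ⋯ X(f_{n+m-1})`, an element of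
the algebra. A tensor `ξ` whose factors live in bounded time does not interact with late `fₖ`, and
distinct `fₖ` have disjoint supports. So for large `n` both `V` and `V*` act on `ξ` purely by
creation: `V ξ = fₙ ⊗ ⋯ ⊗ f_{n+m-1} ⊗ ξ`, and `V* ξ` is the same with the `fₖ` in reverse order.
Hence for fixed `m` and `n → ∞` both `V* V` and `V V*` tend weakly to the identity, boundedly.

For a normal trace, `τ(A) = lim τ(A V V*) = lim τ(V* A V) = τ(B)`, where `B = Bₘ` is a weak limit of
`V* A V` along an ultrafilter and `‖Bₘ‖ ≤ ‖A‖` (`IsNormalTracialState.exists_compression`).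

Take `A = W(η₁ ⊗ ⋯ ⊗ ηₖ)` with `k > 0`. The matrix element of `Bₘ` between local `ξ'` and `ξ` is a
limit of `⟨f ⊗ ξ', W (f ⊗ ξ)⟩`, with `f` the block of `m` far vectors. The recursion defining `W`
cancels every contraction among the `ηᵢ`, so `W (f ⊗ ξ)` is `η₁ ⊗ ⋯ ⊗ ηₖ ⊗ f ⊗ ξ` up to contractions
reaching `ξ` across `f`. Crossing `f` costs `q^m`, as does contracting `η₁` with `ξ'`. So the matrix
element is `O(|q|^m)` (`decays_inner_wick`), the uniformly bounded `Bₘ` tend to zero ultraweakly,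
and `τ(W) = 0` (`trace_wick_eq_zero`).

The Wick products span all polynomials in the generators, and `W(η) Ω = η`, so `τ` and the vacuum
state agree on polynomials. Both are ultraweakly continuous, and von Neumann's density theorem
(`ampl_mem_closure`, `eq_of_eqOn_adjoin`) extends the equality to the whole algebra.

A preliminary task is the boundedness of the Fock space operators, since `extend` is controlled only
through norm estimates. These come from the `q`-commutation relation, with constant `1 / (1 - |q|)`
or its square root. -/

noncomputable section

namespace QLevy

/-! ### Expansion of the `q`-inner product along the first factor. -/

section KernelRecursion

/-- The permutation of `{0, …, n}` which sends `0` to `k` and the other elements to the complement of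
`k` in the order given by `τ`. -/
def consPerm {n : ℕ} (p : Fin (n + 1) × Equiv.Perm (Fin n)) : Equiv.Perm (Fin (n + 1)) :=
  (Equiv.Perm.decomposeFin.symm (0, p.2)).trans p.1.cycleRange.symm

lemma consPerm_zero {n : ℕ} (p : Fin (n + 1) × Equiv.Perm (Fin n)) : consPerm p 0 = p.1 := by
  simp [consPerm, Fin.cycleRange_symm_zero]

lemma consPerm_succ {n : ℕ} (p : Fin (n + 1) × Equiv.Perm (Fin n)) (i : Fin n) :
    consPerm p i.succ = p.1.succAbove (p.2 i) := by
  simp [consPerm, Fin.cycleRange_symm_succ]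

lemma consPerm_bijective (n : ℕ) : Function.Bijective (consPerm (n := n)) := by
  rw [Fintype.bijective_iff_injective_and_card]
  refine ⟨?_, ?_⟩
  · rintro ⟨k, τ⟩ ⟨k', τ'⟩ h
    have h0 : k = k' := by
      simpa [consPerm_zero] using congrArg (fun σ : Equiv.Perm (Fin (n + 1)) => σ 0) h
    subst h0
    refine Prod.ext rfl (Equiv.ext fun i => ?_)
    have := congrArg (fun σ : Equiv.Perm (Fin (n + 1)) => σ i.succ) h
    simpa [consPerm_succ] using this
  · simp [Fintype.card_perm, Nat.factorial_succ]

lemma inversions_eq_sum {n : ℕ} (σ : Equiv.Perm (Fin n)) :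
    inversions σ = ∑ i, ∑ j, if i < j ∧ σ j < σ i then 1 else 0 := by
  rw [inversions, Finset.card_filter, ← Finset.univ_product_univ, Finset.sum_product]

/-- Pairs containing `0` are inverted once for each value below `p.1`; the remaining pairs keep
their order because `succAbove` is increasing. -/
lemma inversions_consPerm {n : ℕ} (p : Fin (n + 1) × Equiv.Perm (Fin n)) :
    inversions (consPerm p) = p.1 + inversions p.2 := by
  obtain ⟨k, τ⟩ := p
  simp only [inversions_eq_sum, Fin.sum_univ_succ, consPerm_zero, consPerm_succ,
    Fin.succ_lt_succ_iff, Fin.succAbove_lt_succAbove_iff]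
  have h : ∀ i : Fin n, k.succAbove (τ i) < k ↔ (τ i : ℕ) < k := fun i => by
    rw [Fin.succAbove_lt_iff_castSucc_lt]; simp [Fin.lt_def]
  simp only [lt_self_iff_false, false_and, if_false, zero_add, Fin.succ_pos, true_and,
    Fin.not_lt_zero, h]
  congr 1
  rw [Equiv.sum_comp τ (fun i : Fin n => if (i : ℕ) < k then 1 else 0), ← Finset.card_filter,
    Fin.card_filter_val_lt]
  omega

variable {H : Type*} [NormedAddCommGroup H] [InnerProductSpace ℂ H]

lemma getD_eraseIdx {α : Type*} (l : List α) (d : α) {n : ℕ}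
    (k : Fin (n + 1)) (j : Fin n) : (l.eraseIdx k).getD j d = l.getD (k.succAbove j) d := by
  rw [List.getD_eq_getElem?_getD, List.getD_eq_getElem?_getD, List.getElem?_eraseIdx]
  by_cases h : (j : ℕ) < k
  · rw [if_pos h, Fin.succAbove_of_castSucc_lt _ _ (by simpa [Fin.lt_def] using h)]; rfl
  · rw [if_neg h, Fin.succAbove_of_le_castSucc _ _ (by simpa [Fin.le_def] using h)]; rfl

/-- Sort the permutations by the image `k` of `0`, which contributes `k` inversions. This is the
adjointness of creation and annihilation at the level of simple tensors. -/
lemma qKernel_cons (q : ℝ) (ζ : H) (l l' : List H) :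
    qKernel q (ζ :: l) l' = ∑ k : Fin l'.length,
      ((q : ℂ) ^ (k : ℕ) * ⟪ζ, l'.get k⟫_ℂ) * qKernel q l (l'.eraseIdx k) := by
  by_cases hl : l'.length = l.length + 1
  · obtain ⟨n, hn⟩ : ∃ n, l.length = n := ⟨_, rfl⟩
    rw [hn] at hl
    rw [qKernel_eq (n + 1) _ _ (by simp [hn]) hl]
    rw [← (consPerm_bijective n).sum_comp, Fintype.sum_prod_type]
    rw [← Equiv.sum_comp (finCongr hl.symm)]
    refine Finset.sum_congr rfl fun k _ => ?_
    rw [qKernel_eq n l _ hn (by rw [List.length_eraseIdx_of_lt] <;> simp [hl]; omega),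
      Finset.mul_sum]
    refine Finset.sum_congr rfl fun τ _ => ?_
    rw [inversions_consPerm, Fin.prod_univ_succ, consPerm_zero, pow_add]
    have h1 : l'.getD (k : ℕ) 0 = l'.get (finCongr hl.symm k) := by
      rw [List.getD_eq_getElem _ _ (by omega)]; rfl
    simp only [consPerm_succ, Fin.val_succ, List.getD_cons_succ, Fin.val_zero,
      List.getD_cons_zero, h1]
    rw [Finset.prod_congr rfl fun (i : Fin n) _ => by rw [← getD_eraseIdx l' 0 k (τ i)]]
    simp only [finCongr_apply, Fin.val_cast]
    ring
  -- If the orders differ by anything but one, both sides vanish.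
  · rw [qKernel, if_neg (by simpa using Ne.symm hl)]
    refine (Finset.sum_eq_zero fun k _ => ?_).symm
    rw [qKernel, if_neg, mul_zero]
    rw [List.length_eraseIdx_of_lt k.2]
    have := k.2
    omega

end KernelRecursion

/-! ### Creation and annihilation on formal tensors: `q`-commutation relation and bounds over
orthonormal families. -/

section PreFock

variable (q : Set.Ioo (-1 : ℝ) 1) {H : Type*} [NormedAddCommGroup H] [InnerProductSpace ℂ H]

omit [NormedAddCommGroup H] [InnerProductSpace ℂ H] in
lemma preFock_induction {p : PreFock q H → Prop} (x : PreFock q H) (h0 : p 0)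
    (hadd : ∀ x y, p x → p y → p (x + y)) (hsmul : ∀ (c : ℂ) x, p x → p (c • x))
    (ht : ∀ l, p (preTensor q l)) : p x := by
  refine Finsupp.induction_linear (motive := p) x h0 hadd fun l c => ?_
  have := hsmul c _ (ht l)
  rwa [show c • preTensor q l = (Finsupp.single l c : List H →₀ ℂ) from by
    change c • (Finsupp.single l (1 : ℂ)) = _
    rw [Finsupp.smul_single, smul_eq_mul, mul_one]] at this

lemma inner_preTensor (l l' : List H) : ⟪preTensor q l, preTensor q l'⟫_ℂ = qKernel q l l' := by
  rw [← inner_tensor, tensor, tensor, UniformSpace.Completion.inner_coe]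

/-- Creation on formal combinations of simple tensors. -/
def preCreation (ζ : H) : PreFock q H →ₗ[ℂ] PreFock q H :=
  preLift q fun l => preTensor q (ζ :: l)

/-- Annihilation on formal combinations of simple tensors. -/
def preAnnihilation (ζ : H) : PreFock q H →ₗ[ℂ] PreFock q H :=
  preLift q fun l => ∑ k : Fin l.length,
    (((q : ℝ) : ℂ) ^ (k : ℕ) * ⟪ζ, l.get k⟫_ℂ) • preTensor q (l.eraseIdx k)

/-- The gauge operator on formal combinations of simple tensors. -/
def preGauge (T : H →L[ℂ] H) : PreFock q H →ₗ[ℂ] PreFock q H :=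
  preLift q fun l => ∑ k : Fin l.length,
    (((q : ℝ) : ℂ) ^ (k : ℕ)) • preTensor q (T (l.get k) :: l.eraseIdx k)

@[simp] lemma preCreation_preTensor (ζ : H) (l : List H) :
    preCreation q ζ (preTensor q l) = preTensor q (ζ :: l) := preLift_preTensor q _ l

lemma preAnnihilation_preTensor (ζ : H) (l : List H) :
    preAnnihilation q ζ (preTensor q l) = ∑ k : Fin l.length,
      (((q : ℝ) : ℂ) ^ (k : ℕ) * ⟪ζ, l.get k⟫_ℂ) • preTensor q (l.eraseIdx k) :=
  preLift_preTensor q _ l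

lemma preGauge_preTensor (T : H →L[ℂ] H) (l : List H) :
    preGauge q T (preTensor q l) = ∑ k : Fin l.length,
      (((q : ℝ) : ℂ) ^ (k : ℕ)) • preTensor q (T (l.get k) :: l.eraseIdx k) :=
  preLift_preTensor q _ l

lemma inner_preCreation (ζ : H) (x y : PreFock q H) :
    ⟪preCreation q ζ x, y⟫_ℂ = ⟪x, preAnnihilation q ζ y⟫_ℂ := by
  refine preFock_induction q (p := fun x => ⟪preCreation q ζ x, y⟫_ℂ = ⟪x, preAnnihilation q ζ y⟫_ℂ)
    x (by simp) (fun x x' h h' => ?_) (fun c x h => ?_) fun l => ?_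
  · rw [map_add, inner_add_left, inner_add_left, h, h']
  · rw [map_smul, inner_smul_left, inner_smul_left, h]
  refine preFock_induction q (p := fun y => ⟪preCreation q ζ (preTensor q l), y⟫_ℂ =
    ⟪preTensor q l, preAnnihilation q ζ y⟫_ℂ) y (by simp) (fun y y' h h' => ?_) (fun c y h => ?_)
    fun l' => ?_
  · rw [map_add, inner_add_right, inner_add_right, h, h']
  · rw [map_smul, inner_smul_right, inner_smul_right, h]
  rw [preCreation_preTensor, preAnnihilation_preTensor, inner_preTensor, qKernel_cons, inner_sum]
  refine Finset.sum_congr rfl fun k _ => ?_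
  rw [inner_smul_right, inner_preTensor]

lemma inner_preAnnihilation (ζ : H) (x y : PreFock q H) :
    ⟪preAnnihilation q ζ x, y⟫_ℂ = ⟪x, preCreation q ζ y⟫_ℂ := by
  rw [← inner_conj_symm, ← inner_preCreation, inner_conj_symm]

/-- The `q`-commutation relation: removing the new first factor gives the scalar term, and every
other removal is shifted by one place, hence the factor `q`. -/
lemma preAnnihilation_preCreation (ζ η : H) (x : PreFock q H) :
    preAnnihilation q ζ (preCreation q η x) =
      ⟪ζ, η⟫_ℂ • x + ((q : ℝ) : ℂ) • preCreation q η (preAnnihilation q ζ x) := by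
  refine preFock_induction q (p := fun x => preAnnihilation q ζ (preCreation q η x) =
    ⟪ζ, η⟫_ℂ • x + ((q : ℝ) : ℂ) • preCreation q η (preAnnihilation q ζ x)) x (by simp)
    (fun x x' h h' => ?_) (fun c x h => ?_) fun l => ?_
  · simp only [map_add, h, h', smul_add]; abel
  · simp only [map_smul, h, smul_add, smul_comm c]
  rw [preCreation_preTensor, preAnnihilation_preTensor, preAnnihilation_preTensor]
  simp only [List.length_cons]
  rw [Fin.sum_univ_succ]
  simp only [Fin.val_zero, pow_zero, one_mul, List.get_cons_zero, List.eraseIdx_cons_zero,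
    Fin.val_succ, List.eraseIdx_cons_succ, map_sum, map_smul,
    preCreation_preTensor, Finset.smul_sum, smul_smul]
  congr 1
  refine Finset.sum_congr rfl fun k _ => ?_
  rw [show (η :: l).get k.succ = l.get k from rfl]
  congr 1
  ring

/-- Formal combinations of simple tensors of order at most `n`. -/
def degreeLE (H : Type*) (n : ℕ) : Submodule ℂ (PreFock q H) :=
  Submodule.span ℂ (preTensor q '' {l : List H | l.length ≤ n})

omit [NormedAddCommGroup H] [InnerProductSpace ℂ H] in
lemma preTensor_mem_degreeLE {l : List H} {n : ℕ} (h : l.length ≤ n) :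
    preTensor q l ∈ degreeLE q H n := Submodule.subset_span ⟨l, h, rfl⟩

omit [NormedAddCommGroup H] [InnerProductSpace ℂ H] in
lemma degreeLE_mono : Monotone (degreeLE q H) := fun _ _ h =>
  Submodule.span_mono (Set.image_mono fun _ hl => le_trans hl h)

omit [NormedAddCommGroup H] [InnerProductSpace ℂ H] in
lemma exists_mem_degreeLE (x : PreFock q H) : ∃ n, x ∈ degreeLE q H n := by
  refine preFock_induction q (p := fun x => ∃ n, x ∈ degreeLE q H n) x ⟨0, zero_mem _⟩
    (fun x x' ⟨n, hn⟩ ⟨m, hm⟩ => ⟨max n m, ?_⟩) (fun c x ⟨n, hn⟩ => ⟨n, Submodule.smul_mem _ c hn⟩)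
    fun l => ⟨l.length, preTensor_mem_degreeLE q le_rfl⟩
  exact add_mem (degreeLE_mono q (le_max_left _ _) hn) (degreeLE_mono q (le_max_right _ _) hm)

lemma preAnnihilation_degreeLE_zero (ζ : H) {x : PreFock q H} (hx : x ∈ degreeLE q H 0) :
    preAnnihilation q ζ x = 0 := by
  have : degreeLE q H 0 ≤ LinearMap.ker (preAnnihilation q ζ) := by
    refine Submodule.span_le.2 ?_
    rintro _ ⟨l, hl, rfl⟩
    obtain rfl : l = [] := List.length_eq_zero_iff.1 (Nat.le_zero.1 hl)
    simp [preAnnihilation_preTensor]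
  exact this hx

lemma preAnnihilation_degreeLE_succ (ζ : H) {n : ℕ} {x : PreFock q H}
    (hx : x ∈ degreeLE q H (n + 1)) : preAnnihilation q ζ x ∈ degreeLE q H n := by
  have : degreeLE q H (n + 1) ≤ (degreeLE q H n).comap (preAnnihilation q ζ) := by
    refine Submodule.span_le.2 ?_
    rintro _ ⟨l, hl, rfl⟩
    rw [SetLike.mem_coe, Submodule.mem_comap, preAnnihilation_preTensor]
    refine sum_mem fun k _ => Submodule.smul_mem _ _ (preTensor_mem_degreeLE q ?_)
    rw [List.length_eraseIdx_of_lt k.2]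
    exact Nat.sub_le_of_le_add hl
  exact this hx

/-- With `S` the left-hand sum, adjointness gives `S = ⟨x, ∑ a*(eᵢ) a(eᵢ) x⟩`. Cauchy–Schwarz and
the hypothesis yield `S² ≤ C ‖x‖² S`, and one factor `S` cancels. -/
lemma sum_norm_preAnnihilation_le {ι : Type*} [Fintype ι] (e : ι → H) {C : ℝ} (x : PreFock q H)
    (h : ‖∑ i, preCreation q (e i) (preAnnihilation q (e i) x)‖ ^ 2 ≤
      C * ∑ i, ‖preAnnihilation q (e i) x‖ ^ 2) (hC : 0 ≤ C) :
    ∑ i, ‖preAnnihilation q (e i) x‖ ^ 2 ≤ C * ‖x‖ ^ 2 := by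
  set S := ∑ i, ‖preAnnihilation q (e i) x‖ ^ 2 with hS
  have h1 : (S : ℂ) = ⟪x, ∑ i, preCreation q (e i) (preAnnihilation q (e i) x)⟫_ℂ := by
    rw [inner_sum, hS, Complex.ofReal_sum]
    refine Finset.sum_congr rfl fun i _ => ?_
    rw [← inner_preAnnihilation, inner_self_eq_norm_sq_to_K]
    simp
  have hS0 : 0 ≤ S := Finset.sum_nonneg fun i _ => sq_nonneg _
  have h2 : S ≤ ‖x‖ * ‖∑ i, preCreation q (e i) (preAnnihilation q (e i) x)‖ := by
    have := norm_inner_le_norm (𝕜 := ℂ) x (∑ i, preCreation q (e i) (preAnnihilation q (e i) x))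
    rwa [← h1, Complex.norm_real, Real.norm_of_nonneg hS0] at this
  have h3 : S * S ≤ (C * ‖x‖ ^ 2) * S := by
    calc S * S ≤ (‖x‖ * ‖∑ i, preCreation q (e i) (preAnnihilation q (e i) x)‖) ^ 2 := by
          rw [← sq]; gcongr
      _ = ‖x‖ ^ 2 * ‖∑ i, preCreation q (e i) (preAnnihilation q (e i) x)‖ ^ 2 := by ring
      _ ≤ ‖x‖ ^ 2 * (C * S) := by gcongr
      _ = _ := by ring
  rcases hS0.eq_or_lt with h4 | h4
  · rw [← h4]; positivity
  · exact le_of_mul_le_mul_right h3 h4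

/-- The `q`-commutation relation turns the squared norm into `∑ ‖ξᵢ‖²` plus `q` times the cross
terms `⟨a(eⱼ) ξᵢ, a(eᵢ) ξⱼ⟩`. By the arithmetic-geometric mean inequality and the symmetry in `i,
j`, these are controlled by the column bound for each `ξᵢ`. -/
lemma norm_sum_preCreation_le {ι : Type*} [Fintype ι] {e : ι → H} (he : Orthonormal ℂ e) {C : ℝ}
    (ξ : ι → PreFock q H)
    (h : ∀ i, ∑ j, ‖preAnnihilation q (e j) (ξ i)‖ ^ 2 ≤ C * ‖ξ i‖ ^ 2) :
    ‖∑ i, preCreation q (e i) (ξ i)‖ ^ 2 ≤ (1 + |(q : ℝ)| * C) * ∑ i, ‖ξ i‖ ^ 2 := by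
  classical
  have h1 : ((‖∑ i, preCreation q (e i) (ξ i)‖ ^ 2 : ℝ) : ℂ) = ((∑ i, ‖ξ i‖ ^ 2 : ℝ) : ℂ) +
      ((q : ℝ) : ℂ) * ∑ i, ∑ j, ⟪preAnnihilation q (e j) (ξ i), preAnnihilation q (e i) (ξ j)⟫_ℂ := by
    have h2 := inner_self_eq_norm_sq_to_K (𝕜 := ℂ) (∑ i, preCreation q (e i) (ξ i))
    rw [Complex.ofReal_pow]
    refine h2.symm.trans ?_
    rw [sum_inner, Complex.ofReal_sum, Finset.mul_sum, ← Finset.sum_add_distrib]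
    refine Finset.sum_congr rfl fun i _ => ?_
    rw [inner_sum, Finset.mul_sum]
    have h3 : ∀ j, ⟪preCreation q (e i) (ξ i), preCreation q (e j) (ξ j)⟫_ℂ =
        (if i = j then 1 else 0) * ⟪ξ i, ξ j⟫_ℂ + ((q : ℝ) : ℂ) *
          ⟪preAnnihilation q (e j) (ξ i), preAnnihilation q (e i) (ξ j)⟫_ℂ := fun j => by
      rw [inner_preCreation, preAnnihilation_preCreation, inner_add_right, inner_smul_right,
        inner_smul_right, inner_preAnnihilation, orthonormal_iff_ite.1 he]
    simp only [h3, Finset.sum_add_distrib, ite_mul, one_mul, zero_mul, Finset.sum_ite_eq,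
      Finset.mem_univ, if_true]
    rw [inner_self_eq_norm_sq_to_K]
    simp
  have h4 : ‖∑ i, ∑ j, ⟪preAnnihilation q (e j) (ξ i), preAnnihilation q (e i) (ξ j)⟫_ℂ‖ ≤
      C * ∑ i, ‖ξ i‖ ^ 2 := by
    have h5 : ∑ i, ∑ j, ‖preAnnihilation q (e j) (ξ i)‖ ^ 2 ≤ C * ∑ i, ‖ξ i‖ ^ 2 := by
      rw [Finset.mul_sum]; exact Finset.sum_le_sum fun i _ => h i
    calc _ ≤ ∑ i, ∑ j, (‖preAnnihilation q (e j) (ξ i)‖ ^ 2 +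
            ‖preAnnihilation q (e i) (ξ j)‖ ^ 2) / 2 := by
          refine (norm_sum_le _ _).trans (Finset.sum_le_sum fun i _ =>
            (norm_sum_le _ _).trans (Finset.sum_le_sum fun j _ => (norm_inner_le_norm _ _).trans ?_))
          linarith [two_mul_le_add_sq ‖preAnnihilation q (e j) (ξ i)‖
            ‖preAnnihilation q (e i) (ξ j)‖]
      _ = ∑ i, ∑ j, ‖preAnnihilation q (e j) (ξ i)‖ ^ 2 := by
          simp only [add_div, Finset.sum_add_distrib]
          rw [Finset.sum_comm (f := fun i j => ‖preAnnihilation q (e i) (ξ j)‖ ^ 2 / 2)]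
          simp only [← Finset.sum_div]
          ring
      _ ≤ _ := h5
  have h6 := congrArg norm h1
  rw [Complex.norm_real, Real.norm_of_nonneg (sq_nonneg _)] at h6
  rw [h6]
  refine (norm_add_le _ _).trans ?_
  rw [norm_mul, Complex.norm_real, Complex.norm_real,
    Real.norm_of_nonneg (Finset.sum_nonneg fun i _ => sq_nonneg _), Real.norm_eq_abs]
  calc _ ≤ ∑ i, ‖ξ i‖ ^ 2 + |(q : ℝ)| * (C * ∑ i, ‖ξ i‖ ^ 2) := by gcongr
    _ = _ := by ring

/-- The constant `1 / (1 - |q|)`. -/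
def fockConst : ℝ := (1 - |(q : ℝ)|)⁻¹

lemma fockConst_pos : 0 < fockConst q := inv_pos.2 (sub_pos.2 (abs_lt.2 q.2))

/-- The constant is the fixed point of `C ↦ 1 + |q| C`, so the induction on the degree reproduces it
without loss. -/
lemma fockConst_eq : 1 + |(q : ℝ)| * fockConst q = fockConst q := by
  have : 1 - |(q : ℝ)| ≠ 0 := (sub_pos.2 (abs_lt.2 q.2)).ne'
  rw [fockConst]
  field_simp
  ring

/-- Induction on the degree: annihilation lowers it, so the bound for the vectors `a(eᵢ) x` gives a
row bound for creation, which in turn gives the column bound for `x`. The constant depends neither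
on the degree nor on the number of vectors. -/
lemma annihilation_column_bound {ι : Type*} [Fintype ι] {e : ι → H} (he : Orthonormal ℂ e)
    (x : PreFock q H) :
    ∑ i, ‖preAnnihilation q (e i) x‖ ^ 2 ≤ fockConst q * ‖x‖ ^ 2 := by
  obtain ⟨n, hn⟩ := exists_mem_degreeLE q x
  induction n generalizing x with
  | zero =>
    have := fockConst_pos q
    simp only [preAnnihilation_degreeLE_zero q _ hn]
    simp only [norm_zero, ne_eq, OfNat.ofNat_ne_zero, not_false_eq_true, zero_pow,
      Finset.sum_const_zero]
    positivity
  | succ n ih =>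
    refine sum_norm_preAnnihilation_le q e x ?_ (fockConst_pos q).le
    have := norm_sum_preCreation_le q he (fun i => preAnnihilation q (e i) x) fun i =>
      ih _ (preAnnihilation_degreeLE_succ q (e i) hn)
    rwa [fockConst_eq] at this

lemma creation_row_bound {ι : Type*} [Fintype ι] {e : ι → H} (he : Orthonormal ℂ e)
    (ξ : ι → PreFock q H) :
    ‖∑ i, preCreation q (e i) (ξ i)‖ ^ 2 ≤ fockConst q * ∑ i, ‖ξ i‖ ^ 2 := by
  have := norm_sum_preCreation_le q he ξ fun i => annihilation_column_bound q he (ξ i)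
  rwa [fockConst_eq] at this

end PreFock

/-! ### Amplification of one-particle operators to vectors with entries in another space. -/

section Amplification

open scoped ComplexOrder

variable {H : Type*} [NormedAddCommGroup H] [InnerProductSpace ℂ H]
variable {E : Type*} [SeminormedAddCommGroup E] [InnerProductSpace ℂ E]

/-- The matrix is that of a compression of `T`: Bessel's inequality bounds the left side by `‖T (∑
cⱼ eⱼ)‖²`. -/
lemma sum_norm_sq_inner_apply_le {ι : Type*} [Fintype ι] {e : ι → H} (he : Orthonormal ℂ e)
    (T : H →L[ℂ] H) (c : ι → ℂ) :
    ∑ i, ‖∑ j, ⟪e i, T (e j)⟫_ℂ * c j‖ ^ 2 ≤ ‖T‖ ^ 2 * ∑ j, ‖c j‖ ^ 2 := by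
  have h1 : ∀ i, ∑ j, ⟪e i, T (e j)⟫_ℂ * c j = ⟪e i, T (∑ j, c j • e j)⟫_ℂ := fun i => by
    simp only [map_sum, map_smul, inner_sum, inner_smul_right, mul_comm]
  simp only [h1]
  have h2 : ‖∑ j, c j • e j‖ ^ 2 = ∑ j, ‖c j‖ ^ 2 := by
    have := he.inner_sum c c Finset.univ
    rw [inner_self_eq_norm_sq_to_K] at this
    have h3 : ∑ i, (starRingEnd ℂ) (c i) * c i = ((∑ j, ‖c j‖ ^ 2 : ℝ) : ℂ) := by
      rw [Complex.ofReal_sum]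
      exact Finset.sum_congr rfl fun j _ => by rw [Complex.conj_mul']; simp
    rw [h3] at this
    refine Complex.ofReal_injective (Eq.trans ?_ this)
    simp
  calc _ ≤ ‖T (∑ j, c j • e j)‖ ^ 2 := he.sum_inner_products_le _
    _ ≤ (‖T‖ * ‖∑ j, c j • e j‖) ^ 2 := by gcongr; exact T.le_opNorm _
    _ = _ := by rw [mul_pow, h2]

/-- The amplification of an operator has at most its norm. -/
lemma sum_norm_sq_sum_smul_le {ι : Type*} [Fintype ι] {e : ι → H} (he : Orthonormal ℂ e)
    (T : H →L[ℂ] H) (η : ι → E) :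
    ∑ i, ‖∑ j, ⟪e i, T (e j)⟫_ℂ • η j‖ ^ 2 ≤ ‖T‖ ^ 2 * ∑ j, ‖η j‖ ^ 2 := by
  classical
  let t (i j : ι) : ℂ := ⟪e i, T (e j)⟫_ℂ
  -- `M` is `‖T‖² - t* t`, positive by the scalar case. Its Schur product with the Gram matrix of
  -- `η` is positive, and testing it on the all-ones vector gives the difference of the two sides.
  let M : Matrix ι ι ℂ := Matrix.of fun j k =>
    ((‖T‖ ^ 2 : ℝ) : ℂ) * (if j = k then 1 else 0) - ∑ i, star (t i j) * t i k
  have hM : M.PosSemidef := by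
    rw [Matrix.posSemidef_iff_dotProduct_mulVec]
    refine ⟨?_, fun x => ?_⟩
    · ext j k
      simp only [M, Matrix.conjTranspose_apply, Matrix.of_apply, star_sub, star_mul', star_sum,
        Complex.star_def, Complex.conj_ofReal, mul_comm, eq_comm (a := j)]
      split_ifs <;> simp <;> exact Finset.sum_congr rfl fun _ _ => mul_comm _ _
    · have h1 : star x ⬝ᵥ (M.mulVec x) =
          ((‖T‖ ^ 2 * ∑ j, ‖x j‖ ^ 2 - ∑ i, ‖∑ j, t i j * x j‖ ^ 2 : ℝ) : ℂ) := by
        have h2 : ∀ z : ℂ, ((‖z‖ ^ 2 : ℝ) : ℂ) = star z * z := fun z => by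
          rw [Complex.star_def, Complex.conj_mul']; simp
        rw [Complex.ofReal_sub, Complex.ofReal_mul, Complex.ofReal_sum, Complex.ofReal_sum]
        simp only [h2, dotProduct, Matrix.mulVec, M, Matrix.of_apply, sub_mul, Finset.sum_sub_distrib,
          mul_sub, Pi.star_apply]
        congr 1
        · simp [Finset.mul_sum]
          refine Finset.sum_congr rfl fun j _ => by ring
        · simp only [star_sum, Finset.sum_mul_sum]
          rw [Finset.sum_comm]
          refine Finset.sum_congr rfl fun j _ => ?_
          rw [Finset.sum_comm, Finset.mul_sum]
          refine Finset.sum_congr rfl fun k _ => ?_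
          rw [Finset.sum_mul, Finset.mul_sum]
          refine Finset.sum_congr rfl fun i _ => ?_
          rw [star_mul']
          ring
      rw [h1]
      have := sum_norm_sq_inner_apply_le he T x
      exact_mod_cast sub_nonneg.2 this
  have hG : (Matrix.of fun j k => ⟪η j, η k⟫_ℂ).PosSemidef := by
    -- Passing to the completion makes the seminormed `E` a genuine inner product space without
    -- changing the Gram matrix.
    have := posSemidef_gram fun j => (η j : UniformSpace.Completion E)
    simpa [UniformSpace.Completion.inner_coe] using this
  have h0 := (Matrix.posSemidef_iff_dotProduct_mulVec.1 (hM.hadamard hG)).2 (fun _ => 1)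
  have h1 : ∀ z : E, ((‖z‖ ^ 2 : ℝ) : ℂ) = ⟪z, z⟫_ℂ := fun z => by
    rw [inner_self_eq_norm_sq_to_K]; simp
  have h2 : star (fun _ : ι => (1 : ℂ)) ⬝ᵥ
      ((M.hadamard (Matrix.of fun j k => ⟪η j, η k⟫_ℂ)).mulVec fun _ => 1) =
      ((‖T‖ ^ 2 * ∑ j, ‖η j‖ ^ 2 - ∑ i, ‖∑ j, t i j • η j‖ ^ 2 : ℝ) : ℂ) := by
    rw [Complex.ofReal_sub, Complex.ofReal_mul, Complex.ofReal_sum, Complex.ofReal_sum]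
    simp only [h1, dotProduct, Matrix.mulVec, M, Matrix.of_apply, Matrix.hadamard_apply, sub_mul,
      Finset.sum_sub_distrib, Pi.star_apply, star_one, one_mul, mul_one, mul_ite, mul_zero,
      ite_mul, zero_mul, Finset.sum_ite_eq, Finset.mem_univ, if_true, ← Finset.mul_sum]
    congr 1
    simp only [sum_inner, inner_sum, inner_smul_left, inner_smul_right]
    conv_rhs => rw [Finset.sum_comm]
    conv_lhs => rw [Finset.sum_comm]
    refine Finset.sum_congr rfl fun j _ => ?_
    simp only [Finset.mul_sum]
    conv_rhs => rw [Finset.sum_comm]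
    refine Finset.sum_congr rfl fun k _ => ?_
    rw [Finset.sum_mul]
    refine Finset.sum_congr rfl fun i _ => ?_
    rw [starRingEnd_apply]
    ring
  rw [h2] at h0
  exact sub_nonneg.1 (by exact_mod_cast h0)

end Amplification

/-! ### Norm bounds for the three operators on formal tensors. -/

section Gauge

variable (q : Set.Ioo (-1 : ℝ) 1) {H : Type*} [NormedAddCommGroup H] [InnerProductSpace ℂ H]

/-- A formal tensor involves finitely many one-particle vectors, so a finite orthonormal family
suffices for each estimate. -/
lemma exists_orthonormal_sum_repr (s : Finset H) : ∃ (n : ℕ) (e : Fin n → H), Orthonormal ℂ e ∧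
    ∀ h ∈ s, ∑ i, ⟪e i, h⟫_ℂ • e i = h := by
  let V := Submodule.span ℂ (s : Set H)
  let b := stdOrthonormalBasis ℂ V
  refine ⟨_, fun i => (b i : H), b.orthonormal.comp_linearIsometry V.subtypeₗᵢ, fun h hh => ?_⟩
  have := b.sum_repr' ⟨h, Submodule.subset_span hh⟩
  simpa using congrArg (fun v : V => (v : H)) this

lemma preAnnihilation_add (ζ η : H) :
    preAnnihilation q (ζ + η) = preAnnihilation q ζ + preAnnihilation q η := by
  refine LinearMap.ext fun x => preFock_induction q (p := fun x => preAnnihilation q (ζ + η) x =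
    preAnnihilation q ζ x + preAnnihilation q η x) x (by simp) (fun x y h h' => ?_)
    (fun c x h => ?_) fun l => ?_
  · rw [map_add, h, h', map_add, map_add]; abel
  · rw [map_smul, h, map_smul, map_smul, smul_add]
  · simp only [preAnnihilation_preTensor, ← Finset.sum_add_distrib, inner_add_left, mul_add, add_smul]

lemma preAnnihilation_smul (c : ℂ) (ζ : H) :
    preAnnihilation q (c • ζ) = star c • preAnnihilation q ζ := by
  refine LinearMap.ext fun x => preFock_induction q (p := fun x => preAnnihilation q (c • ζ) x =
    star c • preAnnihilation q ζ x) x (by simp) (fun x y h h' => ?_)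
    (fun d x h => ?_) fun l => ?_
  · rw [map_add, h, h', map_add, smul_add]
  · rw [map_smul, h, map_smul, smul_comm]
  · simp only [preAnnihilation_preTensor, inner_smul_left, Finset.smul_sum, smul_smul]
    refine Finset.sum_congr rfl fun k _ => ?_
    congr 1
    rw [starRingEnd_apply]
    ring

lemma preAnnihilation_sum {ι : Type*} (s : Finset ι) (c : ι → ℂ) (e : ι → H) :
    preAnnihilation q (∑ i ∈ s, c i • e i) = ∑ i ∈ s, star (c i) • preAnnihilation q (e i) := by
  classical
  induction s using Finset.induction_on with
  | empty => simpa using preAnnihilation_smul q 0 (0 : H)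
  | insert i s hi ih =>
    rw [Finset.sum_insert hi, Finset.sum_insert hi, preAnnihilation_add, preAnnihilation_smul, ih]

/-- Formal tensors are multilinear only modulo null vectors, so expansions in a basis are compared
through inner products and then norms, not as equalities. -/
lemma norm_eq_of_inner_eq {x y : PreFock q H} (h : ∀ z, ⟪x, z⟫_ℂ = ⟪y, z⟫_ℂ) : ‖x‖ = ‖y‖ := by
  have h1 : ⟪x, x⟫_ℂ = ⟪y, y⟫_ℂ := by
    rw [h x, ← inner_conj_symm, h y, inner_conj_symm]
  rw [inner_self_eq_norm_sq_to_K, inner_self_eq_norm_sq_to_K] at h1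
  have h2 : ‖x‖ ^ 2 = ‖y‖ ^ 2 := by exact_mod_cast h1
  exact (pow_left_inj₀ (norm_nonneg _) (norm_nonneg _) two_ne_zero).1 h2

/-- Expanding `ζ` in an orthonormal family makes this the row bound for the vectors `⟨eᵢ, ζ⟩ x`. -/
lemma norm_preCreation_le (ζ : H) (x : PreFock q H) :
    ‖preCreation q ζ x‖ ≤ √(fockConst q) * ‖ζ‖ * ‖x‖ := by
  obtain ⟨n, e, he, h⟩ := exists_orthonormal_sum_repr {ζ}
  have hζ := h ζ (Finset.mem_singleton_self _)
  have h1 : ‖preCreation q ζ x‖ = ‖∑ i, preCreation q (e i) (⟪e i, ζ⟫_ℂ • x)‖ := by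
    refine norm_eq_of_inner_eq q fun z => ?_
    rw [inner_preCreation, sum_inner]
    conv_lhs => rw [← hζ]
    rw [preAnnihilation_sum, LinearMap.sum_apply, inner_sum]
    refine Finset.sum_congr rfl fun i _ => ?_
    rw [map_smul, inner_smul_left, inner_preCreation, LinearMap.smul_apply, inner_smul_right]
    rfl
  have h2 : ‖preCreation q ζ x‖ ^ 2 ≤ (√(fockConst q) * ‖ζ‖ * ‖x‖) ^ 2 := by
    rw [h1]
    refine (creation_row_bound q he _).trans ?_
    rw [mul_pow, mul_pow, Real.sq_sqrt (fockConst_pos q).le, mul_assoc]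
    refine mul_le_mul_of_nonneg_left ?_ (fockConst_pos q).le
    simp only [norm_smul, mul_pow, ← Finset.sum_mul]
    exact mul_le_mul_of_nonneg_right (he.sum_inner_products_le ζ) (sq_nonneg _)
  exact (pow_le_pow_iff_left₀ (norm_nonneg _) (by positivity) two_ne_zero).1 h2

lemma norm_preAnnihilation_le (ζ : H) (x : PreFock q H) :
    ‖preAnnihilation q ζ x‖ ≤ √(fockConst q) * ‖ζ‖ * ‖x‖ := by
  rcases (norm_nonneg (preAnnihilation q ζ x)).eq_or_lt with h | h
  · rw [← h]; positivity
  · refine le_of_mul_le_mul_right ?_ h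
    have h1 : ((‖preAnnihilation q ζ x‖ * ‖preAnnihilation q ζ x‖ : ℝ) : ℂ) =
        ⟪x, preCreation q ζ (preAnnihilation q ζ x)⟫_ℂ := by
      rw [← inner_preAnnihilation, inner_self_eq_norm_sq_to_K, ← sq]; simp
    have h2 := congrArg norm h1
    rw [Complex.norm_real, Real.norm_of_nonneg (by positivity)] at h2
    rw [h2]
    refine (norm_inner_le_norm _ _).trans ?_
    calc _ ≤ ‖x‖ * (√(fockConst q) * ‖ζ‖ * ‖preAnnihilation q ζ x‖) := by
          gcongr; exact norm_preCreation_le q _ _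
      _ = _ := by ring

/-- Modulo null vectors, `p(T) = ∑ ⟨eᵢ, T eⱼ⟩ a*(eᵢ) a(eⱼ)` once the family reproduces the factors
of `x` and their images under `T`. Allowing every family that reproduces `s` makes the property
stable under enlarging `s`, as sums require. -/
lemma exists_sum_repr_of_preFock (T : H →L[ℂ] H) (x : PreFock q H) :
    ∃ s : Finset H, ∀ (n : ℕ) (e : Fin n → H), (∀ h ∈ s, ∑ i, ⟪e i, h⟫_ℂ • e i = h) →
      ∀ z, ⟪preGauge q T x, z⟫_ℂ =
        ⟪∑ i, preCreation q (e i) (∑ j, ⟪e i, T (e j)⟫_ℂ • preAnnihilation q (e j) x), z⟫_ℂ := by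
  classical
  refine preFock_induction q (p := fun x => ∃ s : Finset H, ∀ (n : ℕ) (e : Fin n → H),
    (∀ h ∈ s, ∑ i, ⟪e i, h⟫_ℂ • e i = h) → ∀ z, ⟪preGauge q T x, z⟫_ℂ =
      ⟪∑ i, preCreation q (e i) (∑ j, ⟪e i, T (e j)⟫_ℂ • preAnnihilation q (e j) x), z⟫_ℂ) x
    ⟨∅, by simp⟩ ?_ ?_ fun l => ?_
  · rintro x y ⟨s, hs⟩ ⟨t, ht⟩
    refine ⟨s ∪ t, fun n e h z => ?_⟩
    rw [map_add, inner_add_left, hs n e (fun v hv => h v (Finset.mem_union_left _ hv)),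
      ht n e (fun v hv => h v (Finset.mem_union_right _ hv)), ← inner_add_left]
    simp only [map_add, smul_add, Finset.sum_add_distrib]
  · rintro c x ⟨s, hs⟩
    refine ⟨s, fun n e h z => ?_⟩
    rw [map_smul, inner_smul_left, hs n e h, ← inner_smul_left]
    simp only [map_smul, smul_comm _ c, ← Finset.smul_sum]
  · refine ⟨l.toFinset ∪ l.toFinset.image T, fun n e h z => ?_⟩
    have h1 : ∀ v ∈ l, ∑ i, ⟪e i, v⟫_ℂ • e i = v := fun v hv =>
      h v (Finset.mem_union_left _ (List.mem_toFinset.2 hv))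
    have h2 : ∀ v ∈ l, ∑ i, ⟪e i, T v⟫_ℂ • e i = T v := fun v hv =>
      h _ (Finset.mem_union_right _ (Finset.mem_image_of_mem T (List.mem_toFinset.2 hv)))
    have h3 : ∀ i, ∑ j, ⟪e i, T (e j)⟫_ℂ • preAnnihilation q (e j) (preTensor q l) =
        ∑ k : Fin l.length, (((q : ℝ) : ℂ) ^ (k : ℕ) * ⟪e i, T (l.get k)⟫_ℂ) •
          preTensor q (l.eraseIdx k) := fun i => by
      simp only [preAnnihilation_preTensor, Finset.smul_sum, smul_smul]
      rw [Finset.sum_comm]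
      refine Finset.sum_congr rfl fun k _ => ?_
      rw [← Finset.sum_smul]
      congr 1
      conv_rhs => rw [← h1 (l.get k) (List.get_mem l k)]
      rw [map_sum, inner_sum, Finset.mul_sum]
      refine Finset.sum_congr rfl fun j _ => ?_
      rw [map_smul, inner_smul_right]
      ring
    simp only [h3]
    rw [preGauge_preTensor, sum_inner, sum_inner]
    simp only [map_sum, map_smul, sum_inner]
    rw [Finset.sum_comm]
    refine Finset.sum_congr rfl fun k _ => ?_
    rw [inner_smul_left, ← preCreation_preTensor, inner_preCreation]
    conv_lhs => rw [← h2 (l.get k) (List.get_mem l k)]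
    rw [preAnnihilation_sum, LinearMap.sum_apply, inner_sum, Finset.mul_sum]
    refine Finset.sum_congr rfl fun i _ => ?_
    rw [inner_smul_left, inner_preCreation, LinearMap.smul_apply, inner_smul_right, map_mul,
      mul_assoc]
    rfl

/-- The representation `a* · T · a` is bounded by the row bound for creation, the amplification
bound for `T` and the column bound for annihilation; the two outer ones contribute `√(fockConst q)`
each. -/
lemma norm_preGauge_le (T : H →L[ℂ] H) (x : PreFock q H) :
    ‖preGauge q T x‖ ≤ fockConst q * ‖T‖ * ‖x‖ := by
  obtain ⟨s, hs⟩ := exists_sum_repr_of_preFock q T x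
  obtain ⟨n, e, he, h⟩ := exists_orthonormal_sum_repr s
  have hC := (fockConst_pos q).le
  have h2 : ‖preGauge q T x‖ ^ 2 ≤ (fockConst q * ‖T‖ * ‖x‖) ^ 2 := by
    rw [norm_eq_of_inner_eq q (hs n e h)]
    calc _ ≤ fockConst q * ∑ i, ‖∑ j, ⟪e i, T (e j)⟫_ℂ • preAnnihilation q (e j) x‖ ^ 2 :=
          creation_row_bound q he _
      _ ≤ fockConst q * (‖T‖ ^ 2 * ∑ j, ‖preAnnihilation q (e j) x‖ ^ 2) := by
          gcongr; exact sum_norm_sq_sum_smul_le he T _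
      _ ≤ fockConst q * (‖T‖ ^ 2 * (fockConst q * ‖x‖ ^ 2)) := by
          gcongr; exact annihilation_column_bound q he x
      _ = _ := by ring
  exact (pow_le_pow_iff_left₀ (norm_nonneg _) (by positivity) two_ne_zero).1 h2

end Gauge

/-! ### Bounded operators on the `q`-Fock space: action on tensors, adjoints, linearity, density. -/

section FockOperators

variable (q : Set.Ioo (-1 : ℝ) 1) {H : Type*} [NormedAddCommGroup H] [InnerProductSpace ℂ H]

lemma denseRange_toComplL : DenseRange
    ((UniformSpace.Completion.toComplL (𝕜 := ℂ) (E := PreFock q H)).toLinearMap) :=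
  UniformSpace.Completion.denseRange_coe

/-- The extension by continuity is tied to its defining formula only through a norm bound; the
preceding estimates supply it. -/
lemma extend_coe (f : List H → PreFock q H) {C : ℝ}
    (h : ∀ x, ‖preLift q f x‖ ≤ C * ‖x‖) (x : PreFock q H) :
    extend q f (x : Fock q H) = (preLift q f x : Fock q H) :=
  LinearMap.extendOfNorm_eq (denseRange_toComplL q) ⟨C, fun x => by simpa using h x⟩ x

lemma norm_extend_le (f : List H → PreFock q H) {C : ℝ} (hC : 0 ≤ C)
    (h : ∀ x, ‖preLift q f x‖ ≤ C * ‖x‖) : ‖extend q f‖ ≤ C :=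
  LinearMap.opNorm_extendOfNorm_le (denseRange_toComplL q) hC fun x => by simpa using h x

lemma norm_creation_le (ζ : H) : ‖creation q ζ‖ ≤ √(fockConst q) * ‖ζ‖ :=
  norm_extend_le q _ (by positivity) (norm_preCreation_le q ζ)

lemma norm_annihilation_le (ζ : H) : ‖annihilation q ζ‖ ≤ √(fockConst q) * ‖ζ‖ :=
  norm_extend_le q _ (by positivity) (norm_preAnnihilation_le q ζ)

lemma norm_gauge_le (T : H →L[ℂ] H) : ‖gauge q T‖ ≤ fockConst q * ‖T‖ :=
  norm_extend_le q _ (mul_nonneg (fockConst_pos q).le (norm_nonneg _)) (norm_preGauge_le q T)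

lemma creation_coe (ζ : H) (x : PreFock q H) :
    creation q ζ (x : Fock q H) = (preCreation q ζ x : Fock q H) :=
  extend_coe q _ (norm_preCreation_le q ζ) x

lemma annihilation_coe (ζ : H) (x : PreFock q H) :
    annihilation q ζ (x : Fock q H) = (preAnnihilation q ζ x : Fock q H) :=
  extend_coe q _ (norm_preAnnihilation_le q ζ) x

lemma gauge_coe (T : H →L[ℂ] H) (x : PreFock q H) :
    gauge q T (x : Fock q H) = (preGauge q T x : Fock q H) :=
  extend_coe q _ (norm_preGauge_le q T) x

lemma coe_sum_smul_preTensor {ι : Type*} (s : Finset ι) (c : ι → ℂ) (l : ι → List H) :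
    ((∑ i ∈ s, c i • preTensor q (l i) : PreFock q H) : Fock q H) =
      ∑ i ∈ s, c i • tensor q (l i) := by
  change UniformSpace.Completion.toComplL (𝕜 := ℂ) (E := PreFock q H) _ = _
  rw [map_sum]
  exact Finset.sum_congr rfl fun i _ => by rw [map_smul]; rfl

lemma creation_tensor (ζ : H) (l : List H) : creation q ζ (tensor q l) = tensor q (ζ :: l) := by
  rw [tensor, creation_coe, preCreation_preTensor, tensor]

lemma annihilation_tensor (ζ : H) (l : List H) :
    annihilation q ζ (tensor q l) = ∑ k : Fin l.length,
      (((q : ℝ) : ℂ) ^ (k : ℕ) * ⟪ζ, l.get k⟫_ℂ) • tensor q (l.eraseIdx k) := by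
  rw [tensor, annihilation_coe, preAnnihilation_preTensor, coe_sum_smul_preTensor]

lemma gauge_tensor (T : H →L[ℂ] H) (l : List H) :
    gauge q T (tensor q l) = ∑ k : Fin l.length,
      (((q : ℝ) : ℂ) ^ (k : ℕ)) • tensor q (T (l.get k) :: l.eraseIdx k) := by
  rw [tensor, gauge_coe, preGauge_preTensor, coe_sum_smul_preTensor]

/-- The span of the simple tensors whose factors lie in `V`. -/
def tensorSpan (V : Set H) : Submodule ℂ (Fock q H) :=
  Submodule.span ℂ (tensor q '' {l : List H | ∀ h ∈ l, h ∈ V})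

lemma coe_mem_tensorSpan_univ (x : PreFock q H) : (x : Fock q H) ∈ tensorSpan q (Set.univ : Set H) := by
  refine preFock_induction q (p := fun x => (x : Fock q H) ∈ tensorSpan q (Set.univ : Set H)) x ?_
    (fun x y h h' => ?_) (fun c x h => ?_) fun l => Submodule.subset_span ⟨l, by simp, rfl⟩
  · rw [UniformSpace.Completion.coe_zero]; exact zero_mem _
  · rw [UniformSpace.Completion.coe_add]; exact add_mem h h'
  · rw [UniformSpace.Completion.coe_smul]; exact Submodule.smul_mem _ _ h

lemma topologicalClosure_tensorSpan_univ :
    (tensorSpan q (Set.univ : Set H)).topologicalClosure = ⊤ := by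
  rw [← Submodule.dense_iff_topologicalClosure_eq_top]
  refine (UniformSpace.Completion.denseRange_coe (α := PreFock q H)).mono ?_
  rintro _ ⟨x, rfl⟩
  exact coe_mem_tensorSpan_univ q x

lemma clm_ext_tensor {E : Type*} [NormedAddCommGroup E] [NormedSpace ℂ E] {A B : Fock q H →L[ℂ] E}
    (h : ∀ l, A (tensor q l) = B (tensor q l)) : A = B := by
  refine ContinuousLinearMap.ext_on (s := tensor q '' {l : List H | ∀ h ∈ l, h ∈ Set.univ}) ?_ ?_
  · exact (Submodule.dense_iff_topologicalClosure_eq_top).2 (topologicalClosure_tensorSpan_univ q)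
  · rintro _ ⟨l, -, rfl⟩
    exact h l

lemma inner_creation (ζ : H) (x y : Fock q H) :
    ⟪creation q ζ x, y⟫_ℂ = ⟪x, annihilation q ζ y⟫_ℂ := by
  induction x, y using UniformSpace.Completion.induction_on₂ with
  | hp => exact isClosed_eq (by fun_prop) (by fun_prop)
  | ih x y =>
    rw [creation_coe, annihilation_coe, UniformSpace.Completion.inner_coe,
      UniformSpace.Completion.inner_coe, inner_preCreation]

lemma inner_annihilation (ζ : H) (x y : Fock q H) :
    ⟪annihilation q ζ x, y⟫_ℂ = ⟪x, creation q ζ y⟫_ℂ := by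
  rw [← inner_conj_symm, ← inner_creation, inner_conj_symm]

lemma adjoint_creation (ζ : H) :
    ContinuousLinearMap.adjoint (creation q ζ) = annihilation q ζ := by
  refine ((ContinuousLinearMap.eq_adjoint_iff _ _).2 fun x y => ?_).symm
  exact inner_annihilation q ζ x y

lemma adjoint_annihilation (ζ : H) :
    ContinuousLinearMap.adjoint (annihilation q ζ) = creation q ζ := by
  rw [← adjoint_creation, ContinuousLinearMap.adjoint_adjoint]

lemma inner_tensor_cons (ζ : H) (l : List H) (y : Fock q H) :
    ⟪tensor q (ζ :: l), y⟫_ℂ = ⟪tensor q l, annihilation q ζ y⟫_ℂ := by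
  rw [← creation_tensor, inner_creation]

/-- Both sides expand into the same double sum, over a factor removed from `l` and a factor removed
from `l'`, with `⟨T ηₖ, η'ⱼ⟩` paired as `⟨ηₖ, T' η'ⱼ⟩`. -/
lemma inner_gauge_tensor (T T' : H →L[ℂ] H) (h : ∀ x y, ⟪T x, y⟫_ℂ = ⟪x, T' y⟫_ℂ) (l l' : List H) :
    ⟪gauge q T (tensor q l), tensor q l'⟫_ℂ = ⟪tensor q l, gauge q T' (tensor q l')⟫_ℂ := by
  have h2 : ∀ (v : H) (m m' : List H), ⟪tensor q m', tensor q (v :: m)⟫_ℂ =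
      ∑ k : Fin m'.length, (((q : ℝ) : ℂ) ^ (k : ℕ) * ⟪m'.get k, v⟫_ℂ) *
        ⟪tensor q (m'.eraseIdx k), tensor q m⟫_ℂ := fun v m m' => by
    rw [← creation_tensor, ← inner_annihilation, annihilation_tensor, sum_inner]
    refine Finset.sum_congr rfl fun k _ => ?_
    rw [inner_smul_left, map_mul, map_pow, Complex.conj_ofReal, inner_conj_symm]
  rw [gauge_tensor, gauge_tensor, sum_inner, inner_sum]
  simp only [inner_smul_left, inner_smul_right, inner_tensor_cons, annihilation_tensor, inner_sum,
    h2, Finset.mul_sum, map_pow, Complex.conj_ofReal]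
  rw [Finset.sum_comm]
  refine Finset.sum_congr rfl fun k _ => Finset.sum_congr rfl fun j _ => ?_
  rw [h]
  ring

lemma adjoint_gauge (T T' : H →L[ℂ] H) (h : ∀ x y, ⟪T x, y⟫_ℂ = ⟪x, T' y⟫_ℂ) :
    ContinuousLinearMap.adjoint (gauge q T) = gauge q T' := by
  refine clm_ext_tensor q fun l => ?_
  refine ext_inner_left ℂ fun v => ?_
  rw [ContinuousLinearMap.adjoint_inner_right]
  have : (innerSL ℂ (gauge q T' (tensor q l))) =
      (innerSL ℂ (tensor q l)).comp (gauge q T) := by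
    refine clm_ext_tensor q fun m => ?_
    simp only [innerSL_apply_apply, ContinuousLinearMap.comp_apply]
    rw [← inner_conj_symm, ← inner_gauge_tensor q T T' h, inner_conj_symm]
  have h3 := congrArg (fun A => A v) this
  simp only [innerSL_apply_apply, ContinuousLinearMap.comp_apply] at h3
  rw [← inner_conj_symm, ← h3, inner_conj_symm]

lemma annihilation_creation (ζ η : H) (x : Fock q H) :
    annihilation q ζ (creation q η x) =
      ⟪ζ, η⟫_ℂ • x + ((q : ℝ) : ℂ) • creation q η (annihilation q ζ x) := by
  have h : (annihilation q ζ).comp (creation q η) =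
      ⟪ζ, η⟫_ℂ • ContinuousLinearMap.id ℂ (Fock q H) +
        ((q : ℝ) : ℂ) • (creation q η).comp (annihilation q ζ) := by
    refine clm_ext_tensor q fun l => ?_
    change annihilation q ζ (creation q η (preTensor q l : Fock q H)) =
      ⟪ζ, η⟫_ℂ • (preTensor q l : Fock q H) +
        ((q : ℝ) : ℂ) • creation q η (annihilation q ζ (preTensor q l : Fock q H))
    rw [creation_coe, annihilation_coe, annihilation_coe, creation_coe,
      preAnnihilation_preCreation, UniformSpace.Completion.coe_add,
      UniformSpace.Completion.coe_smul, UniformSpace.Completion.coe_smul]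
  exact DFunLike.congr_fun h x

lemma annihilation_add (ζ η : H) :
    annihilation q (ζ + η) = annihilation q ζ + annihilation q η := by
  refine clm_ext_tensor q fun l => ?_
  simp only [add_apply, annihilation_tensor, ← Finset.sum_add_distrib,
    inner_add_left, mul_add, add_smul]

lemma annihilation_smul (c : ℂ) (ζ : H) :
    annihilation q (c • ζ) = star c • annihilation q ζ := by
  refine clm_ext_tensor q fun l => ?_
  simp only [smul_apply, annihilation_tensor, Finset.smul_sum, smul_smul,
    inner_smul_left]
  refine Finset.sum_congr rfl fun k _ => ?_
  rw [starRingEnd_apply, mul_left_comm]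

lemma creation_add (ζ η : H) : creation q (ζ + η) = creation q ζ + creation q η := by
  rw [← adjoint_annihilation, annihilation_add, map_add, adjoint_annihilation,
    adjoint_annihilation]

lemma creation_smul (c : ℂ) (ζ : H) : creation q (c • ζ) = c • creation q ζ := by
  rw [← adjoint_annihilation, annihilation_smul, map_smulₛₗ, adjoint_annihilation]
  simp

lemma gauge_add (S T : H →L[ℂ] H) : gauge q (S + T) = gauge q S + gauge q T := by
  refine clm_ext_tensor q fun l => ?_
  simp only [add_apply, gauge_tensor, ← creation_tensor, creation_add,
    ← Finset.sum_add_distrib, smul_add]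

lemma gauge_smul (c : ℂ) (T : H →L[ℂ] H) : gauge q (c • T) = c • gauge q T := by
  refine clm_ext_tensor q fun l => ?_
  simp only [smul_apply, gauge_tensor, ← creation_tensor, creation_smul,
    Finset.smul_sum, smul_comm c]

/-- A dense set of one-particle vectors gives a dense set of Fock space vectors. -/
lemma dense_tensorSpan {V : Set H} (hV : Dense V) : Dense (tensorSpan q V : Set (Fock q H)) := by
  rw [Submodule.dense_iff_topologicalClosure_eq_top, eq_top_iff,
    ← topologicalClosure_tensorSpan_univ]
  refine Submodule.topologicalClosure_minimal _ (Submodule.span_le.2 ?_)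
    (Submodule.isClosed_topologicalClosure _)
  rintro _ ⟨l, -, rfl⟩
  rw [SetLike.mem_coe]
  induction l with
  | nil => exact Submodule.le_topologicalClosure _ (Submodule.subset_span ⟨[], by simp, rfl⟩)
  | cons ζ l ih =>
    have hcl : IsClosed ((tensorSpan q V).topologicalClosure : Set (Fock q H)) :=
      Submodule.isClosed_topologicalClosure _
    -- Creation by elements of `V` preserves the closed span; continuity of `v ↦ a*(v)` then admits
    -- an arbitrary first factor.
    have h1 : ∀ v ∈ V, creation q v (tensor q l) ∈ (tensorSpan q V).topologicalClosure := by
      intro v hv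
      have h2 : tensorSpan q V ≤ (tensorSpan q V).topologicalClosure.comap
          (creation q v).toLinearMap := by
        refine Submodule.span_le.2 ?_
        rintro _ ⟨m, hm, rfl⟩
        refine Submodule.le_topologicalClosure _ (Submodule.subset_span ⟨v :: m, ?_, ?_⟩)
        · intro h hh
          rcases List.mem_cons.1 hh with rfl | hh
          exacts [hv, hm h hh]
        · exact (creation_tensor q v m).symm
      exact Submodule.topologicalClosure_minimal _ h2
        (hcl.preimage (creation q v).continuous) ih
    rw [← creation_tensor]
    have hc : Continuous fun v : H => creation q v (tensor q l) := by
      let L : H →ₗ[ℂ] Fock q H :=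
        { toFun := fun v => creation q v (tensor q l)
          map_add' := fun v w => by rw [creation_add]; rfl
          map_smul' := fun c v => by rw [creation_smul]; rfl }
      refine (L.mkContinuous (√(fockConst q) * ‖tensor q l‖) fun v => ?_).continuous
      calc ‖creation q v (tensor q l)‖ ≤ (√(fockConst q) * ‖v‖) * ‖tensor q l‖ :=
            (creation q v).le_of_opNorm_le (norm_creation_le q v) _
        _ = _ := by ring
    exact hcl.closure_subset_iff.2 (fun x hx => hx)
      (map_mem_closure (f := fun v => creation q v (tensor q l)) hc (hV ζ) (t := ((tensorSpan q V).topologicalClosure : Set (Fock q H))) h1)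

end FockOperators

/-! ### Weighted sums over the removal of one tensor factor. -/

section RemovalSum

variable (q : Set.Ioo (-1 : ℝ) 1) {α β E : Type*} [NormedAddCommGroup E] [NormedSpace ℂ E]

/-- The sum `∑ₖ q^{k-1} φ(ηₖ, (η₁, …, η̌ₖ, …, ηₙ))` (the index `k` starts at `0` here). -/
def removalSum (φ : α → List α → E) (l : List α) : E :=
  ∑ k : Fin l.length, (((q : ℝ) : ℂ) ^ (k : ℕ)) • φ (l.get k) (l.eraseIdx k)

lemma removalSum_cons (φ : α → List α → E) (a : α) (l : List α) :
    removalSum q φ (a :: l) =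
      φ a l + ((q : ℝ) : ℂ) • removalSum q (fun b m => φ b (a :: m)) l := by
  simp only [removalSum, List.length_cons]
  rw [Fin.sum_univ_succ, Finset.smul_sum]
  simp only [Fin.val_zero, pow_zero, one_smul, List.get_cons_zero, List.eraseIdx_cons_zero,
    Fin.val_succ, List.eraseIdx_cons_succ, smul_smul, pow_succ']
  rfl

/-- The weight `q^{|u|}` paid for reaching behind `u` is the source of all decay in the proof. -/
lemma removalSum_append (φ : α → List α → E) (u l : List α) :
    removalSum q φ (u ++ l) = removalSum q (fun b m => φ b (m ++ l)) u +
      (((q : ℝ) : ℂ) ^ u.length) • removalSum q (fun b m => φ b (u ++ m)) l := by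
  induction u generalizing φ with
  | nil => simp [removalSum]
  | cons a u ih =>
    rw [List.cons_append, removalSum_cons, ih, removalSum_cons, List.length_cons, pow_succ',
      smul_add, smul_smul, add_assoc]
    rfl

lemma removalSum_map (φ : β → List β → E) (v : α → β) (l : List α) :
    removalSum q φ (l.map v) = removalSum q (fun a m => φ (v a) (m.map v)) l := by
  induction l generalizing φ with
  | nil => rfl
  | cons a l ih => rw [List.map_cons, removalSum_cons, ih, removalSum_cons]; rfl

lemma removalSum_eq_zero {φ : α → List α → E} {l : List α} (h : ∀ a ∈ l, ∀ m, φ a m = 0) :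
    removalSum q φ l = 0 :=
  Finset.sum_eq_zero fun k _ => by rw [h _ (List.get_mem l k), smul_zero]

/-- The weights are at most one and are dropped. The bound is required only on sublists, so that
properties of all factors of `l` remain available. -/
lemma norm_removalSum_le {φ : α → List α → E} {ψ : α → List α → ℝ} {l : List α}
    (h : ∀ a ∈ l, ∀ m, m.Sublist l → ‖φ a m‖ ≤ ψ a m) :
    ‖removalSum q φ l‖ ≤ ∑ k : Fin l.length, ψ (l.get k) (l.eraseIdx k) := by
  refine (norm_sum_le _ _).trans (Finset.sum_le_sum fun k _ => ?_)
  rw [norm_smul, norm_pow, Complex.norm_real, Real.norm_eq_abs]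
  refine (mul_le_of_le_one_left (norm_nonneg _) (pow_le_one₀ (abs_nonneg _) ?_)).trans
    (h _ (List.get_mem l k) _ (List.eraseIdx_sublist l k))
  exact (abs_lt.2 q.2).le

end RemovalSum

/-! ### Products of field operators at far vectors, and decay across a block of them. -/

section Far

variable (q : Set.Ioo (-1 : ℝ) 1) {H : Type*} [NormedAddCommGroup H] [InnerProductSpace ℂ H]

lemma annihilation_tensor_eq (ζ : H) (l : List H) :
    annihilation q ζ (tensor q l) = removalSum q (fun η m => ⟪ζ, η⟫_ℂ • tensor q m) l := by
  simp only [annihilation_tensor, removalSum, smul_smul]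

lemma gauge_tensor_eq (T : H →L[ℂ] H) (l : List H) :
    gauge q T (tensor q l) = removalSum q (fun η m => tensor q (T η :: m)) l := by
  simp only [gauge_tensor, removalSum]

lemma tensor_zero_cons (l : List H) : tensor q ((0 : H) :: l) = 0 := by
  have h := creation_smul q (0 : ℂ) (0 : H)
  rw [← creation_tensor, ← zero_smul ℂ (0 : H), h, zero_smul]
  rfl

/-- The operator `a(ζ') + a*(ζ) + p(T)`. -/
def fieldOp (ζ' ζ : H) (T : H →L[ℂ] H) : Fock q H →L[ℂ] Fock q H :=
  annihilation q ζ' + creation q ζ + gauge q T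

/-- The contribution of the removal of a factor to the action of `fieldOp`. -/
def contraction (ζ' : H) (T : H →L[ℂ] H) (η : H) (m : List H) : Fock q H :=
  ⟪ζ', η⟫_ℂ • tensor q m + tensor q (T η :: m)

lemma fieldOp_tensor (ζ' ζ : H) (T : H →L[ℂ] H) (l : List H) :
    fieldOp q ζ' ζ T (tensor q l) =
      tensor q (ζ :: l) + removalSum q (contraction q ζ' T) l := by
  rw [fieldOp, add_apply, add_apply, creation_tensor, annihilation_tensor_eq, gauge_tensor_eq]
  simp only [contraction, removalSum, smul_add, Finset.sum_add_distrib]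
  abel

lemma contraction_eq_zero {ζ' : H} {T : H →L[ℂ] H} {η : H} (h1 : ⟪ζ', η⟫_ℂ = 0) (h2 : T η = 0)
    (m : List H) : contraction q ζ' T η m = 0 := by
  rw [contraction, h1, h2, tensor_zero_cons, zero_smul, add_zero]

/-- The norm of tensoring by `u` from the left is at most `tensorBound q u`. -/
def tensorBound (u : List H) : ℝ := (u.map fun ζ => √(fockConst q) * ‖ζ‖).prod

omit [InnerProductSpace ℂ H] in
lemma tensorBound_nonneg (u : List H) : 0 ≤ tensorBound q u :=
  List.prod_nonneg fun a ha => by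
    obtain ⟨ζ, -, rfl⟩ := List.mem_map.1 ha
    positivity

/-- The factor depends on `u` alone, hence stays fixed when a block of far vectors of growing length
stands to its right. -/
lemma norm_tensor_append_le (u l : List H) :
    ‖tensor q (u ++ l)‖ ≤ tensorBound q u * ‖tensor q l‖ := by
  induction u with
  | nil => simp [tensorBound]
  | cons ζ u ih =>
    rw [List.cons_append, ← creation_tensor, tensorBound, List.map_cons, List.prod_cons, mul_assoc]
    refine ((creation q ζ).le_of_opNorm_le (norm_creation_le q ζ) _).trans ?_
    exact mul_le_mul_of_nonneg_left ih (by positivity)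

lemma norm_contraction_le (ζ' : H) (T : H →L[ℂ] H) (η : H) (m : List H) :
    ‖contraction q ζ' T η m‖ ≤ (‖⟪ζ', η⟫_ℂ‖ + tensorBound q [T η]) * ‖tensor q m‖ := by
  rw [contraction, add_mul]
  refine (norm_add_le _ _).trans (add_le_add (norm_smul_le _ _) ?_)
  exact norm_tensor_append_le q [T η] m

variable (f : ℕ → H) (S : ℕ → H →L[ℂ] H)

/-- The vector `ζ` is orthogonal to `fₖ` and annihilated by `Sₖ` for all `k ≥ n`. -/
def IsFar (n : ℕ) (ζ : H) : Prop := ∀ k, n ≤ k → ⟪f k, ζ⟫_ℂ = 0 ∧ S k ζ = 0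

/-- The vectors which are far from almost all `fₙ`. -/
def localVectors : Set H := {ζ | ∃ n, IsFar f S n ζ}

/-- The list `[fₙ, …, f_{n + m - 1}]`. -/
def farList : ℕ → ℕ → List H
  | _, 0 => []
  | n, m + 1 => f n :: farList (n + 1) m

/-- The product `X(fₙ) ⋯ X(f_{n + m - 1})`. -/
def farProd : ℕ → ℕ → (Fock q H →L[ℂ] Fock q H)
  | _, 0 => 1
  | n, m + 1 => fieldOp q (f n) (f n) (S n) * farProd (n + 1) m

variable {f S}

lemma IsFar.mono {n n' : ℕ} {ζ : H} (h : IsFar f S n ζ) (hn : n ≤ n') : IsFar f S n' ζ :=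
  fun k hk => h k (hn.trans hk)

lemma eventually_isFar {l : List H} (hl : ∀ ζ ∈ l, ζ ∈ localVectors f S) :
    ∀ᶠ n in Filter.atTop, ∀ ζ ∈ l, IsFar f S n ζ := by
  induction l with
  | nil => simp
  | cons ζ l ih =>
    obtain ⟨N, hN⟩ := hl ζ List.mem_cons_self
    filter_upwards [ih fun η hη => hl η (List.mem_cons_of_mem _ hη), Filter.eventually_ge_atTop N]
      with n h1 h2
    simpa using ⟨hN.mono h2, h1⟩

omit [NormedAddCommGroup H] [InnerProductSpace ℂ H] in
lemma length_farList (n m : ℕ) : (farList f n m).length = m := by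
  induction m generalizing n with
  | zero => rfl
  | succ m ih => rw [farList, List.length_cons, ih]

omit [NormedAddCommGroup H] [InnerProductSpace ℂ H] in
lemma mem_farList {n m : ℕ} {h : H} (hh : h ∈ farList f n m) : ∃ k, n ≤ k ∧ h = f k := by
  induction m generalizing n with
  | zero => simp [farList] at hh
  | succ m ih =>
    rcases List.mem_cons.1 hh with rfl | hh
    · exact ⟨n, le_rfl, rfl⟩
    · obtain ⟨k, hk, rfl⟩ := ih hh
      exact ⟨k, by omega, rfl⟩

lemma annihilation_tensor_eq_zero {ζ : H} {l : List H} (h : ∀ η ∈ l, ⟪ζ, η⟫_ℂ = 0) :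
    annihilation q ζ (tensor q l) = 0 := by
  rw [annihilation_tensor_eq]
  exact removalSum_eq_zero q fun η hη m => by rw [h η hη, zero_smul]

/-- Commuting `a(ζ)` past `a*(ζ)` leaves a term with `a(ζ)` on the right-hand tensor, so
orthogonality is needed on that side only. -/
lemma inner_tensor_cons_cons {ζ : H} (hζ : ‖ζ‖ = 1) (l : List H) {l' : List H}
    (h : ∀ η ∈ l', ⟪ζ, η⟫_ℂ = 0) :
    ⟪tensor q (ζ :: l), tensor q (ζ :: l')⟫_ℂ = ⟪tensor q l, tensor q l'⟫_ℂ := by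
  rw [inner_tensor_cons, ← creation_tensor, annihilation_creation,
    annihilation_tensor_eq_zero q h, map_zero, smul_zero, add_zero, inner_self_eq_norm_sq_to_K, hζ]
  simp

lemma inner_tensor_farList (hf : Orthonormal ℂ f) {n m : ℕ} (l : List H) {l' : List H}
    (h : ∀ η ∈ l', IsFar f S n η) :
    ⟪tensor q (farList f n m ++ l), tensor q (farList f n m ++ l')⟫_ℂ =
      ⟪tensor q l, tensor q l'⟫_ℂ := by
  induction m generalizing n with
  | zero => rfl
  | succ m ih =>
    rw [farList, List.cons_append, List.cons_append, inner_tensor_cons_cons q (hf.1 n),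
      ih fun η hη => (h η hη).mono (Nat.le_succ n)]
    intro η hη
    rcases List.mem_append.1 hη with hη | hη
    · obtain ⟨k, hk, rfl⟩ := mem_farList hη
      exact hf.2 (by omega)
    · exact (h η hη n le_rfl).1

lemma norm_tensor_farList (hf : Orthonormal ℂ f) {n m : ℕ} {l : List H}
    (h : ∀ η ∈ l, IsFar f S n η) : ‖tensor q (farList f n m ++ l)‖ = ‖tensor q l‖ := by
  have h1 := inner_tensor_farList q (m := m) hf l h
  rw [inner_self_eq_norm_sq_to_K, inner_self_eq_norm_sq_to_K] at h1
  exact (pow_left_inj₀ (norm_nonneg _) (norm_nonneg _) two_ne_zero).1 (by exact_mod_cast h1)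

lemma fieldOp_tensor_far {ζ' ζ : H} {T : H →L[ℂ] H} {l : List H}
    (h : ∀ η ∈ l, ⟪ζ', η⟫_ℂ = 0 ∧ T η = 0) :
    fieldOp q ζ' ζ T (tensor q l) = tensor q (ζ :: l) := by
  rw [fieldOp_tensor, removalSum_eq_zero q fun η hη m =>
    contraction_eq_zero q (h η hη).1 (h η hη).2 m, add_zero]

/-- When `X(fₖ)` acts, all factors already present are orthogonal to `fₖ` and killed by `Sₖ`, so
only creation survives. -/
lemma farProd_tensor (hf : Orthonormal ℂ f) (hS : ∀ j k, j ≠ k → S j (f k) = 0) {n m : ℕ}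
    {l : List H} (h : ∀ η ∈ l, IsFar f S n η) :
    farProd q f S n m (tensor q l) = tensor q (farList f n m ++ l) := by
  induction m generalizing n with
  | zero => rfl
  | succ m ih =>
    rw [farProd, mul_apply_eq_comp, ih fun η hη => (h η hη).mono (Nat.le_succ n),
      fieldOp_tensor_far, farList, List.cons_append]
    intro η hη
    rcases List.mem_append.1 hη with hη | hη
    · obtain ⟨k, hk, rfl⟩ := mem_farList hη
      exact ⟨hf.2 (by omega), hS _ _ (by omega)⟩
    · exact h η hη n le_rfl

lemma star_fieldOp {ζ : H} {T : H →L[ℂ] H} (hT : ∀ x y, ⟪T x, y⟫_ℂ = ⟪x, T y⟫_ℂ) :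
    star (fieldOp q ζ ζ T) = fieldOp q ζ ζ T := by
  rw [ContinuousLinearMap.star_eq_adjoint, fieldOp, map_add, map_add, adjoint_annihilation,
    adjoint_creation, adjoint_gauge q T T hT, add_comm (creation q ζ)]

/-- The adjoint product applies `X(fₙ)` first and `X(f_{n+m-1})` last. Each new factor `fₙ` is
itself far from index `n + 1` on, so the induction runs over growing lists. -/
lemma inner_star_farProd_tensor (hf : Orthonormal ℂ f) (hS : ∀ j k, j ≠ k → S j (f k) = 0)
    (hS' : ∀ k x y, ⟪S k x, y⟫_ℂ = ⟪x, S k y⟫_ℂ) {n m : ℕ} {l l' : List H}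
    (h : ∀ η ∈ l, IsFar f S n η) (h' : ∀ η ∈ l', IsFar f S n η) :
    ⟪star (farProd q f S n m) (tensor q l), star (farProd q f S n m) (tensor q l')⟫_ℂ =
      ⟪tensor q l, tensor q l'⟫_ℂ := by
  induction m generalizing n l l' with
  | zero => simp [farProd]
  | succ m ih =>
    have hc : ∀ l : List H, (∀ η ∈ l, IsFar f S n η) → ∀ η ∈ f n :: l, IsFar f S (n + 1) η := by
      intro l h η hη
      rcases List.mem_cons.1 hη with rfl | hη
      · exact fun k hk => ⟨hf.2 (by omega), hS _ _ (by omega)⟩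
      · exact (h η hη).mono (Nat.le_succ n)
    rw [farProd, star_mul, star_fieldOp q (hS' n), mul_apply_eq_comp,
      mul_apply_eq_comp, fieldOp_tensor_far q fun η hη => h η hη n le_rfl,
      fieldOp_tensor_far q fun η hη => h' η hη n le_rfl, ih (hc l h) (hc l' h'),
      inner_tensor_cons_cons q (hf.1 n) _ fun η hη => (h' η hη n le_rfl).1]

lemma norm_farProd_le {R : ℝ} (hR : ∀ k, ‖fieldOp q (f k) (f k) (S k)‖ ≤ R) (n m : ℕ) :
    ‖farProd q f S n m‖ ≤ R ^ m := by
  induction m generalizing n with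
  | zero =>
    rw [pow_zero]
    exact ContinuousLinearMap.norm_id_le
  | succ m ih =>
    rw [farProd, pow_succ']
    exact (norm_mul_le _ _).trans
      (mul_le_mul (hR n) (ih _) (norm_nonneg _) ((norm_nonneg _).trans (hR n)))

/-! ### Vectors which decay like `q ^ m` -/

/-- The vectors `v m n` are `O(|q|ᵐ)`, for fixed `m` and almost all `n`. -/
def Decays {E : Type*} [NormedAddCommGroup E] (v : ℕ → ℕ → E) : Prop :=
  ∃ C, ∀ m, ∀ᶠ n in Filter.atTop, ‖v m n‖ ≤ C * |(q : ℝ)| ^ m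

section Decays

variable {q} {E E' : Type*} [NormedAddCommGroup E] [NormedSpace ℂ E] [NormedAddCommGroup E']
  [NormedSpace ℂ E']

omit [NormedSpace ℂ E] in
lemma Decays.congr {v w : ℕ → ℕ → E} (h : Decays q v)
    (hvw : ∀ m, ∀ᶠ n in Filter.atTop, v m n = w m n) : Decays q w := by
  obtain ⟨C, hC⟩ := h
  refine ⟨C, fun m => ?_⟩
  filter_upwards [hC m, hvw m] with n h1 h2
  rwa [← h2]

omit [NormedSpace ℂ E] in
lemma Decays.add {v w : ℕ → ℕ → E} (hv : Decays q v) (hw : Decays q w) :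
    Decays q fun m n => v m n + w m n := by
  obtain ⟨C, hC⟩ := hv
  obtain ⟨D, hD⟩ := hw
  refine ⟨C + D, fun m => ?_⟩
  filter_upwards [hC m, hD m] with n h1 h2
  rw [add_mul]
  exact (norm_add_le _ _).trans (add_le_add h1 h2)

omit [NormedSpace ℂ E] in
lemma decays_zero : Decays q fun _ _ => (0 : E) := ⟨0, by simp⟩

lemma Decays.map {v : ℕ → ℕ → E} (hv : Decays q v) (A : E →L[ℂ] E') :
    Decays q fun m n => A (v m n) := by
  obtain ⟨C, hC⟩ := hv
  refine ⟨‖A‖ * C, fun m => ?_⟩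
  filter_upwards [hC m] with n h
  rw [mul_assoc]
  exact (A.le_opNorm _).trans (mul_le_mul_of_nonneg_left h (norm_nonneg _))

lemma Decays.smul {v : ℕ → ℕ → E} (hv : Decays q v) (c : ℂ) : Decays q fun m n => c • v m n :=
  hv.map (c • ContinuousLinearMap.id ℂ E)

omit [NormedSpace ℂ E] in
lemma Decays.sum {ι : Type*} {s : Finset ι} {v : ι → ℕ → ℕ → E} (h : ∀ i ∈ s, Decays q (v i)) :
    Decays q fun m n => ∑ i ∈ s, v i m n := by
  classical
  induction s using Finset.induction_on with
  | empty => simpa using decays_zero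
  | insert i s hi ih =>
    simp only [Finset.sum_insert hi]
    exact (h i (Finset.mem_insert_self i s)).add
      (ih fun j hj => h j (Finset.mem_insert_of_mem hj))

end Decays

/-- Up to a small error, `fieldOp` acts on `u ⊗ fₙ ⊗ ⋯ ⊗ f_{n + m - 1} ⊗ ξ` by its action on `u`. -/
lemma decays_fieldOp_tensor (hf : Orthonormal ℂ f) {ξ : List H}
    (hξ : ∀ ζ ∈ ξ, ζ ∈ localVectors f S) (u : List H) {ζ' : H} (ζ : H) {T : H →L[ℂ] H}
    (hT : ∀ᶠ k in Filter.atTop, ⟪ζ', f k⟫_ℂ = 0 ∧ T (f k) = 0) :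
    Decays q fun m n => fieldOp q ζ' ζ T (tensor q (u ++ (farList f n m ++ ξ))) -
      (tensor q (ζ :: u ++ (farList f n m ++ ξ)) +
        removalSum q (fun η w => contraction q ζ' T η (w ++ (farList f n m ++ ξ))) u) := by
  -- The constant collects the contractions with the factors of `ξ`. It is free of `m` and `n`
  -- because a far block does not change norms.
  refine ⟨∑ k : Fin ξ.length, (‖⟪ζ', ξ.get k⟫_ℂ‖ + tensorBound q [T (ξ.get k)]) *
    (tensorBound q u * ‖tensor q (ξ.eraseIdx k)‖), fun m => ?_⟩
  filter_upwards [eventually_isFar hξ, Filter.eventually_forall_ge_atTop.2 hT] with n h1 h2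
  -- Removals from `u` are the main term, removals from the far block vanish, and removals from `ξ`
  -- carry the weight `q^{|u| + m}`.
  rw [fieldOp_tensor, removalSum_append, removalSum_append, length_farList,
    removalSum_eq_zero (l := farList f n m), zero_add, List.cons_append, ← add_assoc,
    add_sub_cancel_left]
  · rw [norm_smul, norm_smul, norm_pow, norm_pow, Complex.norm_real, Real.norm_eq_abs,
      ← mul_assoc, mul_comm]
    refine mul_le_mul (norm_removalSum_le q (ψ := fun η w =>
      (‖⟪ζ', η⟫_ℂ‖ + tensorBound q [T η]) * (tensorBound q u * ‖tensor q w‖)) fun η _ w hw => ?_)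
      (mul_le_of_le_one_left (by positivity) (pow_le_one₀ (abs_nonneg _) (abs_lt.2 q.2).le))
      (by positivity) (Finset.sum_nonneg fun k _ => ?_)
    · refine (norm_contraction_le q _ _ _ _).trans (mul_le_mul_of_nonneg_left ?_ ?_)
      · rw [← norm_tensor_farList q (m := m) hf fun η hη => h1 η (hw.subset hη)]
        exact norm_tensor_append_le q _ _
      · exact add_nonneg (norm_nonneg _) (tensorBound_nonneg q _)
    · exact mul_nonneg (add_nonneg (norm_nonneg _) (tensorBound_nonneg q _))
        (mul_nonneg (tensorBound_nonneg q _) (norm_nonneg _))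
  · intro η hη w
    obtain ⟨k, hk, rfl⟩ := mem_farList hη
    exact contraction_eq_zero q (h2 k hk).1 (h2 k hk).2 _

/-- Moved to the other side, `v` becomes an annihilation operator. It cannot contract with the far
block, and reaching `ξ'` across that block costs `q^m`. -/
lemma decays_inner_tensor (hf : Orthonormal ℂ f) {ξ ξ' : List H}
    (hξ : ∀ ζ ∈ ξ, ζ ∈ localVectors f S) (hξ' : ∀ ζ ∈ ξ', ζ ∈ localVectors f S) {v : H}
    (hv : v ∈ localVectors f S) (u : List H) :
    Decays q fun m n => ⟪tensor q (farList f n m ++ ξ'),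
      tensor q (v :: u ++ (farList f n m ++ ξ))⟫_ℂ := by
  refine ⟨(∑ k : Fin ξ'.length, ‖⟪v, ξ'.get k⟫_ℂ‖ * ‖tensor q (ξ'.eraseIdx k)‖) *
    (tensorBound q u * ‖tensor q ξ‖), fun m => ?_⟩
  obtain ⟨N, hN⟩ := hv
  filter_upwards [eventually_isFar hξ, eventually_isFar hξ', Filter.eventually_ge_atTop N]
    with n h1 h2 h3
  rw [List.cons_append, ← creation_tensor, ← inner_annihilation, annihilation_tensor_eq,
    removalSum_append, length_farList, removalSum_eq_zero, zero_add, inner_smul_left, norm_mul]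
  · rw [RCLike.norm_conj, norm_pow, Complex.norm_real, Real.norm_eq_abs, mul_comm]
    refine mul_le_mul_of_nonneg_right ?_ (by positivity)
    refine (norm_inner_le_norm _ _).trans (mul_le_mul ?_ ?_ (norm_nonneg _) ?_)
    · refine norm_removalSum_le q (ψ := fun η w => ‖⟪v, η⟫_ℂ‖ * ‖tensor q w‖) fun η _ w hw => ?_
      rw [norm_smul, norm_tensor_farList q hf fun η hη => h2 η (hw.subset hη)]
    · rw [← norm_tensor_farList q (m := m) hf h1]
      exact norm_tensor_append_le q _ _
    · positivity
  · intro η hη w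
    obtain ⟨k, hk, rfl⟩ := mem_farList hη
    rw [← inner_conj_symm, (hN k (h3.trans hk)).1, map_zero, zero_smul]

end Far

/-! ### Ultraweak density of polynomials, and compression of normal traces. -/

section DoubleCommutant

variable {F : Type*} [NormedAddCommGroup F] [InnerProductSpace ℂ F]

section Amplification

variable (ι : Type*)

/-- The operator `A ⊗ 1` on the `ℓ²`-sum of copies of `F`. -/
def ampl (A : F →L[ℂ] F) : lp (fun _ : ι => F) 2 →L[ℂ] lp (fun _ : ι => F) 2 :=
  lp.mapCLM 2 (fun _ => A) (norm_nonneg A) fun _ => le_rfl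

variable {ι}

@[simp] lemma ampl_apply (A : F →L[ℂ] F) (x : lp (fun _ : ι => F) 2) (i : ι) :
    ampl ι A x i = A (x i) := rfl

lemma ampl_single [DecidableEq ι] (A : F →L[ℂ] F) (i : ι) (v : F) :
    ampl ι A (lp.single 2 i v) = lp.single 2 i (A v) := by
  ext j
  rw [ampl_apply, lp.single_apply, lp.single_apply]
  by_cases h : j = i
  · subst h; simp
  · simp [h]

/-- The map `A ↦ (A ⊗ 1) y`. -/
def amplOrbit (y : lp (fun _ : ι => F) 2) : (F →L[ℂ] F) →ₗ[ℂ] lp (fun _ : ι => F) 2 where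
  toFun A := ampl ι A y
  map_add' A B := by ext i; simp
  map_smul' c A := by ext i; simp

variable [CompleteSpace F]

lemma inner_ampl (A : F →L[ℂ] F) (x y : lp (fun _ : ι => F) 2) :
    ⟪x, ampl ι A y⟫_ℂ = ⟪ampl ι (star A) x, y⟫_ℂ := by
  rw [lp.inner_eq_tsum, lp.inner_eq_tsum]
  refine tsum_congr fun i => ?_
  rw [ampl_apply, ampl_apply, ContinuousLinearMap.star_eq_adjoint,
    ContinuousLinearMap.adjoint_inner_left]

/-- Von Neumann's density theorem, for the amplified algebra. -/
lemma ampl_mem_closure {S : Set (F →L[ℂ] F)} (hS : ∀ A ∈ S, star A ∈ S) {T : F →L[ℂ] F}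
    (hT : T ∈ generated S) (y : lp (fun _ : ι => F) 2) :
    ampl ι T y ∈ closure ((fun A => ampl ι A y) '' (Algebra.adjoin ℂ S : Set (F →L[ℂ] F))) := by
  classical
  -- The closed orbit of `y` is invariant under the self-adjoint set `S ⊗ 1`, so its projection
  -- commutes with `S ⊗ 1`.
  let K₀ := (Subalgebra.toSubmodule (Algebra.adjoin ℂ S)).map (amplOrbit y)
  let K := K₀.topologicalClosure
  have : CompleteSpace K := K₀.isClosed_topologicalClosure.completeSpace_coe
  have hK : ∀ A ∈ S, ∀ x ∈ K, ampl ι A x ∈ K := by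
    intro A hA
    have h1 : K₀ ≤ K.comap (ampl ι A).toLinearMap := by
      rintro _ ⟨B, hB, rfl⟩
      exact K₀.le_topologicalClosure
        ⟨A * B, (Algebra.adjoin ℂ S).mul_mem (Algebra.subset_adjoin hA) hB, by ext i; rfl⟩
    exact Submodule.topologicalClosure_minimal _ h1
      (K₀.isClosed_topologicalClosure.preimage (ampl ι A).continuous)
  have hP : ∀ A ∈ S, ∀ x, K.starProjection (ampl ι A x) = ampl ι A (K.starProjection x) := by
    intro A hA x
    refine Submodule.eq_starProjection_of_mem_of_inner_eq_zero
      (hK A hA _ (Submodule.starProjection_apply_mem K x)) fun w hw => ?_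
    rw [← map_sub, ← inner_conj_symm, inner_ampl, inner_conj_symm]
    exact Submodule.starProjection_inner_eq_zero x _ (hK _ (hS A hA) w hw)
  -- The matrix entries of the projection commute with `S` and `S*`, hence with `T`. Summing the
  -- entries back shows that `T ⊗ 1` maps `y` into the orbit closure.
  let p (i j : ι) : F →L[ℂ] F :=
    (lp.evalCLM ℂ (fun _ : ι => F) 2 i).comp
      (K.starProjection.comp (lp.singleContinuousLinearMap ℂ (fun _ : ι => F) 2 j))
  have hp : ∀ i j v, p i j v = K.starProjection (lp.single 2 j v) i := fun _ _ _ => rfl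
  have hT' : ∀ i j, T * p i j = p i j * T := by
    intro i j
    have h1 : p i j ∈ StarSubalgebra.centralizer ℂ S := by
      rw [StarSubalgebra.mem_centralizer_iff]
      have h2 : ∀ A ∈ S, A * p i j = p i j * A := fun A hA => by
        ext v
        change A (p i j v) = p i j (A v)
        rw [hp, hp, ← ampl_single, hP A hA, ampl_apply]
      exact fun A hA => ⟨h2 A hA, h2 _ (hS A hA)⟩
    have h3 : T ∈ StarSubalgebra.centralizer ℂ
      (StarSubalgebra.centralizer ℂ S : Set (F →L[ℂ] F)) := hT
    rw [StarSubalgebra.mem_centralizer_iff] at h3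
    exact (h3 _ h1).1.symm
  have hy : y ∈ K := K₀.le_topologicalClosure ⟨1, (Algebra.adjoin ℂ S).one_mem, by ext i; rfl⟩
  have hsum : ∀ (x : lp (fun _ : ι => F) 2) (i : ι),
      HasSum (fun j => p i j (x j)) (K.starProjection x i) := fun x i =>
    ((lp.hasSum_single (p := 2) (by simp) x).mapL K.starProjection).mapL
      (lp.evalCLM ℂ (fun _ : ι => F) 2 i)
  have h4 : ampl ι T y = K.starProjection (ampl ι T y) := by
    ext i
    refine HasSum.unique ?_ (hsum (ampl ι T y) i)
    have h5 := (hsum y i).mapL T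
    rw [Submodule.starProjection_eq_self_iff.2 hy] at h5
    have h6 : (fun j => p i j (ampl ι T y j)) = fun j => T (p i j (y j)) :=
      funext fun j => (DFunLike.congr_fun (hT' i j) (y j)).symm
    rw [h6]
    exact h5
  rw [h4]
  exact Submodule.starProjection_apply_mem K _

end Amplification

variable [CompleteSpace F]

omit [InnerProductSpace ℂ F] [CompleteSpace F] in
lemma summable_norm_inner {x y : ℕ → F} (hx : Summable fun n => ‖x n‖ ^ 2)
    (hy : Summable fun n => ‖y n‖ ^ 2) : Summable fun n => ‖x n‖ * ‖y n‖ := by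
  refine Summable.of_nonneg_of_le (fun n => by positivity) (fun n => ?_) (hx.add hy)
  nlinarith [sq_nonneg (‖x n‖ - ‖y n‖), sq_nonneg (‖x n‖), sq_nonneg (‖y n‖)]

lemma tendsto_ultraweak_iff (M : VonNeumannAlgebra F) {κ : Type*} {l : Filter κ}
    {A : κ → M.toStarSubalgebra} {B : M.toStarSubalgebra} :
    Filter.Tendsto A l (@nhds _ (ultraweakTopology M) B) ↔
      ∀ x y : ℕ → F, (Summable fun n => ‖x n‖ ^ 2) → (Summable fun n => ‖y n‖ ^ 2) →
        Filter.Tendsto (fun k => ∑' n, ⟪x n, (A k : F →L[ℂ] F) (y n)⟫_ℂ) l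
          (nhds (∑' n, ⟪x n, (B : F →L[ℂ] F) (y n)⟫_ℂ)) := by
  simp only [nhds_iInf, Filter.tendsto_iInf, nhds_induced,
    Filter.tendsto_comap_iff]
  rfl

/-- A bounded weakly convergent family of operators is ultraweakly convergent. -/
lemma tendsto_ultraweak_of_bounded (M : VonNeumannAlgebra F) {κ : Type*} {l : Filter κ}
    {A : κ → M.toStarSubalgebra} {B : M.toStarSubalgebra} {R : ℝ}
    (hR : ∀ᶠ k in l, ‖(A k : F →L[ℂ] F)‖ ≤ R)
    (h : ∀ x y : F, Filter.Tendsto (fun k => ⟪x, (A k : F →L[ℂ] F) y⟫_ℂ) l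
      (nhds ⟪x, (B : F →L[ℂ] F) y⟫_ℂ)) :
    Filter.Tendsto A l (@nhds _ (ultraweakTopology M) B) := by
  rw [tendsto_ultraweak_iff]
  intro x y hx hy
  refine tendsto_tsum_of_dominated_convergence ((summable_norm_inner hx hy).mul_left R)
    (fun n => h _ _) ?_
  filter_upwards [hR] with k hk n
  calc _ ≤ ‖x n‖ * ‖(A k : F →L[ℂ] F) (y n)‖ := norm_inner_le_norm _ _
    _ ≤ ‖x n‖ * (R * ‖y n‖) := by gcongr; exact ContinuousLinearMap.le_of_opNorm_le _ hk _
    _ = _ := by ring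

/-- Commutation with an element of the commutant passes to weak limits, and `M` is its own double
commutant. -/
lemma mem_of_tendsto (M : VonNeumannAlgebra F) {κ : Type*} {l : Filter κ} [l.NeBot]
    {A : κ → F →L[ℂ] F} (hA : ∀ k, A k ∈ M) {B : F →L[ℂ] F}
    (h : ∀ x y : F, Filter.Tendsto (fun k => ⟪x, A k y⟫_ℂ) l (nhds ⟪x, B y⟫_ℂ)) : B ∈ M := by
  rw [← VonNeumannAlgebra.commutant_commutant M, VonNeumannAlgebra.mem_commutant_iff]
  intro N hN
  ext y
  refine ext_inner_left ℂ fun x => ?_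
  change ⟪x, N (B y)⟫_ℂ = ⟪x, B (N y)⟫_ℂ
  rw [← ContinuousLinearMap.adjoint_inner_left]
  refine tendsto_nhds_unique (h _ _) ((h x (N y)).congr fun k => ?_)
  rw [ContinuousLinearMap.adjoint_inner_left]
  have := VonNeumannAlgebra.mem_commutant_iff.1 hN (A k) (hA k)
  exact congrArg (fun C : F →L[ℂ] F => ⟪x, C y⟫_ℂ) this

/-- A bounded sequence of operators has a weak limit along every ultrafilter. -/
lemma exists_weak_limit (𝒰 : Ultrafilter ℕ) {A : ℕ → F →L[ℂ] F} {R : ℝ} (hR : ∀ n, ‖A n‖ ≤ R) :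
    ∃ B : F →L[ℂ] F, ∀ x y : F,
      Filter.Tendsto (fun n => ⟪x, A n y⟫_ℂ) 𝒰 (nhds ⟪x, B y⟫_ℂ) := by
  have hb : ∀ (x y : F) n, ‖⟪x, A n y⟫_ℂ‖ ≤ R * ‖x‖ * ‖y‖ := fun x y n => by
    calc _ ≤ ‖x‖ * ‖A n y‖ := norm_inner_le_norm _ _
      _ ≤ ‖x‖ * (R * ‖y‖) := by gcongr; exact ContinuousLinearMap.le_of_opNorm_le _ (hR n) _
      _ = _ := by ring
  have h1 : ∀ x y : F, ∃ c, Filter.Tendsto (fun n => ⟪x, A n y⟫_ℂ) 𝒰 (nhds c) := fun x y => by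
    obtain ⟨c, -, hc⟩ := (isCompact_closedBall (0 : ℂ) (R * ‖x‖ * ‖y‖)).ultrafilter_le_nhds
      (𝒰.map fun n => ⟪x, A n y⟫_ℂ) (by
        rw [Filter.le_principal_iff]
        exact Filter.eventually_map.2 (Filter.Eventually.of_forall fun n => by
          simpa using hb x y n))
    exact ⟨c, hc⟩
  choose c hc using h1
  -- The limits of the matrix elements form a bounded sesquilinear form, which an operator
  -- represents.
  let L : F →ₗ⋆[ℂ] F →ₗ[ℂ] ℂ := LinearMap.mk₂'ₛₗ (starRingEnd ℂ) (RingHom.id ℂ) c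
    (fun x x' y => tendsto_nhds_unique (hc _ _)
      (((hc x y).add (hc x' y)).congr fun n => (inner_add_left _ _ _).symm))
    (fun a x y => tendsto_nhds_unique (hc _ _)
      (((hc x y).const_mul _).congr fun n => (inner_smul_left _ _ _).symm))
    (fun x y y' => tendsto_nhds_unique (hc _ _)
      (((hc x y).add (hc x y')).congr fun n => by rw [map_add, inner_add_right]))
    (fun a x y => tendsto_nhds_unique (hc _ _)
      (((hc x y).const_mul _).congr fun n => by rw [map_smul, inner_smul_right]; rfl))
  let L' : F →L⋆[ℂ] F →L[ℂ] ℂ := LinearMap.mkContinuous₂ L R fun x y =>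
    le_of_tendsto (hc x y).norm (Filter.Eventually.of_forall (hb x y))
  -- The representing operator stands on the left of the inner product; the adjoint moves it to the
  -- right.
  refine ⟨ContinuousLinearMap.adjoint (InnerProductSpace.continuousLinearMapOfBilin L'),
    fun x y => ?_⟩
  rw [ContinuousLinearMap.adjoint_inner_right,
    InnerProductSpace.continuousLinearMapOfBilin_apply]
  exact hc x y

lemma adjoin_subset_generated {S : Set (F →L[ℂ] F)} (hS : ∀ A ∈ S, star A ∈ S) :
    (Algebra.adjoin ℂ S : Set (F →L[ℂ] F)) ⊆ (generated S).toStarSubalgebra := by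
  have h1 : S ⊆ ((generated S).toStarSubalgebra.toSubalgebra : Set (F →L[ℂ] F)) := fun A hA => by
    change A ∈ StarSubalgebra.centralizer ℂ (StarSubalgebra.centralizer ℂ S : Set (F →L[ℂ] F))
    rw [StarSubalgebra.mem_centralizer_iff]
    intro B hB
    have h2 := (StarSubalgebra.mem_centralizer_iff ℂ).1 hB
    refine ⟨(h2 A hA).1.symm, ?_⟩
    have h3 := congrArg star (h2 _ (hS A hA)).1
    rw [star_mul, star_mul, star_star] at h3
    exact h3
  exact Algebra.adjoin_le (S := (generated S).toStarSubalgebra.toSubalgebra) h1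

/-- Ultraweakly continuous functions which agree on a self-adjoint set of generators and all
polynomials in them agree on the generated von Neumann algebra. -/
lemma eq_of_eqOn_adjoin {S : Set (F →L[ℂ] F)} (hS : ∀ A ∈ S, star A ∈ S)
    {φ ψ : (generated S).toStarSubalgebra → ℂ}
    (hφ : @Continuous _ _ (ultraweakTopology (generated S)) _ φ)
    (hψ : @Continuous _ _ (ultraweakTopology (generated S)) _ ψ)
    (h : ∀ A : (generated S).toStarSubalgebra, (A : F →L[ℂ] F) ∈ Algebra.adjoin ℂ S → φ A = ψ A) :
    φ = ψ := by
  classical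
  let _ := ultraweakTopology (generated S)
  let D : Set (generated S).toStarSubalgebra :=
    {A | (A : F →L[ℂ] F) ∈ Algebra.adjoin ℂ S}
  have hD : Dense D := by
    intro T
    rw [mem_closure_iff_nhds]
    intro U hU
    let I := {p : (ℕ → F) × (ℕ → F) //
      (Summable fun n => ‖p.1 n‖ ^ 2) ∧ Summable fun n => ‖p.2 n‖ ^ 2}
    let ω (p : I) (A : F →L[ℂ] F) : ℂ := ∑' n, ⟪p.1.1 n, A (p.1.2 n)⟫_ℂ
    have hn : nhds T = ⨅ p : I, Filter.comap (fun A : (generated S).toStarSubalgebra => ω p A)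
        (nhds (ω p T)) := by
      simp only [nhds_iInf, nhds_induced, I, ω, iInf_subtype, iInf_prod, iInf_and]
    rw [hn, Filter.mem_iInf] at hU
    obtain ⟨s, hs, V, hV, rfl⟩ := hU
    have : Finite s := hs
    choose W hW hWV using fun p : s => Filter.mem_comap.1 (hV p)
    have hinj : ∀ p : s, Function.Injective fun n : ℕ => (p, n) := fun p m n h => (Prod.ext_iff.1 h).2
    -- A basic ultraweak neighbourhood involves finitely many functionals. Their right-hand
    -- sequences are assembled into one vector `y`, and `x p` is supported on the block of `p`, so
    -- each functional reads `⟨x p, (A ⊗ 1) y⟩` and norm approximation of `(T ⊗ 1) y` suffices.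
    let y : lp (fun _ : s × ℕ => F) 2 := ⟨fun k => k.1.1.1.2 k.2, memℓp_gen (by
      simp only [ENNReal.toReal_ofNat, Real.rpow_ofNat]
      exact (summable_prod_of_nonneg fun _ => by positivity).2
        ⟨fun p => p.1.2.2, Summable.of_finite⟩)⟩
    let x (p : s) : lp (fun _ : s × ℕ => F) 2 :=
      ⟨fun k => if k.1 = p then p.1.1.1 k.2 else 0, memℓp_gen (by
        simp only [ENNReal.toReal_ofNat, Real.rpow_ofNat]
        refine ((hinj p).summable_iff fun k hk => ?_).1 ?_
        · have : k.1 ≠ p := fun h => hk ⟨k.2, by rw [← h]⟩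
          simp [this]
        · simpa [Function.comp_def] using p.1.2.1)⟩
    have hx : ∀ (p : s) (A : F →L[ℂ] F), ⟪x p, ampl (s × ℕ) A y⟫_ℂ = ω p A := fun p A => by
      rw [lp.inner_eq_tsum]
      refine ((hinj p).tsum_eq fun k hk => ?_).symm.trans (tsum_congr fun n => ?_)
      · by_contra hne
        have : k.1 ≠ p := fun h => hne ⟨k.2, by rw [← h]⟩
        simp [x, this] at hk
      · simp [x, y]
    have ho : ∀ᶠ z in nhds (ampl (s × ℕ) (T : F →L[ℂ] F) y), ∀ p : s, ⟪x p, z⟫_ℂ ∈ W p := by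
      refine Filter.eventually_all.2 fun p => ?_
      have hc : Continuous fun z => ⟪x p, z⟫_ℂ := by fun_prop
      exact hc.continuousAt.eventually_mem (by rw [hx]; exact hW p)
    obtain ⟨_, hz, A, hA, rfl⟩ := mem_closure_iff_nhds.1 (ampl_mem_closure hS T.2 y) _ ho
    refine ⟨⟨A, adjoin_subset_generated hS hA⟩, Set.mem_iInter.2 fun p => hWV p ?_, hA⟩
    have := hz p
    rwa [hx] at this
  exact hφ.ext_on hD hψ fun A hA => h A hA

omit [CompleteSpace F] in
lemma tendsto_zero_of_dense_span {κ : Type*} {l : Filter κ} {φ : κ → F →L[ℂ] ℂ} {C : ℝ}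
    (hC : ∀ k, ‖φ k‖ ≤ C) {s : Set F} (hs : Dense (Submodule.span ℂ s : Set F))
    (h : ∀ y ∈ s, Filter.Tendsto (fun k => φ k y) l (nhds 0)) (y : F) :
    Filter.Tendsto (fun k => φ k y) l (nhds 0) := by
  have h1 : ∀ y ∈ Submodule.span ℂ s, Filter.Tendsto (fun k => φ k y) l (nhds 0) := by
    intro y hy
    induction hy using Submodule.span_induction with
    | mem y hy => exact h y hy
    | zero => simpa using tendsto_const_nhds
    | add x y _ _ hx hy => simpa using hx.add hy
    | smul c x _ hx => simpa using hx.const_mul c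
  rw [Metric.tendsto_nhds]
  intro ε hε
  have hC' : 0 < |C| + 1 := by positivity
  obtain ⟨z, hz, hyz⟩ := Metric.mem_closure_iff.1 (hs y) (ε / 2 / (|C| + 1)) (by positivity)
  filter_upwards [Metric.tendsto_nhds.1 (h1 z hz) (ε / 2) (by positivity)] with k hk
  rw [dist_zero_right] at hk ⊢
  have h2 : ‖φ k (y - z)‖ < ε / 2 := by
    calc _ ≤ (|C| + 1) * ‖y - z‖ := (φ k).le_of_opNorm_le
          (((hC k).trans (le_abs_self C)).trans (by linarith)) _
      _ < (|C| + 1) * (ε / 2 / (|C| + 1)) := by rw [← dist_eq_norm]; gcongr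
      _ = ε / 2 := by field_simp
  calc ‖φ k y‖ = ‖φ k (y - z) + φ k z‖ := by rw [← map_add, sub_add_cancel]
    _ ≤ ‖φ k (y - z)‖ + ‖φ k z‖ := norm_add_le _ _
    _ < ε := by linarith

omit [CompleteSpace F] in
/-- Weak convergence of a bounded family of operators can be tested on a total set. -/
lemma tendsto_inner_of_dense_span {κ : Type*} {l : Filter κ} {A : κ → F →L[ℂ] F} {B : F →L[ℂ] F}
    {R : ℝ} (hR : ∀ k, ‖A k‖ ≤ R) {s : Set F} (hs : Dense (Submodule.span ℂ s : Set F))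
    (h : ∀ x ∈ s, ∀ y ∈ s, Filter.Tendsto (fun k => ⟪x, A k y⟫_ℂ) l (nhds ⟪x, B y⟫_ℂ)) (x y : F) :
    Filter.Tendsto (fun k => ⟪x, A k y⟫_ℂ) l (nhds ⟪x, B y⟫_ℂ) := by
  have hAB : ∀ k, ‖A k - B‖ ≤ R + ‖B‖ := fun k => (norm_sub_le _ _).trans (by gcongr; exact hR k)
  have h1 : ∀ x ∈ s, ∀ y, Filter.Tendsto (fun k => ⟪x, (A k - B) y⟫_ℂ) l (nhds 0) := by
    intro x hx
    refine tendsto_zero_of_dense_span (φ := fun k => (innerSL ℂ x).comp (A k - B))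
      (C := ‖x‖ * (R + ‖B‖)) (fun k => ?_) hs fun y hy => ?_
    · refine (ContinuousLinearMap.opNorm_comp_le _ _).trans ?_
      rw [innerSL_apply_norm]
      gcongr
      exact hAB k
    · have := (h x hx y hy).sub_const ⟪x, B y⟫_ℂ
      simpa [inner_sub_right] using this
  have h2 : Filter.Tendsto (fun k => ⟪(A k - B) y, x⟫_ℂ) l (nhds 0) := by
    refine tendsto_zero_of_dense_span (φ := fun k => innerSL ℂ ((A k - B) y))
      (C := (R + ‖B‖) * ‖y‖) (fun k => ?_) hs (fun x hx => ?_) x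
    · rw [innerSL_apply_norm]
      exact (A k - B).le_of_opNorm_le (hAB k) y
    · have := (h1 x hx y).star
      simpa using this
  have h3 := h2.star.add_const ⟪x, B y⟫_ℂ
  simpa [inner_sub_right] using h3

omit [CompleteSpace F] in
lemma opNorm_le_of_norm_inner_le {B : F →L[ℂ] F} {C : ℝ} (hC : 0 ≤ C)
    (h : ∀ x y, ‖⟪x, B y⟫_ℂ‖ ≤ C * ‖x‖ * ‖y‖) : ‖B‖ ≤ C := by
  refine B.opNorm_le_bound hC fun y => ?_
  rcases (norm_nonneg (B y)).eq_or_lt with h0 | h0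
  · rw [← h0]; positivity
  · refine le_of_mul_le_mul_right ?_ h0
    have h1 := h (B y) y
    rw [inner_self_eq_norm_sq_to_K, norm_pow, RCLike.norm_ofReal, abs_norm] at h1
    linarith

/-- Asymptotic isometry of a bounded family of operators can be tested on a total set. -/
lemma tendsto_inner_self_of_dense_span {κ : Type*} {l : Filter κ} {V : κ → F →L[ℂ] F} {R : ℝ}
    (hR : ∀ k, ‖V k‖ ≤ R) {s : Set F} (hs : Dense (Submodule.span ℂ s : Set F))
    (h : ∀ x ∈ s, ∀ y ∈ s, ∀ᶠ k in l, ⟪V k x, V k y⟫_ℂ = ⟪x, y⟫_ℂ) (x y : F) :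
    Filter.Tendsto (fun k => ⟪V k x, V k y⟫_ℂ) l (nhds ⟪x, y⟫_ℂ) := by
  have h1 : ∀ k x y, ⟪x, (star (V k) * V k) y⟫_ℂ = ⟪V k x, V k y⟫_ℂ := fun k x y => by
    rw [mul_apply_eq_comp, ContinuousLinearMap.star_eq_adjoint,
      ContinuousLinearMap.adjoint_inner_right]
  have h2 := tendsto_inner_of_dense_span (A := fun k => star (V k) * V k)
    (B := ContinuousLinearMap.id ℂ F) (R := R * R) (l := l) (fun k => ?_) hs
    (fun x hx y hy => ?_) x y
  · simpa only [h1, ContinuousLinearMap.id_apply] using h2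
  · refine (norm_mul_le _ _).trans (mul_le_mul ?_ (hR k) (norm_nonneg _)
      ((norm_nonneg _).trans (hR k)))
    rw [norm_star]
    exact hR k
  · refine tendsto_const_nhds.congr' ?_
    filter_upwards [h x hx y hy] with k hk
    rw [h1, hk, ContinuousLinearMap.id_apply]

lemma IsNormalTracialState.tendsto {M : VonNeumannAlgebra F} {τ : M.toStarSubalgebra →ₗ[ℂ] ℂ}
    (hτ : IsNormalTracialState M τ) {κ : Type*} {l : Filter κ} {A : κ → M.toStarSubalgebra}
    {B : M.toStarSubalgebra} (h : Filter.Tendsto A l (@nhds _ (ultraweakTopology M) B)) :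
    Filter.Tendsto (fun k => τ (A k)) l (nhds (τ B)) :=
  (@Continuous.tendsto _ _ (ultraweakTopology M) _ _ hτ.normal B).comp h

/-- A normal trace does not change under the compression by an asymptotically unitary bounded
sequence. -/
lemma IsNormalTracialState.exists_compression {M : VonNeumannAlgebra F}
    {τ : M.toStarSubalgebra →ₗ[ℂ] ℂ} (hτ : IsNormalTracialState M τ) {V : ℕ → F →L[ℂ] F}
    (hV : ∀ n, V n ∈ M.toStarSubalgebra) {R : ℝ} (hR : ∀ n, ‖V n‖ ≤ R)
    (h1 : ∀ x y, Filter.Tendsto (fun n => ⟪V n x, V n y⟫_ℂ) Filter.atTop (nhds ⟪x, y⟫_ℂ))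
    (h2 : ∀ x y, Filter.Tendsto (fun n => ⟪star (V n) x, star (V n) y⟫_ℂ) Filter.atTop
      (nhds ⟪x, y⟫_ℂ)) (A : M.toStarSubalgebra) :
    ∃ B : M.toStarSubalgebra, τ B = τ A ∧ ‖(B : F →L[ℂ] F)‖ ≤ ‖(A : F →L[ℂ] F)‖ ∧
      ∀ x y, Filter.Tendsto (fun n => ⟪V n x, (A : F →L[ℂ] F) (V n y)⟫_ℂ)
        (Filter.hyperfilter ℕ) (nhds ⟪x, (B : F →L[ℂ] F) y⟫_ℂ) := by
  have h0 : 0 ≤ R := (norm_nonneg _).trans (hR 0)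
  have hR' : ∀ n, ‖star (V n)‖ ≤ R := fun n => (norm_star (V n)).trans_le (hR n)
  let V' (n : ℕ) : M.toStarSubalgebra := ⟨V n, hV n⟩
  have hb : ∀ n, ‖star (V n) * ((A : F →L[ℂ] F) * V n)‖ ≤ R * (‖(A : F →L[ℂ] F)‖ * R) :=
    fun n => (norm_mul_le _ _).trans (mul_le_mul (hR' n) ((norm_mul_le _ _).trans
      (mul_le_mul_of_nonneg_left (hR n) (norm_nonneg _))) (norm_nonneg _) h0)
  obtain ⟨B, hB⟩ := exists_weak_limit (Filter.hyperfilter ℕ) hb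
  have hBM : B ∈ M := mem_of_tendsto M (fun n => (star (V' n) * (A * V' n)).2) hB
  have hB' : ∀ x y, Filter.Tendsto (fun n => ⟪V n x, (A : F →L[ℂ] F) (V n y)⟫_ℂ)
      (Filter.hyperfilter ℕ) (nhds ⟪x, B y⟫_ℂ) := fun x y =>
    (hB x y).congr fun n => ContinuousLinearMap.adjoint_inner_right _ _ _
  refine ⟨⟨B, hBM⟩, ?_, ?_, hB'⟩
  · have h3 : Filter.Tendsto (fun n => τ (star (V' n) * (A * V' n))) (Filter.hyperfilter ℕ)
        (nhds (τ ⟨B, hBM⟩)) :=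
      hτ.tendsto (tendsto_ultraweak_of_bounded M (Filter.Eventually.of_forall hb) hB)
    -- Since `V V* → 1` weakly and boundedly, `A V V* → A` ultraweakly; traciality identifies these
    -- traces with those of `V* A V`.
    have h4 : Filter.Tendsto (fun n => τ (A * (V' n * star (V' n)))) Filter.atTop
        (nhds (τ A)) := by
      refine hτ.tendsto (tendsto_ultraweak_of_bounded M (R := ‖(A : F →L[ℂ] F)‖ * (R * R))
        (Filter.Eventually.of_forall fun n => ?_) fun x y => ?_)
      · exact (norm_mul_le _ _).trans (mul_le_mul_of_nonneg_left ((norm_mul_le _ _).trans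
          (mul_le_mul (hR n) (hR' n) (norm_nonneg _) h0)) (norm_nonneg _))
      · have h5 := h2 (ContinuousLinearMap.adjoint (A : F →L[ℂ] F) x) y
        rw [ContinuousLinearMap.adjoint_inner_left] at h5
        refine h5.congr fun n => ?_
        rw [ContinuousLinearMap.star_eq_adjoint, ContinuousLinearMap.adjoint_inner_left,
          ContinuousLinearMap.adjoint_inner_left]
        rfl
    refine tendsto_nhds_unique h3 ((h4.mono_left Nat.hyperfilter_le_atTop).congr fun n => ?_)
    rw [hτ.tracial (star (V' n)), mul_assoc]
  -- Asymptotic isometry improves the crude bound `R² ‖A‖` to `‖A‖`. This matters because the bound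
  -- on `V` will grow with `m`.
  · have hn : ∀ x, Filter.Tendsto (fun n => ‖V n x‖) Filter.atTop (nhds ‖x‖) := fun x => by
      have h3 : ∀ z : F, √‖⟪z, z⟫_ℂ‖ = ‖z‖ := fun z => by
        rw [inner_self_eq_norm_sq_to_K, norm_pow, RCLike.norm_ofReal, abs_norm,
          Real.sqrt_sq (norm_nonneg _)]
      simpa only [h3] using (h1 x x).norm.sqrt
    refine opNorm_le_of_norm_inner_le (norm_nonneg _) fun x y => ?_
    have h3 := ((hn x).mul ((hn y).const_mul ‖(A : F →L[ℂ] F)‖)).mono_left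
      Nat.hyperfilter_le_atTop
    refine (le_of_tendsto_of_tendsto (hB' x y).norm h3 (Filter.Eventually.of_forall fun n =>
      (norm_inner_le_norm _ _).trans (mul_le_mul_of_nonneg_left
        (ContinuousLinearMap.le_opNorm _ _) (norm_nonneg _)))).trans_eq ?_
    ring

/-- A vector functional is one of the defining functionals, with both sequences concentrated at
index `0`. -/
lemma continuous_inner_apply (M : VonNeumannAlgebra F) (x y : F) :
    @Continuous _ _ (ultraweakTopology M) _ fun A : M.toStarSubalgebra =>
      ⟪x, (A : F →L[ℂ] F) y⟫_ℂ := by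
  have hs : ∀ z : F, Summable fun n : ℕ => ‖(Pi.single 0 z : ℕ → F) n‖ ^ 2 := fun z =>
    summable_of_ne_finset_zero (s := {0}) fun n hn => by
      rw [Pi.single_eq_of_ne (by simpa using hn)]; simp
  have h1 : ∀ A : F →L[ℂ] F,
      ∑' n, ⟪(Pi.single 0 x : ℕ → F) n, A ((Pi.single 0 y : ℕ → F) n)⟫_ℂ = ⟪x, A y⟫_ℂ := fun A => by
    rw [tsum_eq_single 0 fun n hn => by rw [Pi.single_eq_of_ne hn, inner_zero_left]]
    simp
  rw [@continuous_iff_continuousAt _ _ (ultraweakTopology M)]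
  intro B
  have h2 := (tendsto_ultraweak_iff M).1 (Filter.tendsto_id (x := @nhds _ (ultraweakTopology M) B))
    _ _ (hs x) (hs y)
  simp only [h1] at h2
  exact h2

end DoubleCommutant

/-! ### The one-particle space: test functions, multiplication operators, far unit vectors. -/

section OneParticle

variable (ν : Measure ℝ) [IsProbabilityMeasure ν]

/-- Measurable functions which are essentially bounded and supported in a bounded time interval. -/
structure IsTame (g : ℝ × ℝ → ℂ) : Prop where
  measurable : Measurable g
  bounded : ∃ C : ℝ, ∀ᵐ z ∂baseMeasure ν, ‖g z‖ ≤ C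
  support : ∃ N : ℕ, ∀ z, (N : ℝ) ≤ z.1 → g z = 0

variable {ν}

lemma baseMeasure_Iio_lt_top (N : ℝ) : baseMeasure ν (Set.Iio N ×ˢ Set.univ) < ∞ := by
  rw [Measure.prod_prod, measure_univ, mul_one, Measure.restrict_apply measurableSet_Iio]
  refine (measure_mono (t := Set.Icc 0 N) fun x hx => ⟨hx.2, hx.1.le⟩).trans_lt ?_
  simp

lemma IsTame.memLp {g : ℝ × ℝ → ℂ} (hg : IsTame ν g) (p : ℝ≥0∞) : MemLp g p (baseMeasure ν) := by
  obtain ⟨C, hC⟩ := hg.bounded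
  obtain ⟨N, hN⟩ := hg.support
  refine (memLp_indicator_const (μ := baseMeasure ν) p
    (measurableSet_Iio.prod MeasurableSet.univ : MeasurableSet (Set.Iio (N : ℝ) ×ˢ Set.univ)) C
    (Or.inr (baseMeasure_Iio_lt_top (ν := ν) N).ne)).mono hg.measurable.aestronglyMeasurable ?_
  filter_upwards [hC] with z hz
  by_cases h : (N : ℝ) ≤ z.1
  · rw [hN z h, norm_zero]; positivity
  · rw [Set.indicator_of_mem (by simpa using h)]
    exact hz.trans (le_abs_self C)

omit [IsProbabilityMeasure ν] in
lemma IsTame.add {g h : ℝ × ℝ → ℂ} (hg : IsTame ν g) (hh : IsTame ν h) : IsTame ν (g + h) := by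
  obtain ⟨C, hC⟩ := hg.bounded
  obtain ⟨D, hD⟩ := hh.bounded
  obtain ⟨N, hN⟩ := hg.support
  obtain ⟨M, hM⟩ := hh.support
  refine ⟨hg.measurable.add hh.measurable, ⟨C + D, ?_⟩, ⟨max N M, fun z hz => ?_⟩⟩
  · filter_upwards [hC, hD] with z h1 h2
    exact (norm_add_le _ _).trans (add_le_add h1 h2)
  · rw [Nat.cast_max, max_le_iff] at hz
    simp [hN z hz.1, hM z hz.2]

omit [IsProbabilityMeasure ν] in
lemma IsTame.mul {g h : ℝ × ℝ → ℂ} (hg : IsTame ν g) (hh : IsTame ν h) :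
    IsTame ν fun z => g z * h z := by
  obtain ⟨C, hC⟩ := hg.bounded
  obtain ⟨D, hD⟩ := hh.bounded
  obtain ⟨N, hN⟩ := hg.support
  refine ⟨hg.measurable.mul hh.measurable, ⟨C * D, ?_⟩, ⟨N, fun z hz => by simp [hN z hz]⟩⟩
  filter_upwards [hC, hD] with z h1 h2
  rw [norm_mul]
  exact mul_le_mul h1 h2 (norm_nonneg _) ((norm_nonneg _).trans h1)

omit [IsProbabilityMeasure ν] in
lemma IsTame.smul {g : ℝ × ℝ → ℂ} (hg : IsTame ν g) (c : ℂ) : IsTame ν (c • g) := by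
  obtain ⟨C, hC⟩ := hg.bounded
  obtain ⟨N, hN⟩ := hg.support
  refine ⟨hg.measurable.const_smul c, ⟨‖c‖ * C, ?_⟩, ⟨N, fun z hz => by simp [hN z hz]⟩⟩
  filter_upwards [hC] with z h1
  rw [Pi.smul_apply, norm_smul]
  exact mul_le_mul_of_nonneg_left h1 (norm_nonneg _)

omit [IsProbabilityMeasure ν] in
lemma IsTame.star {g : ℝ × ℝ → ℂ} (hg : IsTame ν g) : IsTame ν fun z => star (g z) := by
  obtain ⟨C, hC⟩ := hg.bounded
  obtain ⟨N, hN⟩ := hg.support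
  refine ⟨continuous_star.measurable.comp hg.measurable, ⟨C, ?_⟩, ⟨N, fun z hz => by simp [hN z hz]⟩⟩
  filter_upwards [hC] with z h1
  rwa [norm_star]

omit [IsProbabilityMeasure ν] in
lemma exists_ae_abs_le (hν : ∃ K : Set ℝ, IsCompact K ∧ ν Kᶜ = 0) :
    ∃ R : ℝ, 0 ≤ R ∧ ∀ᵐ z ∂baseMeasure ν, |z.2| ≤ R := by
  obtain ⟨K, hK, hK0⟩ := hν
  obtain ⟨R, hR⟩ := hK.isBounded.exists_norm_le
  have h1 : ∀ᵐ x ∂ν, x ∈ K := hK0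
  refine ⟨max R 0, le_max_right _ _, ?_⟩
  have h2 : ∀ᵐ z ∂baseMeasure ν, z.2 ∈ K :=
    Measure.quasiMeasurePreserving_snd.ae h1
  filter_upwards [h2] with z hz
  exact (hR _ hz).trans (le_max_left _ _)

omit [IsProbabilityMeasure ν] in
lemma isTame_snd_mul (hν : ∃ K : Set ℝ, IsCompact K ∧ ν Kᶜ = 0) {g : ℝ × ℝ → ℂ}
    (hg : IsTame ν g) : IsTame ν fun z => (z.2 : ℂ) * g z := by
  obtain ⟨R, hR0, hR⟩ := exists_ae_abs_le hν
  obtain ⟨C, hC⟩ := hg.bounded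
  obtain ⟨N, hN⟩ := hg.support
  refine ⟨(Complex.measurable_ofReal.comp measurable_snd).mul hg.measurable, ⟨R * C, ?_⟩,
    ⟨N, fun z hz => by simp [hN z hz]⟩⟩
  filter_upwards [hR, hC] with z h1 h2
  rw [norm_mul, Complex.norm_real]
  exact mul_le_mul h1 h2 (norm_nonneg _) hR0

lemma star_mono (a b : ℝ) (k : ℕ) (z : ℝ × ℝ) : star (mono a b k z) = mono a b k z := by
  rw [mono, star_mul', star_pow]
  congr 1
  · by_cases h : z.1 ∈ Set.Ico a b <;> simp [h]
  · simp

/-- The exponents add as `1 + (k - 1) + (m - 1) = (k + m) - 1`; this makes `𝒟` stable under `T_g`,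
so the Wick recursion stays within `𝒟`. -/
lemma snd_mul_mono_mul_mono (a b c d : ℝ) {k m : ℕ} (hk : 1 ≤ k) (hm : 1 ≤ m) :
    (fun z : ℝ × ℝ => (z.2 : ℂ) * mono a b k z * mono c d m z) =
      mono (max a c) (min b d) (k + m) := by
  ext z
  have h1 : (Set.Ico (max a c) (min b d)).indicator (fun _ => (1 : ℂ)) z.1 =
      (Set.Ico a b).indicator (fun _ => (1 : ℂ)) z.1 *
        (Set.Ico c d).indicator (fun _ => (1 : ℂ)) z.1 := by
    rw [← Set.Ico_inter_Ico, ← Set.inter_indicator_mul]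
    simp only [mul_one]
  obtain ⟨k, rfl⟩ := Nat.exists_eq_add_of_le' hk
  obtain ⟨m, rfl⟩ := Nat.exists_eq_add_of_le' hm
  rw [mono, mono, mono, h1, show k + 1 + (m + 1) - 1 = k + m + 1 by omega]
  simp only [Nat.add_sub_cancel, pow_add]
  ring

/-- No order between `a` and `b` is required, since intersections of time intervals may be empty. -/
lemma mono_mem_testSpace {a b : ℝ} (ha : 0 ≤ a) {k : ℕ} (hk : 1 ≤ k) :
    mono a b k ∈ testSpace := by
  rcases le_total a b with h | h
  · exact Submodule.subset_span ⟨a, b, k, ha, h, hk, rfl⟩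
  · have : mono a b k = 0 := by
      ext z
      simp [mono, Set.Ico_eq_empty_of_le h]
    rw [this]
    exact zero_mem _

lemma star_mem_testSpace {g : ℝ × ℝ → ℂ} (hg : g ∈ testSpace) :
    (fun z => star (g z)) ∈ testSpace := by
  refine Submodule.span_induction (p := fun g _ => (fun z => star (g z)) ∈ testSpace) ?_ ?_ ?_ ?_ hg
  · rintro _ ⟨a, b, k, ha, hab, hk, rfl⟩
    simp only [star_mono]
    exact mono_mem_testSpace ha hk
  · convert zero_mem testSpace using 1
    ext z; simp
  · intro g h _ _ hg hh
    convert add_mem hg hh using 1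
    ext z; simp
  · intro c g _ hg
    convert testSpace.smul_mem (star c) hg using 1
    ext z; simp

lemma snd_mul_mul_mem_testSpace {g h : ℝ × ℝ → ℂ} (hg : g ∈ testSpace) (hh : h ∈ testSpace) :
    (fun z => (z.2 : ℂ) * g z * h z) ∈ testSpace := by
  refine Submodule.span_induction
    (p := fun g _ => (fun z => (z.2 : ℂ) * g z * h z) ∈ testSpace) ?_ ?_ ?_ ?_ hg
  · rintro _ ⟨a, b, k, ha, hab, hk, rfl⟩
    refine Submodule.span_induction
      (p := fun h _ => (fun z => (z.2 : ℂ) * mono a b k z * h z) ∈ testSpace) ?_ ?_ ?_ ?_ hh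
    · rintro _ ⟨c, d, m, hc, hcd, hm, rfl⟩
      rw [snd_mul_mono_mul_mono a b c d hk hm]
      exact mono_mem_testSpace (le_max_of_le_left ha) (by omega)
    · convert zero_mem testSpace using 1
      ext z; simp
    · intro g h _ _ hg hh
      convert add_mem hg hh using 1
      ext z; simp [mul_add]
    · intro c g _ hg
      convert testSpace.smul_mem c hg using 1
      ext z; simp; ring
  · convert zero_mem testSpace using 1
    ext z; simp
  · intro g h _ _ hg hh
    convert add_mem hg hh using 1
    ext z; simp; ring
  · intro c g _ hg
    convert testSpace.smul_mem c hg using 1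
    ext z; simp; ring

lemma measurable_mono (a b : ℝ) (k : ℕ) : Measurable (mono a b k) :=
  ((measurable_const.indicator measurableSet_Ico).comp measurable_fst).mul
    ((Complex.measurable_ofReal.comp measurable_snd).pow_const _)

omit [IsProbabilityMeasure ν] in
lemma isTame_of_mem_testSpace (hν : ∃ K : Set ℝ, IsCompact K ∧ ν Kᶜ = 0) {g : ℝ × ℝ → ℂ}
    (hg : g ∈ testSpace) : IsTame ν g := by
  refine Submodule.span_induction (p := fun g _ => IsTame ν g) ?_ ?_ (fun _ _ _ _ => IsTame.add)
    (fun c _ _ h => h.smul c) hg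
  · rintro _ ⟨a, b, k, ha, hab, hk, rfl⟩
    obtain ⟨R, hR0, hR⟩ := exists_ae_abs_le hν
    refine ⟨measurable_mono a b k, ⟨R ^ (k - 1), ?_⟩, ⟨⌈b⌉₊, fun z hz => ?_⟩⟩
    · filter_upwards [hR] with z hz
      rw [mono, norm_mul, norm_pow, Complex.norm_real]
      refine (mul_le_of_le_one_left (by positivity) ?_).trans
        (pow_le_pow_left₀ (norm_nonneg _) hz _)
      exact (norm_indicator_le_norm_self _ _).trans (by simp)
    · have : z.1 ∉ Set.Ico a b := fun h => absurd ((Nat.le_ceil b).trans hz) (not_le.2 h.2)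
      simp [mono, this]
  · exact ⟨measurable_const, ⟨0, by simp⟩, ⟨0, by simp⟩⟩

omit [IsProbabilityMeasure ν] in
lemma vec_eq {g : ℝ × ℝ → ℂ} (hg : MemLp g 2 (baseMeasure ν)) : vec ν g = hg.toLp g :=
  dif_pos hg

lemma vec_add {g h : ℝ × ℝ → ℂ} (hg : IsTame ν g) (hh : IsTame ν h) :
    vec ν (g + h) = vec ν g + vec ν h := by
  rw [vec_eq (hg.memLp 2), vec_eq (hh.memLp 2), vec_eq ((hg.memLp 2).add (hh.memLp 2)),
    MemLp.toLp_add]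

lemma vec_smul {g : ℝ × ℝ → ℂ} (hg : IsTame ν g) (c : ℂ) : vec ν (c • g) = c • vec ν g := by
  rw [vec_eq (hg.memLp 2), vec_eq ((hg.memLp 2).const_smul c), MemLp.toLp_const_smul]

omit [IsProbabilityMeasure ν] in
lemma inner_vec {g h : ℝ × ℝ → ℂ} (hg : MemLp g 2 (baseMeasure ν))
    (hh : MemLp h 2 (baseMeasure ν)) :
    ⟪vec ν g, vec ν h⟫_ℂ = ∫ z, h z * star (g z) ∂baseMeasure ν := by
  rw [L2.inner_def]
  refine integral_congr_ae ?_
  rw [vec_eq hg, vec_eq hh]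
  filter_upwards [hg.coeFn_toLp, hh.coeFn_toLp] with z h1 h2
  rw [h1, h2]
  rfl

omit [IsProbabilityMeasure ν] in
lemma mulOp_eq {m : ℝ × ℝ → ℂ} (hm : MemLp m ∞ (baseMeasure ν)) : mulOp ν m =
    (ContinuousLinearMap.mul ℂ ℂ).holderL (baseMeasure ν) ∞ 2 2 (hm.toLp m) := dif_pos hm

omit [IsProbabilityMeasure ν] in
lemma mulOp_apply_ae {m : ℝ × ℝ → ℂ} (hm : MemLp m ∞ (baseMeasure ν)) (x : OneParticle ν) :
    mulOp ν m x =ᵐ[baseMeasure ν] fun z => m z * x z := by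
  rw [mulOp_eq hm, ContinuousLinearMap.holderL_apply_apply]
  filter_upwards [ContinuousLinearMap.coeFn_holder (r := 2) (ContinuousLinearMap.mul ℂ ℂ)
    (hm.toLp m) x, hm.coeFn_toLp] with z h1 h2
  rw [h1, h2]
  rfl

omit [IsProbabilityMeasure ν] in
lemma mulOp_vec {m g : ℝ × ℝ → ℂ} (hm : MemLp m ∞ (baseMeasure ν))
    (hg : MemLp g 2 (baseMeasure ν)) (hmg : MemLp (fun z => m z * g z) 2 (baseMeasure ν)) :
    mulOp ν m (vec ν g) = vec ν fun z => m z * g z := by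
  refine Lp.ext ?_
  rw [vec_eq hmg]
  filter_upwards [mulOp_apply_ae hm (vec ν g), hmg.coeFn_toLp, hg.coeFn_toLp] with z h1 h2 h3
  rw [h1, h2, vec_eq hg, h3]

omit [IsProbabilityMeasure ν] in
lemma mulOp_add {g h : ℝ × ℝ → ℂ} (hg : MemLp g ∞ (baseMeasure ν))
    (hh : MemLp h ∞ (baseMeasure ν)) : mulOp ν (g + h) = mulOp ν g + mulOp ν h := by
  rw [mulOp_eq hg, mulOp_eq hh, mulOp_eq (hg.add hh), MemLp.toLp_add, map_add]

omit [IsProbabilityMeasure ν] in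
lemma mulOp_smul {g : ℝ × ℝ → ℂ} (hg : MemLp g ∞ (baseMeasure ν)) (c : ℂ) :
    mulOp ν (c • g) = c • mulOp ν g := by
  rw [mulOp_eq hg, mulOp_eq (hg.const_smul c), MemLp.toLp_const_smul, map_smul]

omit [IsProbabilityMeasure ν] in
lemma inner_mulOp {m : ℝ × ℝ → ℂ} (hm : MemLp m ∞ (baseMeasure ν)) (hs : ∀ z, star (m z) = m z)
    (x y : OneParticle ν) : ⟪mulOp ν m x, y⟫_ℂ = ⟪x, mulOp ν m y⟫_ℂ := by
  rw [L2.inner_def, L2.inner_def]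
  refine integral_congr_ae ?_
  filter_upwards [mulOp_apply_ae hm x, mulOp_apply_ae hm y] with z h1 h2
  rw [h1, h2]
  have : (starRingEnd ℂ) (m z) = m z := hs z
  simp only [RCLike.inner_apply, map_mul, this]
  ring

omit [IsProbabilityMeasure ν] in
lemma norm_mulOp_le {m : ℝ × ℝ → ℂ} (hm : MemLp m ∞ (baseMeasure ν)) {R : ℝ} (hR : 0 ≤ R)
    (h : ∀ᵐ z ∂baseMeasure ν, ‖m z‖ ≤ R) : ‖mulOp ν m‖ ≤ R := by
  rw [mulOp_eq hm]
  have h1 : ‖hm.toLp m‖ ≤ R := by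
    rw [Lp.norm_toLp, eLpNorm_exponent_top]
    refine ENNReal.toReal_le_of_le_ofReal hR (eLpNormEssSup_le_of_ae_bound h)
  calc _ ≤ ‖(ContinuousLinearMap.mul ℂ ℂ).holderL (baseMeasure ν) ∞ 2 2‖ * ‖hm.toLp m‖ :=
        ContinuousLinearMap.le_opNorm _ _
    _ ≤ 1 * R := by
        gcongr
        exact (ContinuousLinearMap.norm_holderL_le _).trans
          (ContinuousLinearMap.opNorm_mul_le ℂ ℂ)
    _ = R := one_mul R

variable (ν) in
/-- The unit vector `χ_{[n, n + 1)} ⊗ 1`. -/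
def unitVec (n : ℕ) : OneParticle ν := vec ν (mono n (n + 1) 1)

variable (ν) in
/-- The operator of multiplication by `x χ_{[n, n + 1)}(t)`. -/
def unitOp (n : ℕ) : OneParticle ν →L[ℂ] OneParticle ν :=
  mulOp ν fun z => (z.2 : ℂ) * mono n (n + 1) 1 z

lemma unit_mem_testSpace (n : ℕ) : mono n (n + 1) 1 ∈ testSpace :=
  mono_mem_testSpace n.cast_nonneg le_rfl

lemma mono_one_mul_mono_one {j k : ℕ} (h : j ≠ k) (z : ℝ × ℝ) :
    mono j (j + 1) 1 z * mono k (k + 1) 1 z = 0 := by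
  have h1 : ¬ (z.1 ∈ Set.Ico (j : ℝ) (j + 1) ∧ z.1 ∈ Set.Ico (k : ℝ) (k + 1)) := by
    rintro ⟨⟨h1, h2⟩, h3, h4⟩
    have h5 : (j : ℝ) < k + 1 := h1.trans_lt h4
    have h6 : (k : ℝ) < j + 1 := h3.trans_lt h2
    norm_cast at h5 h6
    omega
  rw [not_and_or] at h1
  rcases h1 with h1 | h1 <;> simp [mono, h1]

variable (hν : ∃ K : Set ℝ, IsCompact K ∧ ν Kᶜ = 0)

include hν

lemma orthonormal_unitVec : Orthonormal ℂ (unitVec ν) := by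
  have hm : ∀ n : ℕ, MemLp (mono n (n + 1) 1) 2 (baseMeasure ν) := fun n =>
    (isTame_of_mem_testSpace hν (unit_mem_testSpace n)).memLp 2
  rw [orthonormal_iff_ite]
  intro j k
  rw [unitVec, unitVec, inner_vec (hm j) (hm k)]
  simp only [star_mono]
  split_ifs with h
  · subst h
    have h1 : (fun z : ℝ × ℝ => mono j (j + 1) 1 z * mono j (j + 1) 1 z) =
        (Set.Ico (j : ℝ) (j + 1) ×ˢ Set.univ).indicator fun _ => (1 : ℂ) := by
      ext z
      by_cases hz : z.1 ∈ Set.Ico (j : ℝ) (j + 1)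
      · rw [Set.indicator_of_mem (by exact ⟨hz, trivial⟩)]
        simp [mono, hz]
      · rw [Set.indicator_of_notMem (fun h => hz h.1)]
        simp [mono, hz]
    rw [h1, integral_indicator_const _ (measurableSet_Ico.prod MeasurableSet.univ), measureReal_def,
      Measure.prod_prod, Measure.restrict_apply measurableSet_Ico, measure_univ]
    have h2 : Set.Ico (j : ℝ) (j + 1) ∩ Set.Ici 0 = Set.Ico (j : ℝ) (j + 1) :=
      Set.inter_eq_left.2 fun x hx => le_trans j.cast_nonneg hx.1
    rw [h2]
    simp
  · simp [mono_one_mul_mono_one (Ne.symm h)]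

lemma memLp_top_snd_mul {g : ℝ × ℝ → ℂ} (hg : g ∈ testSpace) :
    MemLp (fun z : ℝ × ℝ => (z.2 : ℂ) * g z) ∞ (baseMeasure ν) :=
  (isTame_snd_mul hν (isTame_of_mem_testSpace hν hg)).memLp ∞

lemma mulOp_vec_testSpace {g h : ℝ × ℝ → ℂ} (hg : g ∈ testSpace) (hh : h ∈ testSpace) :
    mulOp ν (fun z => (z.2 : ℂ) * g z) (vec ν h) = vec ν fun z => (z.2 : ℂ) * g z * h z :=
  mulOp_vec (memLp_top_snd_mul hν hg) ((isTame_of_mem_testSpace hν hh).memLp 2)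
    ((isTame_of_mem_testSpace hν (snd_mul_mul_mem_testSpace hg hh)).memLp 2)

lemma inner_mulOp_mono {a b : ℝ} (ha : 0 ≤ a) {k : ℕ} (hk : 1 ≤ k) (x y : OneParticle ν) :
    ⟪mulOp ν (fun z => (z.2 : ℂ) * mono a b k z) x, y⟫_ℂ =
      ⟪x, mulOp ν (fun z => (z.2 : ℂ) * mono a b k z) y⟫_ℂ :=
  inner_mulOp (memLp_top_snd_mul hν (mono_mem_testSpace ha hk))
    (fun z => by rw [star_mul', star_mono]; simp) x y

lemma unitOp_unitVec (j k : ℕ) (h : j ≠ k) : unitOp ν j (unitVec ν k) = 0 := by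
  rw [unitOp, unitVec, mulOp_vec_testSpace hν (unit_mem_testSpace j) (unit_mem_testSpace k)]
  -- The zero function is written as a multiple of a test function so that `vec_smul` applies.
  have : (fun z : ℝ × ℝ => (z.2 : ℂ) * mono j (j + 1) 1 z * mono k (k + 1) 1 z) =
      (0 : ℂ) • mono 0 0 1 := by
    ext z
    rw [mul_assoc, mono_one_mul_mono_one h]
    simp
  rw [this, vec_smul (isTame_of_mem_testSpace hν (mono_mem_testSpace le_rfl le_rfl)), zero_smul]

/-- Supports are disjoint from late unit intervals. General square integrable `g` are allowed
because density is proved with continuous functions of compact support, not with `𝒟`. -/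
lemma vec_mem_localVectors {g : ℝ × ℝ → ℂ} (hg : MemLp g 2 (baseMeasure ν)) {N : ℕ}
    (hN : ∀ z, (N : ℝ) ≤ z.1 → g z = 0) : vec ν g ∈ localVectors (unitVec ν) (unitOp ν) := by
  refine ⟨N, fun k hk => ?_⟩
  have h1 : ∀ z, mono k (k + 1) 1 z * g z = 0 := fun z => by
    by_cases hz : z.1 ∈ Set.Ico (k : ℝ) (k + 1)
    · rw [hN z (le_trans (by exact_mod_cast hk) hz.1), mul_zero]
    · simp [mono, hz]
  constructor
  · rw [unitVec, inner_vec ((isTame_of_mem_testSpace hν (unit_mem_testSpace k)).memLp 2) hg]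
    simp only [star_mono, mul_comm (g _), h1, integral_zero]
  · refine Lp.ext ?_
    filter_upwards [mulOp_apply_ae (memLp_top_snd_mul hν (unit_mem_testSpace k)) (vec ν g),
      hg.coeFn_toLp, Lp.coeFn_zero ℂ 2 (baseMeasure ν)] with z h2 h3 h4
    rw [unitOp, h2, vec_eq hg, h3, h4, mul_assoc, h1, mul_zero]
    rfl

lemma vec_testSpace_mem_localVectors {g : ℝ × ℝ → ℂ} (hg : g ∈ testSpace) :
    vec ν g ∈ localVectors (unitVec ν) (unitOp ν) := by
  have h := isTame_of_mem_testSpace hν hg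
  obtain ⟨N, hN⟩ := h.support
  exact vec_mem_localVectors hν (h.memLp 2) hN

lemma dense_localVectors : Dense (localVectors (unitVec ν) (unitOp ν)) := by
  intro x
  rw [Metric.mem_closure_iff]
  intro ε hε
  obtain ⟨g, hg, hxg, -, hg2⟩ := (Lp.memLp x).exists_hasCompactSupport_eLpNorm_sub_le (by simp)
    (ε := ENNReal.ofReal (ε / 2)) (by simpa using hε)
  obtain ⟨N, hN⟩ : ∃ N : ℕ, ∀ z, (N : ℝ) ≤ z.1 → g z = 0 := by
    obtain ⟨R, hR⟩ := hg.isCompact.isBounded.exists_norm_le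
    refine ⟨⌈R⌉₊ + 1, fun z hz => ?_⟩
    by_contra hne
    have h1 := hR z (subset_tsupport g hne)
    have h2 : z.1 ≤ ‖z‖ := (le_abs_self _).trans (norm_fst_le z)
    have h3 := Nat.le_ceil R
    push_cast at hz
    linarith
  refine ⟨vec ν g, vec_mem_localVectors hν hg2 hN, ?_⟩
  rw [dist_eq_norm, vec_eq hg2, Lp.norm_def]
  have h1 : eLpNorm (x - hg2.toLp g : OneParticle ν) 2 (baseMeasure ν) ≤ ENNReal.ofReal (ε / 2) := by
    refine le_trans (le_of_eq (eLpNorm_congr_ae ?_)) hxg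
    filter_upwards [Lp.coeFn_sub x (hg2.toLp g), hg2.coeFn_toLp] with z h1 h2
    rw [h1, Pi.sub_apply, h2, Pi.sub_apply]
  exact (ENNReal.toReal_le_of_le_ofReal (by positivity) h1).trans_lt (half_lt_self hε)

end OneParticle

/-! ### Wick products: span, action on the vacuum, action across a far block. -/

section Wick

variable (q : Set.Ioo (-1 : ℝ) 1) {ν : Measure ℝ} [IsProbabilityMeasure ν]

variable (ν) in
/-- The generators of the von Neumann algebra of the `q`-Lévy process. -/
def levySet : Set (Fock q (OneParticle ν) →L[ℂ] Fock q (OneParticle ν)) :=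
  {A | ∃ (k : ℕ) (s : ℝ), 1 ≤ k ∧ 0 ≤ s ∧ A = Y q ν k s}

omit [IsProbabilityMeasure ν] in
lemma X_eq_fieldOp (g : ℝ × ℝ → ℂ) : X q ν g = fieldOp q (vec ν fun z => star (g z)) (vec ν g)
    (mulOp ν fun z => (z.2 : ℂ) * g z) := rfl

omit [IsProbabilityMeasure ν] in
lemma X_mono_eq_fieldOp (a b : ℝ) (k : ℕ) : X q ν (mono a b k) =
    fieldOp q (vec ν (mono a b k)) (vec ν (mono a b k))
      (mulOp ν fun z => (z.2 : ℂ) * mono a b k z) := by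
  simp only [X_eq_fieldOp, star_mono]

variable (hν : ∃ K : Set ℝ, IsCompact K ∧ ν Kᶜ = 0)

include hν

lemma star_X_mono {a b : ℝ} (ha : 0 ≤ a) {k : ℕ} (hk : 1 ≤ k) :
    star (X q ν (mono a b k)) = X q ν (mono a b k) := by
  rw [X_mono_eq_fieldOp, star_fieldOp q (inner_mulOp_mono hν ha hk)]

lemma star_mem_levySet : ∀ A ∈ levySet q ν, star A ∈ levySet q ν := by
  rintro _ ⟨k, s, hk, hs, rfl⟩
  exact ⟨k, s, hk, hs, star_X_mono q hν le_rfl hk⟩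

lemma X_add {g h : ℝ × ℝ → ℂ} (hg : g ∈ testSpace) (hh : h ∈ testSpace) :
    X q ν (g + h) = X q ν g + X q ν h := by
  have tg := isTame_of_mem_testSpace hν hg
  have th := isTame_of_mem_testSpace hν hh
  have h1 : (fun z => star ((g + h) z)) = (fun z => star (g z)) + fun z => star (h z) := by
    ext z; simp
  have h2 : (fun z : ℝ × ℝ => (z.2 : ℂ) * (g + h) z) =
      (fun z : ℝ × ℝ => (z.2 : ℂ) * g z) + fun z : ℝ × ℝ => (z.2 : ℂ) * h z := by
    ext z; simp [mul_add]
  rw [X, X, X, h1, h2, vec_add tg.star th.star, vec_add tg th,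
    mulOp_add (memLp_top_snd_mul hν hg) (memLp_top_snd_mul hν hh), annihilation_add, creation_add,
    gauge_add]
  abel

lemma X_smul {g : ℝ × ℝ → ℂ} (hg : g ∈ testSpace) (c : ℂ) : X q ν (c • g) = c • X q ν g := by
  have tg := isTame_of_mem_testSpace hν hg
  have h1 : (fun z => star ((c • g) z)) = star c • fun z => star (g z) := by
    ext z; simp
  have h2 : (fun z : ℝ × ℝ => (z.2 : ℂ) * (c • g) z) = c • fun z : ℝ × ℝ => (z.2 : ℂ) * g z := by
    ext z; simp; ring
  rw [X, X, h1, h2, vec_smul tg.star, vec_smul tg, mulOp_smul (memLp_top_snd_mul hν hg),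
    annihilation_smul, creation_smul, gauge_smul, star_star, smul_add, smul_add]

/-- Since `χ_[a,b) = χ_[0,b) - χ_[0,a)`, the operator of a spanning function is `Y_k(b) - Y_k(a)`.
-/
lemma X_mem_span {g : ℝ × ℝ → ℂ} (hg : g ∈ testSpace) :
    X q ν g ∈ Submodule.span ℂ (levySet q ν) := by
  have hY : ∀ {s : ℝ} {k : ℕ}, 0 ≤ s → 1 ≤ k →
      X q ν (mono 0 s k) ∈ Submodule.span ℂ (levySet q ν) := fun {s k} hs hk =>
    Submodule.subset_span ⟨k, s, hk, hs, rfl⟩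
  refine Submodule.span_induction
    (p := fun g _ => X q ν g ∈ Submodule.span ℂ (levySet q ν)) ?_ ?_ ?_ ?_ hg
  · rintro _ ⟨a, b, k, ha, hab, hk, rfl⟩
    have h1 : mono 0 b k = mono 0 a k + mono a b k := by
      ext z
      rw [Pi.add_apply, mono, mono, mono, ← add_mul, ← Set.Ico_union_Ico_eq_Ico ha hab,
        Set.indicator_union_of_disjoint (Set.Ico_disjoint_Ico_same)]
    have h2 := X_add q hν (mono_mem_testSpace (b := a) le_rfl hk) (mono_mem_testSpace (b := b) ha hk)
    rw [← h1] at h2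
    rw [← sub_eq_iff_eq_add'.2 h2]
    exact sub_mem (hY (ha.trans hab) hk) (hY ha hk)
  · have := X_smul q hν (zero_mem testSpace) 0
    rw [zero_smul, zero_smul] at this
    rw [this]
    exact zero_mem _
  · intro g h hg hh h1 h2
    rw [X_add q hν hg hh]
    exact add_mem h1 h2
  · intro c g hg h1
    rw [X_smul q hν hg]
    exact Submodule.smul_mem _ c h1

lemma X_mem_adjoin {g : ℝ × ℝ → ℂ} (hg : g ∈ testSpace) :
    X q ν g ∈ Algebra.adjoin ℂ (levySet q ν) :=
  Algebra.span_le_adjoin ℂ _ (X_mem_span q hν hg)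

omit [IsProbabilityMeasure ν] hν in
lemma eraseIdx_mem_testSpace {l : List (ℝ × ℝ → ℂ)} (hl : ∀ g ∈ l, g ∈ testSpace) (i : ℕ) :
    ∀ g ∈ l.eraseIdx i, g ∈ testSpace :=
  fun g hg => hl g ((List.eraseIdx_sublist l i).subset hg)

omit [IsProbabilityMeasure ν] hν in
lemma cons_eraseIdx_mem_testSpace {g : ℝ × ℝ → ℂ} (hg : g ∈ testSpace) {l : List (ℝ × ℝ → ℂ)}
    (hl : ∀ g ∈ l, g ∈ testSpace) (i : Fin l.length) :
    ∀ h ∈ (fun z : ℝ × ℝ => (z.2 : ℂ) * g z * l.get i z) :: l.eraseIdx i, h ∈ testSpace := by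
  intro h hh
  rcases List.mem_cons.1 hh with rfl | hh
  · exact snd_mul_mul_mem_testSpace hg (hl _ (List.get_mem l i))
  · exact eraseIdx_mem_testSpace hl i h hh

omit [IsProbabilityMeasure ν] hν in
/-- Induction along the recursion which defines the Wick products. -/
lemma wick_induction {p : List (ℝ × ℝ → ℂ) → Prop} (nil : p [])
    (cons : ∀ g l, g ∈ testSpace → (∀ h ∈ l, h ∈ testSpace) → p l →
      (∀ i : Fin l.length, p (l.eraseIdx i)) →
      (∀ i : Fin l.length,
        p ((fun z : ℝ × ℝ => (z.2 : ℂ) * g z * l.get i z) :: l.eraseIdx i)) → p (g :: l))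
    (l : List (ℝ × ℝ → ℂ)) (hl : ∀ g ∈ l, g ∈ testSpace) : p l := by
  obtain ⟨n, hn⟩ : ∃ n, l.length ≤ n := ⟨_, le_rfl⟩
  induction n generalizing l with
  | zero =>
    obtain rfl : l = [] := List.length_eq_zero_iff.1 (Nat.le_zero.1 hn)
    exact nil
  | succ n ih =>
    match l, hl, hn with
    | [], _, _ => exact nil
    | g :: l, hl, hn =>
      rw [List.length_cons, Nat.add_le_add_iff_right] at hn
      have hg := hl g List.mem_cons_self
      have hl' : ∀ h ∈ l, h ∈ testSpace := fun h hh => hl h (List.mem_cons_of_mem _ hh)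
      have he : ∀ i : Fin l.length, (l.eraseIdx i).length = l.length - 1 := fun i =>
        List.length_eraseIdx_of_lt i.2
      refine cons g l hg hl' (ih l hl' hn)
        (fun i => ih _ (eraseIdx_mem_testSpace hl' i) ?_)
        (fun i => ih _ (cons_eraseIdx_mem_testSpace hg hl' i) ?_)
      · rw [he]; omega
      · rw [List.length_cons, he]; have := i.2; omega

lemma wick_mem_adjoin (l : List (ℝ × ℝ → ℂ)) (hl : ∀ g ∈ l, g ∈ testSpace) :
    wick q ν l ∈ Algebra.adjoin ℂ (levySet q ν) := by
  refine wick_induction (p := fun l => wick q ν l ∈ Algebra.adjoin ℂ (levySet q ν)) ?_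
    (fun g l hg _ h1 h2 h3 => ?_) l hl
  · rw [wick]; exact one_mem _
  · rw [wick]
    exact sub_mem (sub_mem (mul_mem (X_mem_adjoin q hν hg) h1)
      (sum_mem fun i _ => Subalgebra.smul_mem _ (h2 i) _))
      (sum_mem fun i _ => Subalgebra.smul_mem _ (h3 i) _)

omit [IsProbabilityMeasure ν] hν in
variable (ν) in
/-- The span of the Wick products of vectors in the test space. -/
def wickSpan : Submodule ℂ (Fock q (OneParticle ν) →L[ℂ] Fock q (OneParticle ν)) :=
  Submodule.span ℂ (wick q ν '' {l | ∀ g ∈ l, g ∈ testSpace})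

-- Read backwards, the Wick recursion expresses a generator times a Wick product through Wick
-- products. So the span is stable under left multiplication by polynomials, and it contains `1`.
omit [IsProbabilityMeasure ν] hν in
lemma mem_wickSpan_of_mem_adjoin {A : Fock q (OneParticle ν) →L[ℂ] Fock q (OneParticle ν)}
    (hA : A ∈ Algebra.adjoin ℂ (levySet q ν)) : A ∈ wickSpan q ν := by
  suffices h : ∀ B ∈ wickSpan q ν, A * B ∈ wickSpan q ν by
    have h1 := h 1 (Submodule.subset_span ⟨[], by simp, by rw [wick]⟩)
    rwa [mul_one] at h1
  induction hA using Algebra.adjoin_induction with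
  | mem A hA =>
    obtain ⟨k, s, hk, hs, rfl⟩ := hA
    intro B hB
    induction hB using Submodule.span_induction with
    | mem B hB =>
      obtain ⟨l, hl, rfl⟩ := hB
      have hg : mono 0 s k ∈ testSpace := mono_mem_testSpace le_rfl hk
      have h1 : Y q ν k s * wick q ν l = wick q ν (mono 0 s k :: l)
          + ∑ i : Fin l.length, (((q : ℝ) : ℂ) ^ (i : ℕ)) •
              wick q ν ((fun z => (z.2 : ℂ) * mono 0 s k z * l.get i z) :: l.eraseIdx i)
          + ∑ i : Fin l.length, (((q : ℝ) : ℂ) ^ (i : ℕ) *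
              ⟪vec ν fun z => star (mono 0 s k z), vec ν (l.get i)⟫_ℂ) •
                wick q ν (l.eraseIdx i) := by
        rw [wick, Y]; abel
      rw [h1]
      refine add_mem (add_mem (Submodule.subset_span ⟨_, ?_, rfl⟩)
        (sum_mem fun i _ => Submodule.smul_mem _ _ (Submodule.subset_span ⟨_, ?_, rfl⟩)))
        (sum_mem fun i _ => Submodule.smul_mem _ _ (Submodule.subset_span ⟨_, ?_, rfl⟩))
      · intro h hh
        rcases List.mem_cons.1 hh with rfl | hh
        exacts [hg, hl h hh]
      · exact cons_eraseIdx_mem_testSpace hg hl i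
      · exact eraseIdx_mem_testSpace hl i
    | zero => rw [mul_zero]; exact zero_mem _
    | add B C _ _ hB hC => rw [mul_add]; exact add_mem hB hC
    | smul c B _ hB => rw [mul_smul_comm]; exact Submodule.smul_mem _ c hB
  | algebraMap c =>
    intro B hB
    rw [Algebra.algebraMap_eq_smul_one, smul_mul_assoc, one_mul]
    exact Submodule.smul_mem _ c hB
  | add A A' _ _ h h' =>
    intro B hB
    rw [add_mul]
    exact add_mem (h B hB) (h' B hB)
  | mul A A' _ _ h h' =>
    intro B hB
    rw [mul_assoc]
    exact h _ (h' B hB)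

omit [IsProbabilityMeasure ν] hν in
variable (ν) in
/-- The difference between `W(η₁ ⊗ ⋯ ⊗ ηₙ) ξ` and `η₁ ⊗ ⋯ ⊗ ηₙ ⊗ ξ`. -/
def wickDefect (l : List (ℝ × ℝ → ℂ)) (ξ : List (OneParticle ν)) : Fock q (OneParticle ν) :=
  wick q ν l (tensor q ξ) - tensor q (l.map (vec ν) ++ ξ)

/-- The subtracted terms of the Wick recursion are exactly the contractions of `g` with `l`. The
only new contribution is the middle difference: the contractions of `g` with factors of `ξ`. -/
lemma wickDefect_cons {g : ℝ × ℝ → ℂ} (hg : g ∈ testSpace) {l : List (ℝ × ℝ → ℂ)}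
    (hl : ∀ h ∈ l, h ∈ testSpace) (ξ : List (OneParticle ν)) :
    wickDefect q ν (g :: l) ξ = X q ν g (wickDefect q ν l ξ)
      + (X q ν g (tensor q (l.map (vec ν) ++ ξ)) - (tensor q (vec ν g :: l.map (vec ν) ++ ξ) +
        removalSum q (fun η w => contraction q (vec ν fun z => star (g z))
          (mulOp ν fun z => (z.2 : ℂ) * g z) η (w ++ ξ)) (l.map (vec ν))))
      + (-∑ i : Fin l.length, (((q : ℝ) : ℂ) ^ (i : ℕ) *
          ⟪vec ν fun z => star (g z), vec ν (l.get i)⟫_ℂ) • wickDefect q ν (l.eraseIdx i) ξ)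
      + (-∑ i : Fin l.length, (((q : ℝ) : ℂ) ^ (i : ℕ)) •
          wickDefect q ν ((fun z => (z.2 : ℂ) * g z * l.get i z) :: l.eraseIdx i) ξ) := by
  have h1 : removalSum q (fun η w => contraction q (vec ν fun z => star (g z))
      (mulOp ν fun z => (z.2 : ℂ) * g z) η (w ++ ξ)) (l.map (vec ν)) =
      ∑ i : Fin l.length, (((q : ℝ) : ℂ) ^ (i : ℕ) *
          ⟪vec ν fun z => star (g z), vec ν (l.get i)⟫_ℂ) •
            tensor q ((l.eraseIdx i).map (vec ν) ++ ξ) +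
      ∑ i : Fin l.length, (((q : ℝ) : ℂ) ^ (i : ℕ)) •
          tensor q (((fun z => (z.2 : ℂ) * g z * l.get i z) :: l.eraseIdx i).map (vec ν) ++ ξ) := by
    rw [removalSum_map, removalSum, ← Finset.sum_add_distrib]
    refine Finset.sum_congr rfl fun i _ => ?_
    rw [contraction, mulOp_vec_testSpace hν hg (hl _ (List.get_mem l i)), smul_add, smul_smul]
    rfl
  rw [h1]
  simp only [wickDefect, smul_sub, Finset.sum_sub_distrib, map_sub]
  rw [wick, sub_apply, sub_apply, mul_apply_eq_comp, sum_apply, sum_apply, List.map_cons]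
  simp only [smul_apply]
  abel

/-- With `ξ` empty there is nothing left to contract with, so the defect vanishes. -/
lemma wick_vacuum (l : List (ℝ × ℝ → ℂ)) (hl : ∀ g ∈ l, g ∈ testSpace) :
    wick q ν l (vacuum q (OneParticle ν)) = tensor q (l.map (vec ν)) := by
  suffices h : wickDefect q ν l [] = 0 by
    rw [wickDefect, List.append_nil, sub_eq_zero] at h
    exact h
  refine wick_induction (p := fun l => wickDefect q ν l [] = 0) ?_
    (fun g l hg hl h1 h2 h3 => ?_) l hl
  · rw [wickDefect, wick]; exact sub_self _
  · rw [wickDefect_cons q hν hg hl, h1]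
    simp only [h2, h3, X_eq_fieldOp, fieldOp_tensor, List.append_nil]
    simp

lemma eventually_testSpace_unitVec {g : ℝ × ℝ → ℂ} (hg : g ∈ testSpace) :
    ∀ᶠ k in Filter.atTop, ⟪vec ν fun z => star (g z), unitVec ν k⟫_ℂ = 0 ∧
      mulOp ν (fun z => (z.2 : ℂ) * g z) (unitVec ν k) = 0 := by
  obtain ⟨N, hN⟩ := vec_testSpace_mem_localVectors hν (star_mem_testSpace hg)
  obtain ⟨M, hM⟩ := vec_testSpace_mem_localVectors hν hg
  filter_upwards [Filter.eventually_ge_atTop N, Filter.eventually_ge_atTop M] with k h1 h2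
  refine ⟨by rw [← inner_conj_symm, (hN k h1).1, map_zero], ?_⟩
  -- Multiplication is commutative: `T_g fₖ = Sₖ g`, which vanishes for late `k`.
  rw [← (hM k h2).2, unitOp, unitVec, mulOp_vec_testSpace hν hg (unit_mem_testSpace k),
    mulOp_vec_testSpace hν (unit_mem_testSpace k) hg]
  congr 1
  ext z
  ring

lemma decays_wickDefect {ξ : List (OneParticle ν)}
    (hξ : ∀ ζ ∈ ξ, ζ ∈ localVectors (unitVec ν) (unitOp ν))
    (l : List (ℝ × ℝ → ℂ)) (hl : ∀ g ∈ l, g ∈ testSpace) :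
    Decays q fun m n => wickDefect q ν l (farList (unitVec ν) n m ++ ξ) := by
  refine wick_induction (p := fun l =>
    Decays q fun m n => wickDefect q ν l (farList (unitVec ν) n m ++ ξ)) ?_
    (fun g l hg hl h1 h2 h3 => ?_) l hl
  · refine decays_zero.congr fun m => Filter.Eventually.of_forall fun n => ?_
    rw [wickDefect, wick]
    exact (sub_self _).symm
  · simp only [wickDefect_cons q hν hg hl, ← Finset.sum_neg_distrib, ← neg_smul]
    refine Decays.add (Decays.add (Decays.add (h1.map _) ?_)
      (Decays.sum fun i _ => (h2 i).smul _)) (Decays.sum fun i _ => (h3 i).smul _)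
    exact decays_fieldOp_tensor q (orthonormal_unitVec hν) hξ (l.map (vec ν)) (vec ν g)
      (eventually_testSpace_unitVec hν hg)

/-- The defect decays as a vector, and the leading tensor begins with a local vector, so
`decays_inner_tensor` applies; this is where the order of the Wick product must be positive. -/
lemma decays_inner_wick {ξ ξ' : List (OneParticle ν)}
    (hξ : ∀ ζ ∈ ξ, ζ ∈ localVectors (unitVec ν) (unitOp ν))
    (hξ' : ∀ ζ ∈ ξ', ζ ∈ localVectors (unitVec ν) (unitOp ν))
    {l : List (ℝ × ℝ → ℂ)} (hl0 : 0 < l.length) (hl : ∀ g ∈ l, g ∈ testSpace) :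
    Decays q fun m n => ⟪tensor q (farList (unitVec ν) n m ++ ξ'),
      wick q ν l (tensor q (farList (unitVec ν) n m ++ ξ))⟫_ℂ := by
  match l, hl0, hl with
  | g :: l, _, hl =>
    have h1 := decays_inner_tensor q (orthonormal_unitVec hν) hξ hξ'
      (vec_testSpace_mem_localVectors hν (hl g List.mem_cons_self)) (l.map (vec ν))
    have h2 : Decays q fun m n => ⟪tensor q (farList (unitVec ν) n m ++ ξ'),
        wickDefect q ν (g :: l) (farList (unitVec ν) n m ++ ξ)⟫_ℂ := by
      obtain ⟨C, hC⟩ := decays_wickDefect q hν hξ (g :: l) hl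
      refine ⟨‖tensor q ξ'‖ * C, fun m => ?_⟩
      filter_upwards [hC m, eventually_isFar hξ'] with n h3 h4
      refine (norm_inner_le_norm _ _).trans ?_
      rw [norm_tensor_farList q (orthonormal_unitVec hν) h4, mul_assoc]
      exact mul_le_mul_of_nonneg_left h3 (norm_nonneg _)
    refine (h2.add h1).congr fun m => Filter.Eventually.of_forall fun n => ?_
    rw [← inner_add_right, wickDefect, List.map_cons, sub_add_cancel]

end Wick

/-! ### Vanishing of the trace on Wick products and identification with the vacuum state. -/

section Trace

variable (q : Set.Ioo (-1 : ℝ) 1) {ν : Measure ℝ} [IsProbabilityMeasure ν]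

variable (ν) in
/-- The product `X(fₙ) ⋯ X(f_{n + m - 1})` for the unit vectors `fₖ = χ_{[k, k + 1)} ⊗ 1`. -/
def unitProd (n m : ℕ) : Fock q (OneParticle ν) →L[ℂ] Fock q (OneParticle ν) :=
  farProd q (unitVec ν) (unitOp ν) n m

variable (hν : ∃ K : Set ℝ, IsCompact K ∧ ν Kᶜ = 0)

include hν

lemma unitProd_mem (n m : ℕ) : unitProd q ν n m ∈ (levyAlgebra q ν).toStarSubalgebra := by
  induction m generalizing n with
  | zero => exact one_mem _
  | succ m ih =>
    refine mul_mem ?_ (ih (n + 1))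
    have h := X_mem_adjoin q hν (unit_mem_testSpace n)
    rw [X_mono_eq_fieldOp] at h
    exact adjoin_subset_generated (star_mem_levySet q hν) h

/-- Uniformity in `n` is what matters: the limit in `n` is taken for fixed `m`, so growth in `m` is
harmless. -/
lemma exists_norm_unitProd_le : ∃ R : ℝ, ∀ n m, ‖unitProd q ν n m‖ ≤ R ^ m := by
  obtain ⟨R, hR0, hR⟩ := exists_ae_abs_le hν
  have hC := (fockConst_pos q).le
  have h1 : ∀ k, ‖unitOp ν k‖ ≤ R := fun k => by
    refine norm_mulOp_le (memLp_top_snd_mul hν (unit_mem_testSpace k)) hR0 ?_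
    filter_upwards [hR] with z hz
    rw [norm_mul, Complex.norm_real]
    refine (mul_le_of_le_one_right (norm_nonneg _) ?_).trans hz
    rw [mono, Nat.sub_self, pow_zero, mul_one]
    exact (norm_indicator_le_norm_self _ _).trans (by simp)
  refine ⟨√(fockConst q) + √(fockConst q) + fockConst q * R,
    norm_farProd_le q fun k => ?_⟩
  refine (norm_add_le _ _).trans (add_le_add ((norm_add_le _ _).trans (add_le_add ?_ ?_)) ?_)
  · simpa [(orthonormal_unitVec hν).1 k] using norm_annihilation_le q (unitVec ν k)
  · simpa [(orthonormal_unitVec hν).1 k] using norm_creation_le q (unitVec ν k)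
  · exact (norm_gauge_le q _).trans (mul_le_mul_of_nonneg_left (h1 k) hC)

lemma dense_span_local : Dense (Submodule.span ℂ
    (tensor q '' {l | ∀ ζ ∈ l, ζ ∈ localVectors (unitVec ν) (unitOp ν)}) :
      Set (Fock q (OneParticle ν))) :=
  dense_tensorSpan q (dense_localVectors hν)

lemma unitProd_tensor (m : ℕ) {l : List (OneParticle ν)}
    (hl : ∀ ζ ∈ l, ζ ∈ localVectors (unitVec ν) (unitOp ν)) :
    ∀ᶠ n in Filter.atTop,
      unitProd q ν n m (tensor q l) = tensor q (farList (unitVec ν) n m ++ l) := by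
  filter_upwards [eventually_isFar hl] with n h
  exact farProd_tensor q (orthonormal_unitVec hν) (unitOp_unitVec hν) h

lemma tendsto_inner_unitProd (m : ℕ) (x y : Fock q (OneParticle ν)) :
    Filter.Tendsto (fun n => ⟪unitProd q ν n m x, unitProd q ν n m y⟫_ℂ) Filter.atTop
      (nhds ⟪x, y⟫_ℂ) := by
  obtain ⟨R, hR⟩ := exists_norm_unitProd_le q hν
  refine tendsto_inner_self_of_dense_span (fun n => hR n m) (dense_span_local q hν) ?_ x y
  rintro _ ⟨l, hl, rfl⟩ _ ⟨l', hl', rfl⟩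
  filter_upwards [unitProd_tensor q hν m hl, unitProd_tensor q hν m hl', eventually_isFar hl']
    with n h1 h2 h3
  rw [h1, h2, inner_tensor_farList q (orthonormal_unitVec hν) l h3]

lemma tendsto_inner_star_unitProd (m : ℕ) (x y : Fock q (OneParticle ν)) :
    Filter.Tendsto (fun n => ⟪star (unitProd q ν n m) x, star (unitProd q ν n m) y⟫_ℂ)
      Filter.atTop (nhds ⟪x, y⟫_ℂ) := by
  obtain ⟨R, hR⟩ := exists_norm_unitProd_le q hν
  refine tendsto_inner_self_of_dense_span (R := R ^ m) (fun n => ?_) (dense_span_local q hν) ?_ x y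
  · rw [norm_star]; exact hR n m
  rintro _ ⟨l, hl, rfl⟩ _ ⟨l', hl', rfl⟩
  filter_upwards [eventually_isFar hl, eventually_isFar hl'] with n h1 h2
  exact inner_star_farProd_tensor q (orthonormal_unitVec hν) (unitOp_unitVec hν)
    (fun k => inner_mulOp_mono hν k.cast_nonneg le_rfl) h1 h2

lemma trace_wick_eq_zero {τ : (levyAlgebra q ν).toStarSubalgebra →ₗ[ℂ] ℂ}
    (hτ : IsNormalTracialState (levyAlgebra q ν) τ) {l : List (ℝ × ℝ → ℂ)} (hl0 : 0 < l.length)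
    (hl : ∀ g ∈ l, g ∈ testSpace)
    (hW : wick q ν l ∈ (levyAlgebra q ν).toStarSubalgebra) : τ ⟨wick q ν l, hW⟩ = 0 := by
  obtain ⟨R, hR⟩ := exists_norm_unitProd_le q hν
  choose B hBτ hBn hB using fun m => hτ.exists_compression (fun n => unitProd_mem q hν n m)
    (fun n => hR n m) (tendsto_inner_unitProd q hν m) (tendsto_inner_star_unitProd q hν m)
    ⟨wick q ν l, hW⟩
  -- The bound `‖B m‖ ≤ ‖W‖` is uniform in `m`, so ultraweak convergence follows from matrix
  -- elements between local tensors, which are at most `C |q|^m`.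
  have h1 : Filter.Tendsto B Filter.atTop (@nhds _ (ultraweakTopology (levyAlgebra q ν)) 0) := by
    refine tendsto_ultraweak_of_bounded _ (Filter.Eventually.of_forall hBn) fun x y => ?_
    refine tendsto_inner_of_dense_span hBn (dense_span_local q hν) ?_ x y
    rintro _ ⟨ξ', hξ', rfl⟩ _ ⟨ξ, hξ, rfl⟩
    obtain ⟨C, hC⟩ := decays_inner_wick q hν hξ hξ' hl0 hl
    have h2 : ∀ m, ‖⟪tensor q ξ', (B m : Fock q (OneParticle ν) →L[ℂ] Fock q (OneParticle ν))
        (tensor q ξ)⟫_ℂ‖ ≤ C * |(q : ℝ)| ^ m := fun m => by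
      refine le_of_tendsto (hB m _ _).norm (Nat.hyperfilter_le_atTop ?_)
      filter_upwards [hC m, unitProd_tensor q hν m hξ, unitProd_tensor q hν m hξ'] with n h3 h4 h5
      rw [h4, h5]
      exact h3
    have h3 : Filter.Tendsto (fun m => C * |(q : ℝ)| ^ m) Filter.atTop (nhds 0) := by
      simpa using (tendsto_pow_atTop_nhds_zero_of_lt_one (abs_nonneg _) (abs_lt.2 q.2)).const_mul C
    have h4 := squeeze_zero_norm h2 h3
    simpa using h4
  have h2 := hτ.tendsto h1
  simp only [hBτ, map_zero] at h2
  exact tendsto_nhds_unique tendsto_const_nhds h2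

lemma trace_eq_vacuum {τ : (levyAlgebra q ν).toStarSubalgebra →ₗ[ℂ] ℂ}
    (hτ : IsNormalTracialState (levyAlgebra q ν) τ) (A : (levyAlgebra q ν).toStarSubalgebra) :
    τ A = ⟪vacuum q (OneParticle ν), (A : Fock q (OneParticle ν) →L[ℂ] Fock q (OneParticle ν))
      (vacuum q (OneParticle ν))⟫_ℂ := by
  have hS := star_mem_levySet q hν
  have hle : ∀ {A}, A ∈ wickSpan q ν → A ∈ (levyAlgebra q ν).toStarSubalgebra := fun {A} hA => by
    refine adjoin_subset_generated hS ?_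
    refine (Submodule.span_le (p := Subalgebra.toSubmodule (Algebra.adjoin ℂ (levySet q ν)))).2
      ?_ hA
    rintro _ ⟨l, hl, rfl⟩
    exact wick_mem_adjoin q hν l hl
  have key : ∀ A (hA : A ∈ wickSpan q ν), τ ⟨A, hle hA⟩ =
      ⟪vacuum q (OneParticle ν), A (vacuum q (OneParticle ν))⟫_ℂ := by
    intro A hA
    induction hA using Submodule.span_induction with
    | mem A hA =>
      obtain ⟨l, hl, rfl⟩ := hA
      rw [wick_vacuum q hν l hl]
      rcases Nat.eq_zero_or_pos l.length with h0 | h0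
      · obtain rfl := List.length_eq_zero_iff.1 h0
        have h1 : (⟨wick q ν [], hle (Submodule.subset_span ⟨[], hl, rfl⟩)⟩ :
            (levyAlgebra q ν).toStarSubalgebra) = 1 := Subtype.ext (by change wick q ν [] = 1; rw [wick])
        rw [h1, hτ.map_one, vacuum, List.map_nil, inner_tensor, qKernel]
        simp [inversions]
      -- The vacuum expectation vanishes too: `W Ω` is a tensor of positive order, orthogonal to
      -- `Ω`.
      · rw [trace_wick_eq_zero q hν hτ h0 hl, vacuum, inner_tensor, qKernel, if_neg]
        simpa using h0.ne
    | zero => exact (map_zero τ).trans (by simp)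
    | add A B hA hB h1 h2 =>
      rw [add_apply, inner_add_right, ← h1, ← h2, ← map_add]
      rfl
    | smul c A hA h1 =>
      rw [smul_apply, inner_smul_right, ← h1, ← smul_eq_mul, ← map_smul]
      rfl
  exact congrFun (eq_of_eqOn_adjoin hS hτ.normal (continuous_inner_apply _ _ _)
    fun A hA => key A (mem_wickSpan_of_mem_adjoin q hA)) A

end Trace

end QLevy

end

theorem mainTheorem2 (q : Set.Ioo (-1 : ℝ) 1) (ν : Measure ℝ) [IsProbabilityMeasure ν]
    (hν : ∃ K : Set ℝ, IsCompact K ∧ ν Kᶜ = 0)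
    (τ : (QLevy.levyAlgebra q ν).toStarSubalgebra →ₗ[ℂ] ℂ)
    (hτ : QLevy.IsNormalTracialState (QLevy.levyAlgebra q ν) τ) :
    (∀ l : List (ℝ × ℝ → ℂ), 0 < l.length → (∀ g ∈ l, g ∈ QLevy.testSpace) →
      ∃ hW : QLevy.wick q ν l ∈ (QLevy.levyAlgebra q ν).toStarSubalgebra,
        τ ⟨QLevy.wick q ν l, hW⟩ = 0) ∧
    ∀ A : (QLevy.levyAlgebra q ν).toStarSubalgebra,
      τ A = ⟪QLevy.vacuum q (QLevy.OneParticle ν),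
        (A : QLevy.Fock q (QLevy.OneParticle ν) →L[ℂ] QLevy.Fock q (QLevy.OneParticle ν))
          (QLevy.vacuum q (QLevy.OneParticle ν))⟫_ℂ := by
  refine ⟨fun l hl0 hl => ?_, QLevy.trace_eq_vacuum q hν hτ⟩
  have hW := QLevy.adjoin_subset_generated (QLevy.star_mem_levySet q hν)
    (QLevy.wick_mem_adjoin q hν l hl)
  exact ⟨hW, QLevy.trace_wick_eq_zero q hν hτ hl0 hl hW⟩
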